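/- Let $Q\ge 8$ be even, let $\mathbf k_j=(\cos\frac{2\pi (j-1)}{Q},\sin\frac{2\pi (j-1)}{Q})$ for $j=1,\dots,Q$, and let $\Gamma=\{\sum_j m_j\mathbf k_j:\ \mathbf m\in\mathbb N^Q\}\subset\mathbb R^2$. For $\mathbf k\in\Gamma$ let $N_{\mathbf k}$ be the minimum of $\sum_j m_j$ over all $\mathbf m\in\mathbb N^Q$ with $\sum_j m_j\mathbf k_j=\mathbf k$, and let $$\mathcal H_s=\Big\{U=\sum_{\mathbf k\in\Gamma}U_{\mathbf k}e^{i\mathbf k\cdot\mathbf x}:\ \|U\|_s^2=\sum_{\mathbf k\in\Gamma}(1+N_{\mathbf k}^2)^s|U_{\mathbf k}|^2<\infty\Big\}.$$ Put $l=\frac12\varphi(Q)-1$, with $\varphi$ Euler's totient function, and $\beta=3(Q-1)$, and let $s>Q/4$. There is exactly one sequence $(U^{(n)})_{n\ge0}$ in $\mathcal H_s$, all of whose terms are invariant under rotation by $2\pi/Q$, with $U^{(0)}=\sum_{j=1}^Qe^{i\mathbf k_j\cdot\mathbf x}$, such that $\sqrt{\mu/\beta}\,\sum_{n\ge0}\mu^nU^{(n)}$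 is a formal solution of $(1+\Delta)^2U-\mu U+U^3=0$. There are $K>0$ and $\gamma$ with $\|U^{(n)}\|_s\le\gamma K^n(n!)^{4l}$ for all $n\ge0$. For any $K>0$ for which such an estimate holds with some $\gamma$, and any $K'>K^{1/4l}$, define for $\mu>0$, with $\nu=\mu^{1/4l}$, $$\bar U=\frac1\nu\int_0^{1/K'}e^{-\zeta/\nu}\,\widehat U(\zeta)\,d\zeta,\qquad \widehat U(\zeta)=\frac1{\sqrt\beta}\sum_{n\ge0}\frac{\zeta^{4ln+2l}}{(4ln+2l)!}\,U^{(n)},$$ and let $c=1/K'$. Then there are $\alpha>0$ and $C'>0$, independent of $\mu$ and $t$, such that for every $\mu>0$: $\bar U\in\mathcal H_{s+4}$, the initial value problem $$\frac{\partial U}{\partial t}=\mu U-(1+\Delta)^2U-U^3,\qquad U|_{t=0}=\bar U,$$ has a solution $U(t)$ in $\mathcal H_s$ for $0\le t\le\alpha/\mu^{1+1/4l}$ (the time derivative being taken in $\mathcal H_s$), any solution on a shorter interval $[0,T]$ coincides with it there, it is real-valued, and $$\|U(t)-\bar U\|_s\le C'e^{-c/\mu^{1/4l}}\qquad\text{for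 } 0\le t\le\frac{\alpha}{\mu^{1+1/4l}}.$$ -/

import Mathlib

namespace SwiftHohenberg

noncomputable section

/-! The plane of wavevectors is identified with the complex numbers, so that the Euclidean length
of a wavevector is the complex modulus and the rotation of angle `2π/Q` is the multiplication by
`exp (2πi/Q)`. -/

/-- The basic wavevector `(cos (2πj/Q), sin (2πj/Q))`, for `j = 0, …, Q - 1`. -/
def waveVector (Q : ℕ) (j : ℕ) : ℂ :=
  Complex.exp (2 * Real.pi * Complex.I * (j / Q))

/-- The wavevector `k_m = ∑ⱼ mⱼ kⱼ` of a tuple `m` of natural numbers. -/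
def waveSum (Q : ℕ) (m : Fin Q → ℕ) : ℂ :=
  ∑ j : Fin Q, (m j : ℂ) * waveVector Q j

/-- The quasilattice `Γ`: all `k_m` with `m ∈ ℕ^Q`. -/
def quasilattice (Q : ℕ) : Set ℂ :=
  Set.range (waveSum Q)

/-- The order `N_k` of `k ∈ Γ`: the minimum of `∑ⱼ mⱼ` over all `m ∈ ℕ^Q` with `k_m = k`. -/
def order (Q : ℕ) (k : ℂ) : ℕ :=
  sInf {n : ℕ | ∃ m : Fin Q → ℕ, waveSum Q m = k ∧ ∑ j, m j = n}

/-- The formal quasiperiodic series `∑_{k ∈ Γ} U_k exp (i k · x)`, given by its coefficients. -/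
abbrev Coeffs (Q : ℕ) : Type := quasilattice Q → ℂ

/-- The weight `(1 + N_k²)^s`. -/
def weight (Q : ℕ) (s : ℝ) (k : quasilattice Q) : ℝ :=
  (1 + (order Q k : ℝ) ^ 2) ^ s

/-- Membership in `H_s`: `∑_{k ∈ Γ} (1 + N_k²)^s |U_k|² < ∞`. -/
def MemHs (Q : ℕ) (s : ℝ) (U : Coeffs Q) : Prop :=
  Summable fun k => weight Q s k * ‖U k‖ ^ 2

theorem weight_pos (Q : ℕ) (s : ℝ) (k : quasilattice Q) : 0 < weight Q s k := by
  unfold weight; positivity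

theorem weighted_sq (Q : ℕ) (s : ℝ) (U : Coeffs Q) (k : quasilattice Q) :
    ‖((Real.sqrt (weight Q s k) : ℝ) : ℂ) * U k‖ ^ 2 = weight Q s k * ‖U k‖ ^ 2 := by
  rw [norm_mul, mul_pow, Complex.norm_real, Real.norm_eq_abs, sq_abs,
    Real.sq_sqrt (weight_pos Q s k).le]

theorem memHs_iff (Q : ℕ) (s : ℝ) (U : Coeffs Q) :
    MemHs Q s U ↔
      Memℓp (fun k : quasilattice Q => ((Real.sqrt (weight Q s k) : ℝ) : ℂ) * U k) 2 := by
  rw [memℓp_gen_iff (by norm_num)]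
  unfold MemHs
  refine summable_congr fun k => ?_
  rw [← weighted_sq]
  norm_num

/-- `H_s` as a linear subspace of the space of all coefficient families. -/
def hsSubmodule (Q : ℕ) (s : ℝ) : Submodule ℂ (Coeffs Q) where
  carrier := {U | MemHs Q s U}
  zero_mem' := by
    simp only [Set.mem_ofPred_eq, MemHs, Pi.zero_apply, norm_zero]
    simp [summable_zero]
  add_mem' := by
    intro U V hU hV
    simp only [Set.mem_ofPred_eq, memHs_iff] at hU hV ⊢
    convert hU.add hV using 1
    funext k
    simp [mul_add]
  smul_mem' := by
    intro a U hU
    simp only [Set.mem_ofPred_eq, memHs_iff] at hU ⊢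
    convert hU.const_smul a using 1
    funext k
    simp only [Pi.smul_apply, smul_eq_mul]
    ring

/-- The space `H_s`. It is a type of its own, so that its topology is that of `‖·‖_s`. -/
def Hs (Q : ℕ) (s : ℝ) : Type := hsSubmodule Q s

instance (Q : ℕ) (s : ℝ) : AddCommGroup (Hs Q s) :=
  inferInstanceAs (AddCommGroup (hsSubmodule Q s))

instance (Q : ℕ) (s : ℝ) : Module ℂ (Hs Q s) :=
  inferInstanceAs (Module ℂ (hsSubmodule Q s))

/-- The family of Fourier coefficients of an element of `H_s`. -/
def Hs.coeff {Q : ℕ} {s : ℝ} (U : Hs Q s) : Coeffs Q := U.1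

/-- The embedding `U ↦ ((1 + N_k²)^{s/2} U_k)_k` of `H_s` into `ℓ²(Γ)`. -/
def Hs.toL2 (Q : ℕ) (s : ℝ) : Hs Q s →ₗ[ℂ] lp (fun _ : quasilattice Q => ℂ) 2 where
  toFun U := ⟨fun k => ((Real.sqrt (weight Q s k) : ℝ) : ℂ) * U.coeff k,
    (memHs_iff Q s U.coeff).1 U.2⟩
  map_add' U V := by
    ext k
    exact mul_add _ _ _
  map_smul' a U := by
    ext k
    exact mul_left_comm _ _ _

theorem Hs.toL2_injective (Q : ℕ) (s : ℝ) : Function.Injective (Hs.toL2 Q s) := by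
  intro U V h
  apply Subtype.ext
  funext k
  have hk : ((Real.sqrt (weight Q s k) : ℝ) : ℂ) * U.coeff k
      = ((Real.sqrt (weight Q s k) : ℝ) : ℂ) * V.coeff k :=
    congrFun (congrArg Subtype.val h) k
  exact mul_left_cancel₀
    (Complex.ofReal_ne_zero.2 (Real.sqrt_pos.2 (weight_pos Q s k)).ne') hk

/-- The norm of `H_s`, `‖U‖_s² = ∑_{k ∈ Γ} (1 + N_k²)^s |U_k|²` (see `Hs.norm_sq`). -/
instance (Q : ℕ) (s : ℝ) : NormedAddCommGroup (Hs Q s) :=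
  NormedAddCommGroup.induced (Hs Q s) (lp (fun _ : quasilattice Q => ℂ) 2) (Hs.toL2 Q s)
    (Hs.toL2_injective Q s)

instance (Q : ℕ) (s : ℝ) : NormedSpace ℂ (Hs Q s) :=
  NormedSpace.induced ℂ (Hs Q s) (lp (fun _ : quasilattice Q => ℂ) 2) (Hs.toL2 Q s)

instance (Q : ℕ) (s : ℝ) : NormedSpace ℝ (Hs Q s) :=
  NormedSpace.restrictScalars ℝ ℂ (Hs Q s)

theorem Hs.norm_sq {Q : ℕ} {s : ℝ} (U : Hs Q s) :
    ‖U‖ ^ 2 = ∑' k : quasilattice Q, weight Q s k * ‖U.coeff k‖ ^ 2 := by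
  have h : ‖U‖ = ‖Hs.toL2 Q s U‖ := rfl
  have h2 := lp.norm_rpow_eq_tsum (p := 2) (by norm_num) (Hs.toL2 Q s U)
  norm_num at h2
  rw [h, h2]
  exact tsum_congr fun k => weighted_sq Q s U.coeff k

/-- The operator `L₀ = (1 + Δ)²`, which multiplies `exp (i k · x)` by `(1 - |k|²)²`. -/
def linOp (Q : ℕ) (U : Coeffs Q) : Coeffs Q :=
  fun k => (((1 - ‖(k : ℂ)‖ ^ 2) ^ 2 : ℝ) : ℂ) * U k

/-- The Fourier coefficients of the product `U V W` of three series. -/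
def prod3 (Q : ℕ) (U V W : Coeffs Q) : Coeffs Q :=
  fun k => ∑' p : {p : quasilattice Q × quasilattice Q × quasilattice Q //
      (p.1 : ℂ) + (p.2.1 : ℂ) + (p.2.2 : ℂ) = (k : ℂ)},
    U p.1.1 * V p.1.2.1 * W p.1.2.2

/-- Invariance of the function `∑ U_k exp (i k · x)` under the rotation of angle `2π/Q`. -/
def RotInvariant (Q : ℕ) (U : Coeffs Q) : Prop :=
  ∀ k k' : quasilattice Q, (k' : ℂ) = waveVector Q 1 * (k : ℂ) → U k' = U k

/-- The function `∑ U_k exp (i k · x)` is real: `U_{-k}` is the complex conjugate of `U_k`. -/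
def RealValued (Q : ℕ) (U : Coeffs Q) : Prop :=
  ∀ k k' : quasilattice Q, (k' : ℂ) = -(k : ℂ) → U k' = starRingEnd ℂ (U k)

open Classical in
/-- `U⁽⁰⁾ = ∑ⱼ exp (i kⱼ · x)`. -/
def leading (Q : ℕ) : Coeffs Q :=
  fun k => if ∃ j : Fin Q, (k : ℂ) = waveVector Q j then 1 else 0

/-- `β = 3 (Q - 1)`. -/
def beta (Q : ℕ) : ℝ := 3 * ((Q : ℝ) - 1)

/-- `l = φ(Q)/2 - 1`. -/
def ell (Q : ℕ) : ℕ := Nat.totient Q / 2 - 1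

/-- `√(μ/β) ∑ₙ μⁿ U⁽ⁿ⁾` is a formal solution of `(1 + Δ)² U - μ U + U³ = 0` whose factors lie in
`H_s` and are invariant under the rotation of angle `2π/Q`, with `U⁽⁰⁾ = ∑ⱼ exp (i kⱼ · x)`. The
equations are those at the orders `μ^{1/2}` and `μ^{n + 3/2}`, `n ≥ 0`. -/
structure IsFormalSolution (Q : ℕ) (s : ℝ) (U : ℕ → Coeffs Q) : Prop where
  mem : ∀ n, MemHs Q s (U n)
  rot : ∀ n, RotInvariant Q (U n)
  zero : U 0 = leading Q
  order_zero : linOp Q (U 0) = 0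
  order_succ : ∀ n, linOp Q (U (n + 1)) = U n - ((beta Q)⁻¹ : ℂ) •
    ∑ p ∈ Finset.HasAntidiagonal.antidiagonal n,
      ∑ q ∈ Finset.HasAntidiagonal.antidiagonal p.2, prod3 Q (U p.1) (U q.1) (U q.2)

/-- The Gevrey estimate `‖U⁽ⁿ⁾‖_s ≤ γ Kⁿ (n!)^{4l}` for all `n`, with some constant `γ`. -/
def GevreyBound (Q : ℕ) (s : ℝ) (U : ℕ → Coeffs Q) (K : ℝ) : Prop :=
  ∃ γ : ℝ, ∀ n, ∃ V : Hs Q s, V.coeff = U n ∧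
    ‖V‖ ≤ γ * K ^ n * (Nat.factorial n : ℝ) ^ (4 * ell Q)

/-- The Borel transform in `ζ = μ^{1/(4l)}` of the formal series
`√(μ/β) ∑ₙ μⁿ U⁽ⁿ⁾ = ∑ₙ ζ^{4ln + 2l} β^{-1/2} U⁽ⁿ⁾`. -/
def borel (Q : ℕ) (U : ℕ → Coeffs Q) (ζ : ℝ) : Coeffs Q :=
  fun k => ∑' n : ℕ, ((ζ ^ (4 * ell Q * n + 2 * ell Q) /
    (Nat.factorial (4 * ell Q * n + 2 * ell Q) : ℝ) / Real.sqrt (beta Q) : ℝ) : ℂ) * U n k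

/-- The truncated Laplace transform `(1/ν) ∫₀^{1/K'} exp (-ζ/ν) Û(ζ) dζ` of the Borel transform. -/
def truncLaplace (Q : ℕ) (U : ℕ → Coeffs Q) (K' ν : ℝ) : Coeffs Q :=
  fun k => ((1 / ν : ℝ) : ℂ) *
    ∫ ζ in (0 : ℝ)..(1 / K'), ((Real.exp (-ζ / ν) : ℝ) : ℂ) * borel Q U ζ k

/-- The approximate quasipattern `Ū`, at `ν = μ^{1/(4l)}`. -/
def approxPattern (Q : ℕ) (U : ℕ → Coeffs Q) (K' μ : ℝ) : Coeffs Q :=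
  truncLaplace Q U K' (μ ^ (1 / (4 * (ell Q : ℝ))))

/-- `U` solves `∂U/∂t = μ U - (1 + Δ)² U - U³` in `H_s` on `[0, T]` with `U(0) = U₀`: the time
derivative exists in the norm of `H_s` and is the element of `H_s` with the Fourier coefficients
of the right-hand side. -/
def IsSolution (Q : ℕ) (s μ T : ℝ) (U₀ : Coeffs Q) (U : ℝ → Hs Q s) : Prop :=
  (U 0).coeff = U₀ ∧
  ∀ t ∈ Set.Icc (0 : ℝ) T, ∃ F : Hs Q s,
    F.coeff = (μ : ℂ) • (U t).coeff - linOp Q (U t).coeff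
      - prod3 Q (U t).coeff (U t).coeff (U t).coeff ∧
    HasDerivWithinAt U F (Set.Icc (0 : ℝ) T) t

end

end SwiftHohenberg

/-! The basic wavevectors are the Q-th roots of unity, so a point k of the quasilattice is an
integer of the cyclotomic field, and so is |k|² - 1. If nonzero, the latter has norm over ℚ at least
1 in absolute value. The identity and complex conjugation both give |k|² - 1, and the other 2l
embeddings are bounded by 1 + N_k². Hence (1 - |k|²)² ≥ (1 + N_k²)^{-2l} off the unit circle
(`small_divisor`), while the points on the circle are the basic wavevectors
(`exists_eq_waveVector`). Among rotation invariant families the kernel of (1 + Δ)² is therefore the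
line of U⁽⁰⁾.

Off the kernel each order of the formal series is obtained by dividing by the symbol. Each basic
wavevector is the sum of β ordered triples of basic wavevectors (`conv3_leadR`), so adding α U⁽⁰⁾ to
U⁽ⁿ⁾, n ≥ 1, changes the solvability condition of the next order by α - 3α = -2α. This fixes the
kernel component uniquely. Since U⁽ⁿ⁾ lives on N_k ≤ 2n + 1, each division costs a constant times (n
+ 1)^{4l}, which accumulates to (n!)^{4l} (`gevrey_l1`).

The estimates are made in ℓ¹ spaces with submultiplicative weights, which are algebras under
convolution; H_s is left at the start and re-entered at the end. The bound on the support of U⁽ⁿ⁾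
and the strict inequality K' > K^{1/4l} leave room for a weight exp(ρ N_k), with a radius R > c =
1/K' (`exists_gevreyL1`). For small ν, let P be the formal series cut at an index near (c +
R)/(8lν). Then Ū - P is O(e^{-c/ν}) (`exists_l1Bound_patternR_sub`), and P solves the stationary
equation up to O(μ e^{-c/ν}) (`exists_l1Bound_residual`).

For small ν the evolution is solved by contraction around P. On the kernel the linearization at
√(μ/β) U⁽⁰⁾ has rate μ - 3μ = -2μ. Off the kernel the small divisors give no uniform damping, and it
is supplied by a weight that shrinks in time, exp(ρN/2 + (ρ/2 - σt/M) min(N, M)) with σ = κμ and M a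
multiple of 1/ν. It damps the modes N ≥ M at the rate κμ, and for N ≤ M the small divisor bound
makes the symbol itself at least κμ (`damping_le`); κ is taken large enough to beat the cubic
coupling, which is of size μ. The weight can shrink as long as σT/M ≤ ρ/2, that is for T up to a
multiple of 1/(μν): this is the time in the theorem. Damping of order μ turns the residual μ
e^{-c/ν} into an error e^{-c/ν} (`lipschitz_near_leading`, `exists_coeffSolution_small`). For ν
bounded below, e^{-c/ν} is bounded below and T above, and a plain Picard argument suffices
(`exists_coeffSolution_large`).

The exponential weight that is left pays for the unbounded operator and gives the time derivative in
H_s (`IsCoeffSolution.isSolution`). Uniqueness follows coefficient by coefficient: the symbol is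
nonnegative, and the cube is Lipschitz in ℓ¹, which contains H_s for s > Q/4 (`isSolution_unique`).
-/

namespace SwiftHohenberg
noncomputable section

/-! ### The quasilattice: rotations, orders, and summability of the inverse weights. -/

section Lattice
variable {Q : ℕ}

theorem waveVector_eq_pow (Q j : ℕ) : waveVector Q j = waveVector Q 1 ^ j := by
  unfold waveVector
  rw [← Complex.exp_nat_mul]
  congr 1
  push_cast
  ring

theorem isPrimitiveRoot_waveVector (hQ : Q ≠ 0) : IsPrimitiveRoot (waveVector Q 1) Q := by
  have := Complex.isPrimitiveRoot_exp Q hQ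
  unfold waveVector
  convert this using 2
  push_cast
  ring

theorem waveVector_pow_self (hQ : Q ≠ 0) : waveVector Q 1 ^ Q = 1 :=
  (isPrimitiveRoot_waveVector hQ).pow_eq_one

theorem waveVector_mod (hQ : Q ≠ 0) (j : ℕ) : waveVector Q (j % Q) = waveVector Q j := by
  rw [waveVector_eq_pow, waveVector_eq_pow Q j]
  conv_rhs => rw [← Nat.mod_add_div j Q, pow_add, pow_mul, waveVector_pow_self hQ]
  simp

theorem norm_waveVector (Q j : ℕ) : ‖waveVector Q j‖ = 1 := by
  unfold waveVector
  have : (2 * Real.pi * Complex.I * (j / Q) : ℂ) = ((2 * Real.pi * (j / Q) : ℝ) : ℂ) * Complex.I := by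
    push_cast; ring
  rw [this, Complex.norm_exp_ofReal_mul_I]

theorem waveVector_half (hQ : Q ≠ 0) (he : Even Q) : waveVector Q 1 ^ (Q / 2) = -1 := by
  obtain ⟨h, rfl⟩ := he
  have hh : (h + h) / 2 = h := by omega
  rw [hh]
  have h1 : (waveVector (h + h) 1 ^ h) ^ 2 = 1 := by
    rw [← pow_mul, mul_two, waveVector_pow_self hQ]
  have h0 : (waveVector (h + h) 1 ^ h - 1) * (waveVector (h + h) 1 ^ h + 1) = 0 := by
    linear_combination h1
  rcases mul_eq_zero.1 h0 with h2 | h2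
  · exfalso
    replace h2 := sub_eq_zero.1 h2
    have := (isPrimitiveRoot_waveVector hQ).dvd_of_pow_eq_one h h2
    have := Nat.le_of_dvd (by omega) this
    omega
  · exact eq_neg_of_add_eq_zero_left h2

theorem waveSum_add (Q : ℕ) (m n : Fin Q → ℕ) : waveSum Q (m + n) = waveSum Q m + waveSum Q n := by
  simp [waveSum, add_mul, Finset.sum_add_distrib]

theorem norm_waveSum_le (Q : ℕ) (m : Fin Q → ℕ) : ‖waveSum Q m‖ ≤ ∑ j, (m j : ℝ) := by
  refine (norm_sum_le _ _).trans (Finset.sum_le_sum fun j _ => ?_)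
  simp [norm_waveVector]

theorem order_waveSum_le (Q : ℕ) (m : Fin Q → ℕ) : order Q (waveSum Q m) ≤ ∑ j, m j :=
  Nat.sInf_le ⟨m, rfl, rfl⟩

theorem exists_waveSum_eq {k : ℂ} (hk : k ∈ quasilattice Q) :
    ∃ m : Fin Q → ℕ, waveSum Q m = k ∧ ∑ j, m j = order Q k := by
  obtain ⟨m, rfl⟩ := hk
  exact Nat.sInf_mem (s := {n : ℕ | ∃ m' : Fin Q → ℕ, waveSum Q m' = waveSum Q m ∧ ∑ j, m' j = n})
    ⟨_, m, rfl, rfl⟩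

theorem norm_le_order {k : ℂ} (hk : k ∈ quasilattice Q) : ‖k‖ ≤ order Q k := by
  obtain ⟨m, rfl, hm⟩ := exists_waveSum_eq hk
  rw [← hm]
  push_cast
  exact norm_waveSum_le Q m

theorem add_mem_quasilattice {k k' : ℂ} (hk : k ∈ quasilattice Q) (hk' : k' ∈ quasilattice Q) :
    k + k' ∈ quasilattice Q := by
  obtain ⟨m, rfl⟩ := hk
  obtain ⟨n, rfl⟩ := hk'
  exact ⟨m + n, waveSum_add Q m n⟩

theorem order_add_le {k k' : ℂ} (hk : k ∈ quasilattice Q) (hk' : k' ∈ quasilattice Q) :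
    order Q (k + k') ≤ order Q k + order Q k' := by
  obtain ⟨m, rfl, hm⟩ := exists_waveSum_eq hk
  obtain ⟨n, rfl, hn⟩ := exists_waveSum_eq hk'
  rw [← hm, ← hn, ← waveSum_add, ← Finset.sum_add_distrib]
  exact order_waveSum_le Q (m + n)

theorem waveVector_mem (j : Fin Q) : waveVector Q j ∈ quasilattice Q :=
  ⟨Pi.single j 1, by simp [waveSum, Pi.single_apply]⟩

theorem order_waveVector_le (j : Fin Q) : order Q (waveVector Q j) ≤ 1 := by
  have := order_waveSum_le Q (Pi.single j 1)
  simpa [waveSum, Pi.single_apply] using this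

/-- Multiplication by the first root of unity shifts the tuple m cyclically and keeps its sum. -/
theorem rotate_mem_order (hQ : Q ≠ 0) {k : ℂ} (hk : k ∈ quasilattice Q) :
    waveVector Q 1 * k ∈ quasilattice Q ∧ order Q (waveVector Q 1 * k) ≤ order Q k := by
  have : NeZero Q := ⟨hQ⟩
  obtain ⟨m, rfl, hm⟩ := exists_waveSum_eq hk
  have h1 : waveVector Q 1 * waveSum Q m = waveSum Q (m ∘ (Equiv.subRight (1 : Fin Q))) := by
    unfold waveSum
    rw [Finset.mul_sum, ← Equiv.sum_comp (Equiv.subRight (1 : Fin Q))]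
    refine Finset.sum_congr rfl fun j _ => ?_
    rw [mul_left_comm]
    congr 1
    set i : Fin Q := Equiv.subRight (1 : Fin Q) j with hi
    have hj : j = i + 1 := by simp [hi]
    rw [hj, Fin.val_add, waveVector_mod hQ, waveVector_eq_pow _ (_ + _), pow_add,
      ← waveVector_eq_pow, ← waveVector_eq_pow, Fin.val_one', waveVector_mod hQ, mul_comm]
  rw [h1]
  refine ⟨⟨_, rfl⟩, (order_waveSum_le _ _).trans ?_⟩
  rw [← hm]
  exact (Equiv.sum_comp (Equiv.subRight (1 : Fin Q)) m).le

theorem pow_mul_mem_order (hQ : Q ≠ 0) {k : ℂ} (hk : k ∈ quasilattice Q) (i : ℕ) :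
    waveVector Q 1 ^ i * k ∈ quasilattice Q ∧ order Q (waveVector Q 1 ^ i * k) ≤ order Q k := by
  induction i with
  | zero => simpa using hk
  | succ i ih =>
    have := rotate_mem_order hQ ih.1
    rw [pow_succ', mul_assoc]
    exact ⟨this.1, this.2.trans ih.2⟩

theorem neg_mem_quasilattice (hQ : Q ≠ 0) (he : Even Q) {k : ℂ} (hk : k ∈ quasilattice Q) :
    -k ∈ quasilattice Q := by
  have := (pow_mul_mem_order hQ hk (Q / 2)).1
  rwa [waveVector_half hQ he, neg_one_mul] at this

/-- The coordinates of a point of the quasilattice along half of the basic wavevectors. -/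
theorem exists_int_coords (hQ : Q ≠ 0) (he : Even Q) {k : ℂ} (hk : k ∈ quasilattice Q) :
    ∃ n : Fin (Q / 2) → ℤ, k = ∑ i, (n i : ℂ) * waveVector Q i ∧ ∀ i, |n i| ≤ order Q k := by
  obtain ⟨m, rfl, hm⟩ := exists_waveSum_eq hk
  rw [← hm]
  clear hm hk
  have hh := waveVector_half hQ he
  obtain ⟨h, rfl⟩ := he
  have h2 : (h + h) / 2 = h := by omega
  rw [h2] at hh ⊢
  refine ⟨fun i => (m (Fin.castAdd h i) : ℤ) - m (Fin.natAdd h i), ?_, fun i => ?_⟩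
  · unfold waveSum
    rw [Fin.sum_univ_add, ← Finset.sum_add_distrib]
    refine Finset.sum_congr rfl fun i _ => ?_
    have : waveVector (h + h) (h + i : ℕ) = - waveVector (h + h) i := by
      rw [waveVector_eq_pow, pow_add, hh, waveVector_eq_pow _ (i : ℕ)]; ring
    simp only [Fin.val_natAdd, Fin.val_castAdd, this]
    push_cast
    ring
  · have h3 := Finset.single_le_sum (f := m) (fun _ _ => Nat.zero_le _)
      (Finset.mem_univ (Fin.castAdd h i))
    have h4 := Finset.single_le_sum (f := m) (fun _ _ => Nat.zero_le _)
      (Finset.mem_univ (Fin.natAdd h i))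
    rw [abs_le]
    push_cast
    constructor <;> zify at h3 h4 <;> omega

/-- Comparison with the lattice ℤ^h in ℝ^h, where ‖z‖^{-2s} is summable as soon as 2s > h. -/
theorem summable_int_vectors {h : ℕ} {s : ℝ} (hs : (h : ℝ) / 2 < s) :
    Summable fun n : Fin h → ℤ => (1 + ‖n‖ ^ 2) ^ (-s) := by
  let L : Submodule ℤ (Fin h → ℝ) := Submodule.span ℤ (Set.range (Pi.basisFun ℝ (Fin h)))
  have hrank : Module.finrank ℤ L = h := by
    rw [ZLattice.rank ℝ L]; simp
  have hsum : Summable fun z : L => ‖z‖ ^ (-(2 * s)) :=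
    ZLattice.summable_norm_rpow L _ (by rw [hrank]; linarith)
  have hmem : ∀ n : Fin h → ℤ, (fun i => (n i : ℝ)) ∈ L := fun n => by
    rw [Module.Basis.mem_span_iff_repr_mem]
    intro i
    exact ⟨n i, by simp⟩
  let e : (Fin h → ℤ) → L := fun n => ⟨fun i => (n i : ℝ), hmem n⟩
  have he : Function.Injective e := fun n n' hn => by
    funext i
    have : (n i : ℝ) = n' i := congrFun (congrArg Subtype.val hn) i
    exact_mod_cast this
  have hnorm : ∀ n, ‖e n‖ = ‖n‖ := fun n => by
    change ‖(fun i => (n i : ℝ))‖ = ‖n‖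
    simp only [Pi.norm_def]
    congr 2
  have hs0 : 0 < s := lt_of_le_of_lt (by positivity) hs
  have h1 := hsum.comp_injective he
  -- The comparison fails only at the zero vector, where ‖0‖^{-2s} takes the default value 0.
  refine Summable.of_norm_bounded_eventually (g := fun n => ‖e n‖ ^ (-(2 * s))) h1 ?_
  rw [Filter.eventually_cofinite]
  refine (Set.finite_singleton (0 : Fin h → ℤ)).subset fun n hn => ?_
  by_contra h0
  apply hn
  have hpos : 0 < ‖n‖ := norm_pos_iff.2 h0
  rw [Real.norm_of_nonneg (by positivity), hnorm]
  have : ‖n‖ ^ (-(2 * s)) = (‖n‖ ^ 2) ^ (-s) := by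
    rw [← Real.rpow_natCast, ← Real.rpow_mul hpos.le]; congr 1; push_cast; ring
  rw [this]
  exact Real.rpow_le_rpow_of_nonpos (by positivity) (by linarith) (by linarith)

/-- The integer coordinates along half of the wavevectors inject the quasilattice into ℤ^{Q/2} with
sup norm at most N_k. The threshold Q/4 is half of that rank. -/
theorem summable_inv_weight (hQ : Q ≠ 0) (he : Even Q) {s : ℝ} (hs : (Q : ℝ) / 4 < s) :
    Summable fun k : quasilattice Q => (weight Q s k)⁻¹ := by
  choose c hc hc' using fun k : quasilattice Q => exists_int_coords hQ he k.2
  have hinj : Function.Injective c := fun k k' h => by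
    apply Subtype.ext
    rw [hc k, hc k', h]
  have hs0 : 0 < s := lt_of_le_of_lt (by positivity) hs
  have h1 : Summable fun n : Fin (Q / 2) → ℤ => (1 + ‖n‖ ^ 2) ^ (-s) := by
    apply summable_int_vectors
    have : ((Q / 2 : ℕ) : ℝ) = Q / 2 := by
      obtain ⟨h, rfl⟩ := he
      have : (h + h) / 2 = h := by omega
      rw [this]; push_cast; ring
    rw [this]; linarith
  refine Summable.of_nonneg_of_le (fun k => inv_nonneg.2 (weight_pos Q s k).le) (fun k => ?_)
    (h1.comp_injective hinj)
  unfold weight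
  rw [← Real.rpow_neg (by positivity)]
  refine Real.rpow_le_rpow_of_nonpos (by positivity) ?_ (by linarith)
  have : ‖c k‖ ≤ order Q k := by
    rw [pi_norm_le_iff_of_nonneg (by positivity)]
    intro i
    rw [Int.norm_eq_abs]
    exact_mod_cast hc' k i
  gcongr

end Lattice
end
end SwiftHohenberg

namespace SwiftHohenberg
noncomputable section

/-! ### Small divisors from norms in the cyclotomic field. -/

section SmallDivisors
variable {Q : ℕ}

/-- The cyclotomic field as an extension of `ℚ`. -/
abbrev KQ (Q : ℕ) : Type := CyclotomicField Q ℚ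

instance isCyclotomicExtension_KQ [NeZero Q] : IsCyclotomicExtension {Q} ℚ (KQ Q) :=
  haveI : NeZero ((Q : ℕ) : ℚ) := ⟨Nat.cast_ne_zero.2 (NeZero.ne Q)⟩
  CyclotomicField.isCyclotomicExtension Q ℚ

/-- The algebraic integer `∑ⱼ mⱼ ζʲ` in the abstract cyclotomic field. -/
def cycloSum (Q : ℕ) [NeZero Q] (m : Fin Q → ℕ) : KQ Q :=
  ∑ j : Fin Q, (m j : (KQ Q)) * IsCyclotomicExtension.zeta Q ℚ ((KQ Q)) ^ (j : ℕ)

/-- The complex conjugate of `cycloSum Q m`. -/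
def cycloSumConj (Q : ℕ) [NeZero Q] (m : Fin Q → ℕ) : KQ Q :=
  ∑ j : Fin Q, (m j : (KQ Q)) *
    (IsCyclotomicExtension.zeta Q ℚ ((KQ Q)))⁻¹ ^ (j : ℕ)

/-- The product over the embeddings is the norm to ℚ, a nonzero rational integer. -/
theorem one_le_prod_norm_embeddings {x : (KQ Q)} (hx : IsIntegral ℤ x) (h0 : x ≠ 0) :
    1 ≤ ∏ φ : (KQ Q) →ₐ[ℚ] ℂ, ‖φ x‖ := by
  have h1 := Algebra.norm_eq_prod_embeddings ℚ ℂ x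
  obtain ⟨z, hz⟩ := IsIntegrallyClosed.isIntegral_iff.1 (Algebra.isIntegral_norm ℚ hx)
  have hz0 : z ≠ 0 := by
    rintro rfl
    rw [map_zero] at hz
    exact h0 (Algebra.norm_eq_zero_iff.1 hz.symm)
  rw [← norm_prod, ← h1, ← hz]
  have : (1 : ℝ) ≤ |(z : ℝ)| := by exact_mod_cast Int.one_le_abs hz0
  simpa using this

/-- For Q ≥ 3 the totient is even and positive, so neither the halving nor the truncated subtraction
in `ell` loses anything. -/
theorem totient_eq_ell (hQ : 3 ≤ Q) : Q.totient = 2 * ell Q + 2 := by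
  have h1 := Nat.totient_even (n := Q) (by omega)
  have h2 := Nat.totient_pos.2 (show 0 < Q by omega)
  obtain ⟨r, hr⟩ := h1
  unfold ell
  omega

variable [NeZero Q]

theorem norm_embedding_zeta (φ : (KQ Q) →+* ℂ) : ‖φ (IsCyclotomicExtension.zeta Q ℚ (KQ Q))‖ = 1 := by
  have h := (IsCyclotomicExtension.zeta_spec Q ℚ (KQ Q)).pow_eq_one
  have h2 : φ (IsCyclotomicExtension.zeta Q ℚ (KQ Q)) ^ Q = 1 := by rw [← map_pow, h, map_one]
  exact Complex.norm_eq_one_of_pow_eq_one h2 (NeZero.ne Q)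

theorem embedding_cycloSumConj (φ : (KQ Q) →+* ℂ) (m : Fin Q → ℕ) :
    φ (cycloSumConj Q m) = starRingEnd ℂ (φ (cycloSum Q m)) := by
  unfold cycloSumConj cycloSum
  simp only [map_sum, map_mul, map_natCast, map_pow, map_inv₀]
  refine Finset.sum_congr rfl fun j _ => ?_
  rw [Complex.inv_eq_conj (norm_embedding_zeta φ)]

/-- Complex conjugation commutes with every embedding because ζ always goes to a number of modulus
1. So every conjugate of |k|² - 1 is again of the form |k'|² - 1, hence real and controlled by the
order of k. -/
theorem embedding_mul_conj (φ : (KQ Q) →+* ℂ) (m : Fin Q → ℕ) :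
    φ (cycloSum Q m * cycloSumConj Q m - 1) = ((‖φ (cycloSum Q m)‖ ^ 2 - 1 : ℝ) : ℂ) := by
  rw [map_sub, map_mul, embedding_cycloSumConj, Complex.mul_conj, map_one, Complex.normSq_eq_norm_sq]
  push_cast
  rfl

theorem norm_embedding_cycloSum_le (φ : (KQ Q) →+* ℂ) (m : Fin Q → ℕ) :
    ‖φ (cycloSum Q m)‖ ≤ ∑ j, (m j : ℝ) := by
  unfold cycloSum
  rw [map_sum]
  refine (norm_sum_le _ _).trans (Finset.sum_le_sum fun j _ => ?_)
  simp [norm_embedding_zeta φ]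

theorem isIntegral_zeta : IsIntegral ℤ (IsCyclotomicExtension.zeta Q ℚ (KQ Q)) :=
  (IsCyclotomicExtension.zeta_spec Q ℚ (KQ Q)).isIntegral (NeZero.pos Q)

theorem isIntegral_cycloSum (m : Fin Q → ℕ) : IsIntegral ℤ (cycloSum Q m) :=
  IsIntegral.sum _ fun _ _ => (isIntegral_natCast _).mul (isIntegral_zeta.pow _)

theorem isIntegral_cycloSumConj (m : Fin Q → ℕ) : IsIntegral ℤ (cycloSumConj Q m) :=
  IsIntegral.sum _ fun _ _ => (isIntegral_natCast _).mul
    (((IsCyclotomicExtension.zeta_spec Q ℚ (KQ Q)).inv.isIntegral (NeZero.pos Q)).pow _)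

theorem exists_embedding :
    ∃ φ : (KQ Q) →ₐ[ℚ] ℂ, ∀ m : Fin Q → ℕ, φ (cycloSum Q m) = waveSum Q m := by
  have hirr := Polynomial.cyclotomic.irreducible_rat (NeZero.pos Q)
  let e := (IsCyclotomicExtension.zeta_spec Q ℚ (KQ Q)).embeddingsEquivPrimitiveRoots ℂ hirr
  have hμ : waveVector Q 1 ∈ primitiveRoots Q ℂ :=
    (mem_primitiveRoots (NeZero.pos Q)).2 (isPrimitiveRoot_waveVector (NeZero.ne Q))
  refine ⟨e.symm ⟨_, hμ⟩, fun m => ?_⟩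
  have h : e.symm ⟨_, hμ⟩ (IsCyclotomicExtension.zeta Q ℚ (KQ Q)) = waveVector Q 1 := by
    exact congrArg Subtype.val (e.apply_symm_apply ⟨_, hμ⟩)
  unfold cycloSum waveSum
  rw [map_sum]
  refine Finset.sum_congr rfl fun j _ => ?_
  rw [map_mul, map_natCast, map_pow, h, waveVector_eq_pow Q j]

theorem card_embeddings : Fintype.card ((KQ Q) →ₐ[ℚ] ℂ) = Q.totient := by
  rw [AlgHom.card, IsCyclotomicExtension.finrank (KQ Q)
    (Polynomial.cyclotomic.irreducible_rat (NeZero.pos Q))]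

/-- The small divisor estimate: `||k|² - 1| ≥ (1 + N_k²)^{-l}` off the unit circle. -/
theorem small_divisor (hQ : 3 ≤ Q) {k : ℂ} (hk : k ∈ quasilattice Q) (h1 : ‖k‖ ≠ 1) :
    1 ≤ (1 - ‖k‖ ^ 2) ^ 2 * (1 + (order Q k : ℝ) ^ 2) ^ (2 * ell Q) := by
  classical
  obtain ⟨m, rfl, hm⟩ := exists_waveSum_eq hk
  obtain ⟨φ, hφ⟩ := exists_embedding (Q := Q)
  set N : ℝ := (order Q (waveSum Q m) : ℝ) with hN
  have hmN : ∑ j, (m j : ℝ) = N := by rw [hN, ← hm]; push_cast; rfl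
  set x := cycloSum Q m * cycloSumConj Q m - 1 with hx
  have hnorm : ∀ ψ : (KQ Q) →ₐ[ℚ] ℂ, ‖ψ x‖ = |‖ψ (cycloSum Q m)‖ ^ 2 - 1| := fun ψ => by
    have := embedding_mul_conj (ψ : (KQ Q) →+* ℂ) m
    rw [hx]
    change ψ _ = _ at this
    rw [this, Complex.norm_real, Real.norm_eq_abs]
    rfl
  have hint : IsIntegral ℤ x :=
    ((isIntegral_cycloSum m).mul (isIntegral_cycloSumConj m)).sub isIntegral_one
  have hx0 : x ≠ 0 := by
    intro h0
    have h2 := hnorm φ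
    rw [h0, map_zero, norm_zero, hφ] at h2
    have h3 : ‖waveSum Q m‖ ^ 2 = 1 := by
      have := abs_eq_zero.1 h2.symm
      linarith
    exact h1 ((pow_eq_one_iff_of_nonneg (norm_nonneg _) two_ne_zero).1 h3)
  have hprod := one_le_prod_norm_embeddings hint hx0
  -- the complex conjugate embedding
  let φ' : (KQ Q) →ₐ[ℚ] ℂ := (Complex.conjAe.restrictScalars ℚ : ℂ →ₐ[ℚ] ℂ).comp φ
  have hφ' : ∀ y, φ' y = starRingEnd ℂ (φ y) := fun y => rfl
  -- If the embedding were real, the primitive root would satisfy ζ² = 1, against Q ≥ 3.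
  have hne : φ' ≠ φ := by
    intro h
    let m' : Fin Q → ℕ := Pi.single ⟨1, by omega⟩ 1
    have h2 : waveSum Q m' = waveVector Q 1 := by simp [m', waveSum, Pi.single_apply]
    have h3 := DFunLike.congr_fun h (cycloSum Q m')
    rw [hφ', hφ, h2, ← Complex.inv_eq_conj (norm_waveVector Q 1)] at h3
    have h4 : waveVector Q 1 ^ 2 = 1 := by
      have h5 : waveVector Q 1 ≠ 0 := by
        intro h0; have := norm_waveVector Q 1; rw [h0] at this; simp at this
      rw [pow_two]; nth_rewrite 1 [← h3]; exact inv_mul_cancel₀ h5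
    have := Nat.le_of_dvd (by norm_num)
      ((isPrimitiveRoot_waveVector (NeZero.ne Q)).dvd_of_pow_eq_one 2 h4)
    omega
  have hle : ∀ ψ : (KQ Q) →ₐ[ℚ] ℂ, ‖ψ x‖ ≤ 1 + N ^ 2 := fun ψ => by
    rw [hnorm]
    have h2 : ‖ψ (cycloSum Q m)‖ ≤ N := by
      rw [← hmN]; exact norm_embedding_cycloSum_le (ψ : (KQ Q) →+* ℂ) m
    have h3 := norm_nonneg (ψ (cycloSum Q m))
    have h4 : ‖ψ (cycloSum Q m)‖ ^ 2 ≤ N ^ 2 := by gcongr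
    rw [abs_le]
    constructor <;> nlinarith [sq_nonneg N]
  -- Two conjugate embeddings contribute ||k|² - 1| each, hence its square; the remaining φ(Q) - 2 =
  -- 2l factors are at most 1 + N².
  have hsplit : ∏ ψ : (KQ Q) →ₐ[ℚ] ℂ, ‖ψ x‖
      = ‖φ x‖ * (‖φ' x‖ * ∏ ψ ∈ (Finset.univ.erase φ).erase φ', ‖ψ x‖) := by
    rw [Finset.mul_prod_erase _ (fun ψ : (KQ Q) →ₐ[ℚ] ℂ => ‖ψ x‖)
      (Finset.mem_erase.2 ⟨hne, Finset.mem_univ _⟩),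
      Finset.mul_prod_erase _ (fun ψ : (KQ Q) →ₐ[ℚ] ℂ => ‖ψ x‖) (Finset.mem_univ _)]
  have hcard : ((Finset.univ.erase φ).erase φ').card = 2 * ell Q := by
    rw [Finset.card_erase_of_mem (Finset.mem_erase.2 ⟨hne, Finset.mem_univ _⟩),
      Finset.card_erase_of_mem (Finset.mem_univ _), Finset.card_univ, card_embeddings,
      totient_eq_ell hQ]
    omega
  have hrest : ∏ ψ ∈ (Finset.univ.erase φ).erase φ', ‖ψ x‖ ≤ (1 + N ^ 2) ^ (2 * ell Q) := by
    rw [← hcard, ← Finset.prod_const]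
    exact Finset.prod_le_prod (fun ψ _ => norm_nonneg _) fun ψ _ => hle ψ
  have h5 : ‖φ' x‖ = ‖φ x‖ := by rw [hφ', RCLike.norm_conj]
  rw [hsplit, h5] at hprod
  calc (1 : ℝ) ≤ ‖φ x‖ * (‖φ x‖ * ∏ ψ ∈ (Finset.univ.erase φ).erase φ', ‖ψ x‖) := hprod
    _ ≤ ‖φ x‖ * (‖φ x‖ * (1 + N ^ 2) ^ (2 * ell Q)) := by gcongr
    _ = _ := by
      rw [← mul_assoc, ← pow_two, hnorm, sq_abs, hφ]
      ring

/-- The points of the quasilattice on the unit circle are the basic wavevectors. -/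
theorem exists_eq_waveVector (hQ : Q ≠ 0) (he : Even Q) {k : ℂ} (hk : k ∈ quasilattice Q)
    (h1 : ‖k‖ = 1) : ∃ j : Fin Q, k = waveVector Q j := by
  obtain ⟨m, rfl⟩ := hk
  obtain ⟨φ, hφ⟩ := exists_embedding (Q := Q)
  have hx0 : cycloSum Q m * cycloSumConj Q m - 1 = 0 := by
    have := embedding_mul_conj (φ : (KQ Q) →+* ℂ) m
    have h2 : (φ : (KQ Q) →+* ℂ) (cycloSum Q m) = waveSum Q m := hφ m
    rw [h2, h1] at this
    apply (φ : (KQ Q) →+* ℂ).injective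
    rw [this]; simp
  -- If |k| = 1 then all conjugates of k have modulus 1, and by Kronecker's theorem k is a root of
  -- unity.
  have hall : ∀ ψ : (KQ Q) →+* ℂ, ‖ψ (cycloSum Q m)‖ = 1 := fun ψ => by
    have := embedding_mul_conj ψ m
    rw [hx0, map_zero] at this
    have h3 : ‖ψ (cycloSum Q m)‖ ^ 2 - 1 = 0 := by exact_mod_cast this.symm
    exact (pow_eq_one_iff_of_nonneg (norm_nonneg _) two_ne_zero).1 (by linarith)
  obtain ⟨n, hn, hpow⟩ :=
    NumberField.Embeddings.pow_eq_one_of_norm_eq_one (KQ Q) ℂ (isIntegral_cycloSum m) hall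
  have hord : 0 < orderOf (cycloSum Q m) := orderOf_pos_iff.2 (isOfFinOrder_iff_pow_eq_one.2 ⟨n, hn, hpow⟩)
  have hprim := IsPrimitiveRoot.orderOf (cycloSum Q m)
  set o := orderOf (cycloSum Q m) with ho
  -- The order o divides 2Q, so lcm(o, Q) is Q or 2Q. The second is excluded: for even Q, φ(2Q) =
  -- 2φ(Q) exceeds the degree φ(Q) of the field.
  have hdvd : o ∣ Q := by
    have hroot := IsCyclotomicExtension.zeta_spec Q ℚ (KQ Q)
    have hpos := Nat.lcm_pos hord (NeZero.pos Q)
    have key := IsPrimitiveRoot.lcm_totient_le_finrank hprim hroot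
      (Polynomial.cyclotomic.irreducible_rat hpos)
    rw [IsCyclotomicExtension.finrank (KQ Q)
      (Polynomial.cyclotomic.irreducible_rat (NeZero.pos Q))] at key
    have h2 := hprim.dvd_of_isCyclotomicExtension Q hord.ne'
    have h3 : o.lcm Q ∣ 2 * Q := Nat.lcm_dvd h2 (Dvd.intro_left 2 rfl)
    obtain ⟨r, hr⟩ := Nat.dvd_lcm_right o Q
    have h4 : r ∣ 2 := by
      rw [hr, mul_comm 2 Q] at h3
      exact Nat.dvd_of_mul_dvd_mul_left (NeZero.pos Q) h3
    rcases (Nat.dvd_prime Nat.prime_two).1 h4 with rfl | rfl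
    · rw [mul_one] at hr
      rw [← hr]; exact Nat.dvd_lcm_left o Q
    · exfalso
      rw [hr, mul_comm, Nat.totient_mul_of_prime_of_dvd Nat.prime_two he.two_dvd] at key
      have := Nat.totient_pos.2 (NeZero.pos Q)
      omega
  have hQ1 : waveSum Q m ^ Q = 1 := by
    rw [← hφ, ← map_pow, orderOf_dvd_iff_pow_eq_one.1 hdvd, map_one]
  obtain ⟨i, hi, hi2⟩ := (isPrimitiveRoot_waveVector hQ).eq_pow_of_pow_eq_one hQ1
  exact ⟨⟨i, hi⟩, by rw [← hi2]; exact (waveVector_eq_pow Q i).symm⟩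

end SmallDivisors
end
end SwiftHohenberg

namespace SwiftHohenberg
noncomputable section

/-! ### Bounds in ℓ¹ expressed through finite partial sums. -/

section L1
variable {ι : Type*} {f g : ι → ℝ} {a b : ℝ}

/-- All finite partial sums of `f` are at most `B`. -/
def L1Bound (f : ι → ℝ) (B : ℝ) : Prop := ∀ s : Finset ι, ∑ i ∈ s, f i ≤ B

theorem L1Bound.nonneg (h : L1Bound f a) : 0 ≤ a := by simpa using h ∅

theorem L1Bound.le (h : L1Bound f a) (i : ι) : f i ≤ a := by simpa using h {i}

theorem L1Bound.mono (h : L1Bound g b) (hfg : ∀ i, f i ≤ g i) (hab : b ≤ a) : L1Bound f a :=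
  fun s => ((Finset.sum_le_sum fun i _ => hfg i).trans (h s)).trans hab

theorem L1Bound.add (hf : L1Bound f a) (hg : L1Bound g b) : L1Bound (fun i => f i + g i) (a + b) :=
  fun s => by rw [Finset.sum_add_distrib]; exact add_le_add (hf s) (hg s)

theorem L1Bound.const_mul {c : ℝ} (hc : 0 ≤ c) (hf : L1Bound f a) :
    L1Bound (fun i => c * f i) (c * a) :=
  fun s => by rw [← Finset.mul_sum]; exact mul_le_mul_of_nonneg_left (hf s) hc

theorem L1Bound.summable (hf : L1Bound f a) (h0 : ∀ i, 0 ≤ f i) : Summable f :=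
  summable_of_sum_le h0 hf

theorem L1Bound.tsum_le (hf : L1Bound f a) (h0 : ∀ i, 0 ≤ f i) : ∑' i, f i ≤ a :=
  (hf.summable h0).tsum_le_of_sum_le hf

theorem l1Bound_tsum (hf : Summable f) (h0 : ∀ i, 0 ≤ f i) : L1Bound f (∑' i, f i) :=
  fun s => hf.sum_le_tsum s fun i _ => h0 i

theorem L1Bound.sum {κ : Type*} (t : Finset κ) {f : κ → ι → ℝ} {a : κ → ℝ}
    (h : ∀ j ∈ t, L1Bound (f j) (a j)) : L1Bound (fun i => ∑ j ∈ t, f j i) (∑ j ∈ t, a j) :=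
  fun s => by rw [Finset.sum_comm]; exact Finset.sum_le_sum fun j hj => h j hj s

end L1

/-! ### Triple convolution in ℓ¹ over the quasilattice. -/

section Convolution
variable {Q : ℕ} {A B : Type*} [NormedCommRing A] [NormedCommRing B]

/-- The triple convolution of families indexed by the quasilattice. -/
def conv3 (f g h : quasilattice Q → A) : quasilattice Q → A :=
  fun k => ∑' p : {p : quasilattice Q × quasilattice Q × quasilattice Q //
      (p.1 : ℂ) + (p.2.1 : ℂ) + (p.2.2 : ℂ) = (k : ℂ)},
    f p.1.1 * g p.1.2.1 * h p.1.2.2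

theorem prod3_eq_conv3 (U V W : Coeffs Q) : prod3 Q U V W = conv3 U V W := rfl

/-- The triples of points of the quasilattice, grouped by their sums. -/
def tripleEquiv (Q : ℕ) :
    (Σ k : quasilattice Q, {p : quasilattice Q × quasilattice Q × quasilattice Q //
      (p.1 : ℂ) + (p.2.1 : ℂ) + (p.2.2 : ℂ) = (k : ℂ)}) ≃
    quasilattice Q × quasilattice Q × quasilattice Q where
  toFun x := x.2.1
  invFun p := ⟨⟨p.1 + p.2.1 + p.2.2,
    add_mem_quasilattice (add_mem_quasilattice p.1.2 p.2.1.2) p.2.2.2⟩, ⟨p, rfl⟩⟩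
  left_inv x := by
    obtain ⟨⟨k, hk⟩, ⟨p, hp⟩⟩ := x
    simp only at hp
    subst hp
    rfl
  right_inv p := rfl

theorem summable_triple {F G H : quasilattice Q → ℝ} (hF : Summable F) (hG : Summable G)
    (hH : Summable H) (hF0 : ∀ k, 0 ≤ F k) (hG0 : ∀ k, 0 ≤ G k) (hH0 : ∀ k, 0 ≤ H k) :
    Summable fun p : quasilattice Q × quasilattice Q × quasilattice Q =>
      F p.1 * G p.2.1 * H p.2.2 := by
  have h1 := hG.mul_of_nonneg hH hG0 hH0
  have h2 := hF.mul_of_nonneg h1 hF0 fun p => mul_nonneg (hG0 _) (hH0 _)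
  refine h2.congr fun p => ?_
  simp only [mul_assoc]

/-- Summing the convolution over k sums F ⊗ G ⊗ H over all triples, which factors into a product of
three sums. -/
theorem L1Bound.conv3 {F G H : quasilattice Q → ℝ} {a b c : ℝ} (hF : L1Bound F a)
    (hG : L1Bound G b) (hH : L1Bound H c) (hF0 : ∀ k, 0 ≤ F k) (hG0 : ∀ k, 0 ≤ G k)
    (hH0 : ∀ k, 0 ≤ H k) : L1Bound (conv3 F G H) (a * b * c) := by
  have sF := hF.summable hF0
  have sG := hG.summable hG0
  have sH := hH.summable hH0
  have hsum := summable_triple sF sG sH hF0 hG0 hH0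
  have h1 := (tripleEquiv Q).summable_iff.2 hsum
  have h2 : Summable (SwiftHohenberg.conv3 F G H) := h1.sigma
  have h3 : ∑' k, SwiftHohenberg.conv3 F G H k = (∑' k, F k) * (∑' k, G k) * ∑' k, H k := by
    have h4 : ∑' k, SwiftHohenberg.conv3 F G H k
        = ∑' p : quasilattice Q × quasilattice Q × quasilattice Q, F p.1 * G p.2.1 * H p.2.2 := by
      rw [← (tripleEquiv Q).tsum_eq]
      exact (h1.tsum_sigma).symm
    rw [h4, mul_assoc, sG.tsum_mul_tsum sH (sG.mul_of_nonneg sH hG0 hH0),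
      sF.tsum_mul_tsum (sG.mul_of_nonneg sH hG0 hH0)
        (sF.mul_of_nonneg (sG.mul_of_nonneg sH hG0 hH0) hF0 fun p => mul_nonneg (hG0 _) (hH0 _))]
    exact tsum_congr fun p => mul_assoc _ _ _
  have h5 : ∀ k, 0 ≤ SwiftHohenberg.conv3 F G H k := fun k =>
    tsum_nonneg fun p => mul_nonneg (mul_nonneg (hF0 _) (hG0 _)) (hH0 _)
  refine (l1Bound_tsum h2 h5).mono (fun _ => le_rfl) ?_
  rw [h3]
  exact mul_le_mul (mul_le_mul (hF.tsum_le hF0) (hG.tsum_le hG0) (tsum_nonneg hG0) hF.nonneg)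
    (hH.tsum_le hH0) (tsum_nonneg hH0) (mul_nonneg hF.nonneg hG.nonneg)

variable {f g h : quasilattice Q → A}

theorem summable_fiber_real {F G H : quasilattice Q → ℝ} (hF : Summable F) (hG : Summable G)
    (hH : Summable H) (hF0 : ∀ k, 0 ≤ F k) (hG0 : ∀ k, 0 ≤ G k) (hH0 : ∀ k, 0 ≤ H k)
    (k : quasilattice Q) :
    Summable fun p : {p : quasilattice Q × quasilattice Q × quasilattice Q //
      (p.1 : ℂ) + (p.2.1 : ℂ) + (p.2.2 : ℂ) = (k : ℂ)} => F p.1.1 * G p.1.2.1 * H p.1.2.2 :=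
  (summable_triple hF hG hH hF0 hG0 hH0).comp_injective Subtype.val_injective

theorem norm_mul_mul_le (x y z : A) : ‖x * y * z‖ ≤ ‖x‖ * ‖y‖ * ‖z‖ :=
  (norm_mul_le _ _).trans (mul_le_mul_of_nonneg_right (norm_mul_le _ _) (norm_nonneg _))

theorem summable_norm_fiber (hf : Summable fun k => ‖f k‖) (hg : Summable fun k => ‖g k‖)
    (hh : Summable fun k => ‖h k‖) (k : quasilattice Q) :
    Summable fun p : {p : quasilattice Q × quasilattice Q × quasilattice Q //
      (p.1 : ℂ) + (p.2.1 : ℂ) + (p.2.2 : ℂ) = (k : ℂ)} => ‖f p.1.1 * g p.1.2.1 * h p.1.2.2‖ :=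
  Summable.of_nonneg_of_le (fun _ => norm_nonneg _) (fun _ => norm_mul_mul_le _ _ _)
    (summable_fiber_real hf hg hh (fun _ => norm_nonneg _) (fun _ => norm_nonneg _)
      (fun _ => norm_nonneg _) k)

/-- Domination of a weighted triple convolution by a triple convolution of weighted norms. -/
theorem norm_mul_conv3_le {F G H : quasilattice Q → ℝ} (c : A)
    (hf : Summable fun k => ‖f k‖) (hg : Summable fun k => ‖g k‖) (hh : Summable fun k => ‖h k‖)
    (hF : Summable F) (hG : Summable G) (hH : Summable H) (hF0 : ∀ k, 0 ≤ F k)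
    (hG0 : ∀ k, 0 ≤ G k) (hH0 : ∀ k, 0 ≤ H k) [CompleteSpace A] (k : quasilattice Q)
    (hle : ∀ p q r : quasilattice Q, (p : ℂ) + q + r = k →
      ‖c * (f p * g q * h r)‖ ≤ F p * G q * H r) :
    ‖c * conv3 f g h k‖ ≤ conv3 F G H k := by
  unfold conv3
  rw [← (summable_norm_fiber hf hg hh k).of_norm.tsum_mul_left]
  exact tsum_of_norm_bounded (summable_fiber_real hF hG hH hF0 hG0 hH0 k).hasSum
    fun p => hle _ _ _ p.2

variable [CompleteSpace A]

theorem conv3_sub₁ {f' : quasilattice Q → A} (hf : Summable fun k => ‖f k‖)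
    (hf' : Summable fun k => ‖f' k‖) (hg : Summable fun k => ‖g k‖) (hh : Summable fun k => ‖h k‖) :
    conv3 (f - f') g h = conv3 f g h - conv3 f' g h := by
  funext k
  simp only [conv3, Pi.sub_apply]
  rw [← ((summable_norm_fiber hf hg hh k).of_norm).tsum_sub (summable_norm_fiber hf' hg hh k).of_norm]
  exact tsum_congr fun p => by ring

omit [CompleteSpace A] in
-- Properties proved in the first slot are carried by this symmetry to the other two.
theorem conv3_rotate_args (f g h : quasilattice Q → A) : conv3 f g h = conv3 g h f := by
  funext k
  unfold conv3
  let e : {p : quasilattice Q × quasilattice Q × quasilattice Q //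
      (p.1 : ℂ) + (p.2.1 : ℂ) + (p.2.2 : ℂ) = (k : ℂ)} ≃
      {p : quasilattice Q × quasilattice Q × quasilattice Q //
      (p.1 : ℂ) + (p.2.1 : ℂ) + (p.2.2 : ℂ) = (k : ℂ)} :=
    { toFun := fun p => ⟨(p.1.2.2, p.1.1, p.1.2.1), by
        have := p.2; simp only; linear_combination this⟩
      invFun := fun p => ⟨(p.1.2.1, p.1.2.2, p.1.1), by
        have := p.2; simp only; linear_combination this⟩
      left_inv := fun p => rfl
      right_inv := fun p => rfl }
  rw [← e.tsum_eq]
  exact tsum_congr fun p => by simp only [e, Equiv.coe_fn_mk]; ring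

theorem conv3_sub₂ {g' : quasilattice Q → A} (hf : Summable fun k => ‖f k‖)
    (hg : Summable fun k => ‖g k‖) (hg' : Summable fun k => ‖g' k‖) (hh : Summable fun k => ‖h k‖) :
    conv3 f (g - g') h = conv3 f g h - conv3 f g' h := by
  rw [conv3_rotate_args, conv3_sub₁ hg hg' hh hf, conv3_rotate_args f, conv3_rotate_args f]

theorem conv3_sub₃ {h' : quasilattice Q → A} (hf : Summable fun k => ‖f k‖)
    (hg : Summable fun k => ‖g k‖) (hh : Summable fun k => ‖h k‖) (hh' : Summable fun k => ‖h' k‖) :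
    conv3 f g (h - h') = conv3 f g h - conv3 f g h' := by
  rw [← conv3_rotate_args, conv3_sub₁ hh hh' hf hg, conv3_rotate_args h, conv3_rotate_args h']

theorem conv3_zero₁ (g h : quasilattice Q → A) : conv3 0 g h = 0 := by
  funext k; simp [conv3]

theorem conv3_zero₂ (f h : quasilattice Q → A) : conv3 f 0 h = 0 := by
  rw [conv3_rotate_args, conv3_zero₁]

theorem conv3_zero₃ (f g : quasilattice Q → A) : conv3 f g 0 = 0 := by
  rw [← conv3_rotate_args, conv3_zero₁]

theorem conv3_const_mul (c : A) (hf : Summable fun k => ‖f k‖) (hg : Summable fun k => ‖g k‖)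
    (hh : Summable fun k => ‖h k‖) (k : quasilattice Q) :
    conv3 (fun k => c * f k) g h k = c * conv3 f g h k := by
  unfold conv3
  rw [← (summable_norm_fiber hf hg hh k).of_norm.tsum_mul_left]
  exact tsum_congr fun p => by ring

theorem conv3_cube_sub (hf : Summable fun k => ‖f k‖) (hg : Summable fun k => ‖g k‖) :
    conv3 f f f - conv3 g g g
      = conv3 (f - g) f f + conv3 g (f - g) f + conv3 g g (f - g) := by
  rw [conv3_sub₁ hf hg hf hf, conv3_sub₂ hg hf hg hf, conv3_sub₃ hg hg hf hg]
  abel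

/-- Convolution is used with values in ℝ, in ℂ and in the continuous functions of time. This is the
passage between them, including constant functions and evaluation at a time. -/
theorem map_conv3 (φ : A →+* B) (hφ : Continuous φ) (hf : Summable fun k => ‖f k‖)
    (hg : Summable fun k => ‖g k‖) (hh : Summable fun k => ‖h k‖) (k : quasilattice Q) :
    φ (conv3 f g h k) = conv3 (fun k => φ (f k)) (fun k => φ (g k)) (fun k => φ (h k)) k := by
  unfold conv3
  rw [(summable_norm_fiber hf hg hh k).of_norm.map_tsum φ hφ]
  simp

end Convolution

/-! ### Rotation invariant families. -/

section Rotation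
variable {Q : ℕ} {A : Type*} [NormedCommRing A]

/-- Invariance of a family under the rotation of the quasilattice. -/
def RotInv (f : quasilattice Q → A) : Prop :=
  ∀ k k' : quasilattice Q, (k' : ℂ) = waveVector Q 1 * (k : ℂ) → f k' = f k

/-- The rotation of the quasilattice. -/
def rotate (hQ : Q ≠ 0) : quasilattice Q ≃ quasilattice Q where
  toFun k := ⟨waveVector Q 1 * k, (rotate_mem_order hQ k.2).1⟩
  invFun k := ⟨waveVector Q 1 ^ (Q - 1) * k, (pow_mul_mem_order hQ k.2 (Q - 1)).1⟩
  left_inv k := by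
    apply Subtype.ext
    simp only
    rw [← mul_assoc, ← pow_succ, Nat.sub_add_cancel (Nat.one_le_iff_ne_zero.2 hQ),
      waveVector_pow_self hQ, one_mul]
  right_inv k := by
    apply Subtype.ext
    simp only
    rw [← mul_assoc, ← pow_succ', Nat.sub_add_cancel (Nat.one_le_iff_ne_zero.2 hQ),
      waveVector_pow_self hQ, one_mul]

theorem waveVector_ne_zero (Q j : ℕ) : waveVector Q j ≠ 0 := fun h0 => by
  have := norm_waveVector Q j
  simp [h0] at this

theorem RotInv.conv3 (hQ : Q ≠ 0) {f g h : quasilattice Q → A} (hf : RotInv f) (hg : RotInv g)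
    (hh : RotInv h) : RotInv (conv3 f g h) := by
  intro k k' hk
  unfold SwiftHohenberg.conv3
  let e : {p : quasilattice Q × quasilattice Q × quasilattice Q //
      (p.1 : ℂ) + (p.2.1 : ℂ) + (p.2.2 : ℂ) = (k : ℂ)} ≃
      {p : quasilattice Q × quasilattice Q × quasilattice Q //
      (p.1 : ℂ) + (p.2.1 : ℂ) + (p.2.2 : ℂ) = (k' : ℂ)} :=
    Equiv.subtypeEquiv (Equiv.prodCongr (rotate hQ) (Equiv.prodCongr (rotate hQ) (rotate hQ)))
      fun p => by
        simp only [Equiv.prodCongr_apply, Prod.map, rotate, Equiv.coe_fn_mk, hk, ← mul_add]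
        exact (mul_right_injective₀ (waveVector_ne_zero Q 1)).eq_iff.symm
  rw [← e.tsum_eq]
  refine tsum_congr fun p => ?_
  simp only [e, Equiv.subtypeEquiv_apply, Equiv.prodCongr_apply, Prod.map]
  rw [hf p.1.1 _ rfl, hg p.1.2.1 _ rfl, hh p.1.2.2 _ rfl]

theorem RotInv.apply_pow (hQ : Q ≠ 0) {f : quasilattice Q → A} (hf : RotInv f) (i : ℕ)
    (k k' : quasilattice Q) (hk : (k' : ℂ) = waveVector Q 1 ^ i * k) : f k' = f k := by
  induction i generalizing k' with
  | zero => exact congrArg f (Subtype.ext (by simpa using hk))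
  | succ i ih =>
    rw [hf ⟨_, (pow_mul_mem_order hQ k.2 i).1⟩ k' (by rw [hk, pow_succ', mul_assoc])]
    exact ih _ rfl

/-- Since Q is even, -1 is one of the rotations. Invariant families are thus even in k, and those
with real coefficients represent real functions. -/
theorem RotInv.apply_neg (hQ : Q ≠ 0) (he : Even Q) {f : quasilattice Q → A} (hf : RotInv f)
    (k k' : quasilattice Q) (hk : (k' : ℂ) = -k) : f k' = f k :=
  hf.apply_pow hQ (Q / 2) k k' (by rw [waveVector_half hQ he, hk]; ring)

/-- The wavevector `1` as a point of the quasilattice. -/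
def unitPoint (Q : ℕ) [NeZero Q] : quasilattice Q := ⟨waveVector Q (0 : Fin Q), waveVector_mem 0⟩

/-- The basic wavevectors form a single orbit: for invariant families the kernel of (1 + Δ)² is
one-dimensional, and one solvability condition at `unitPoint` suffices. -/
theorem RotInv.apply_waveVector [NeZero Q] {f : quasilattice Q → A} (hf : RotInv f)
    {k : quasilattice Q} {j : Fin Q} (hk : (k : ℂ) = waveVector Q j) : f k = f (unitPoint Q) :=
  hf.apply_pow (NeZero.ne Q) j _ _ (by
    rw [hk, unitPoint, ← waveVector_eq_pow]; simp [waveVector_eq_pow Q 0])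

end Rotation

/-! ### Resonant triples of basic wavevectors and the constant β. -/

section UnitVectors
variable {Q : ℕ}

/-- Membership in the set of basic wavevectors. -/
def IsWave (Q : ℕ) (k : ℂ) : Prop := ∃ j : Fin Q, k = waveVector Q j

theorem IsWave.norm {k : ℂ} (h : IsWave Q k) : ‖k‖ = 1 := by
  obtain ⟨j, rfl⟩ := h; exact norm_waveVector Q j

theorem IsWave.mem {k : ℂ} (h : IsWave Q k) : k ∈ quasilattice Q := by
  obtain ⟨j, rfl⟩ := h; exact waveVector_mem j

theorem IsWave.order_le {k : ℂ} (h : IsWave Q k) : order Q k ≤ 1 := by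
  obtain ⟨j, rfl⟩ := h; exact order_waveVector_le j

theorem isWave_iff [NeZero Q] (he : Even Q) (k : quasilattice Q) : IsWave Q k ↔ ‖(k : ℂ)‖ = 1 :=
  ⟨IsWave.norm, exists_eq_waveVector (NeZero.ne Q) he k.2⟩

theorem IsWave.neg [NeZero Q] (he : Even Q) {k : ℂ} (h : IsWave Q k) : IsWave Q (-k) :=
  (isWave_iff he ⟨-k, neg_mem_quasilattice (NeZero.ne Q) he h.mem⟩).2 (by simpa using h.norm)

/-- Conjugating the relation gives a⁻¹ + b⁻¹ + c⁻¹ = d⁻¹, that is e₂ d = e₃ for the elementary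
symmetric functions. With e₁ = d the polynomial (X - a)(X - b)(X - c) then vanishes at d. -/
theorem unit_triple {a b c d : ℂ} (ha : ‖a‖ = 1) (hb : ‖b‖ = 1) (hc : ‖c‖ = 1) (hd : ‖d‖ = 1)
    (h : a + b + c = d) : (a = d ∧ c = -b) ∨ (b = d ∧ c = -a) ∨ (c = d ∧ b = -a) := by
  have h1 : a⁻¹ + b⁻¹ + c⁻¹ = d⁻¹ := by
    rw [Complex.inv_eq_conj ha, Complex.inv_eq_conj hb, Complex.inv_eq_conj hc,
      Complex.inv_eq_conj hd, ← h]
    simp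
  have ha0 : a ≠ 0 := by rintro rfl; simp at ha
  have hb0 : b ≠ 0 := by rintro rfl; simp at hb
  have hc0 : c ≠ 0 := by rintro rfl; simp at hc
  have hd0 : d ≠ 0 := by rintro rfl; simp at hd
  have h2 : (b * c + a * c + a * b) * d = a * b * c := by
    field_simp at h1
    linear_combination h1
  have h3 : (d - a) * ((d - b) * (d - c)) = 0 := by
    linear_combination (-d ^ 2) * h + h2
  rcases mul_eq_zero.1 h3 with h4 | h4
  · exact Or.inl ⟨(sub_eq_zero.1 h4).symm, by linear_combination h + h4⟩
  rcases mul_eq_zero.1 h4 with h5 | h5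
  · exact Or.inr (Or.inl ⟨(sub_eq_zero.1 h5).symm, by linear_combination h + h5⟩)
  · exact Or.inr (Or.inr ⟨(sub_eq_zero.1 h5).symm, by linear_combination h + h5⟩)

open Classical in
/-- The basic wavevectors as a finite set. -/
def waves (Q : ℕ) : Finset ℂ := Finset.univ.image fun j : Fin Q => waveVector Q j

theorem mem_waves {k : ℂ} : k ∈ waves Q ↔ IsWave Q k := by
  simp [waves, IsWave, eq_comm]

theorem card_waves (hQ : Q ≠ 0) : (waves Q).card = Q := by
  classical
  unfold waves
  rw [Finset.card_image_of_injective, Finset.card_univ, Fintype.card_fin]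
  intro i j hij
  have h : waveVector Q 1 ^ (i : ℕ) = waveVector Q 1 ^ (j : ℕ) := by
    rw [← waveVector_eq_pow, ← waveVector_eq_pow]; exact hij
  exact Fin.ext ((isPrimitiveRoot_waveVector hQ).pow_inj i.2 j.2 h)

open Classical in
/-- The leading term `∑ⱼ exp (i kⱼ · x)` with real coefficients. -/
def leadR (Q : ℕ) : quasilattice Q → ℝ := fun k => if IsWave Q k then 1 else 0

open Classical in
/-- The triples of basic wavevectors with sum `d`. -/
def unitTriples (Q : ℕ) (d : ℂ) : Finset (ℂ × ℂ × ℂ) :=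
  ((waves Q).image (fun b => (d, b, -b)) ∪ ((waves Q).erase d).image (fun b => (b, d, -b))) ∪
    (((waves Q).erase d).erase (-d)).image (fun b => (b, -b, d))

/-- The erasures make the three families disjoint, with Q, Q - 1 and Q - 2 members; the total is 3(Q
- 1). -/
theorem card_unitTriples [NeZero Q] (he : Even Q) {d : ℂ} (hd : IsWave Q d) :
    ((unitTriples Q d).card : ℝ) = beta Q := by
  classical
  have hQ2 : 2 ≤ Q := by
    obtain ⟨h, hh⟩ := he
    have := NeZero.ne Q
    omega
  have hd0 : d ≠ -d := fun h => by
    have h2 : d = 0 := by linear_combination (1 / 2 : ℂ) * h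
    have := hd.norm
    simp [h2] at this
  have hc1 : ((waves Q).erase d).card = Q - 1 := by
    rw [Finset.card_erase_of_mem (mem_waves.2 hd), card_waves (NeZero.ne Q)]
  have hc2 : (((waves Q).erase d).erase (-d)).card = Q - 1 - 1 := by
    rw [Finset.card_erase_of_mem (Finset.mem_erase.2 ⟨hd0.symm, mem_waves.2 (hd.neg he)⟩), hc1]
  unfold unitTriples
  rw [Finset.card_union_of_disjoint, Finset.card_union_of_disjoint,
    Finset.card_image_of_injective, Finset.card_image_of_injective, Finset.card_image_of_injective,
    hc2, hc1, card_waves (NeZero.ne Q), beta]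
  · push_cast [Nat.cast_sub (show 1 ≤ Q by omega), Nat.cast_sub (show 1 ≤ Q - 1 by omega)]
    ring
  · intro a b h; exact (Prod.ext_iff.1 h).1
  · intro a b h; exact (Prod.ext_iff.1 h).1
  · intro a b h; exact (Prod.ext_iff.1 (Prod.ext_iff.1 h).2).1
  · rw [Finset.disjoint_left]
    rintro x hx hx'
    obtain ⟨b, _, rfl⟩ := Finset.mem_image.1 hx
    obtain ⟨b', hb', h⟩ := Finset.mem_image.1 hx'
    exact (Finset.mem_erase.1 hb').1 (Prod.ext_iff.1 h).1
  · rw [Finset.disjoint_left]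
    rintro x hx hx'
    obtain ⟨b', hb', rfl⟩ := Finset.mem_image.1 hx'
    rw [Finset.mem_erase, Finset.mem_erase] at hb'
    rcases Finset.mem_union.1 hx with hx | hx
    · obtain ⟨b, _, h⟩ := Finset.mem_image.1 hx
      exact hb'.2.1 (Prod.ext_iff.1 h).1.symm
    · obtain ⟨b, _, h⟩ := Finset.mem_image.1 hx
      have : d = -b' := (Prod.ext_iff.1 (Prod.ext_iff.1 h).2).1
      exact hb'.1 (by rw [this, neg_neg])

theorem mem_unitTriples [NeZero Q] (he : Even Q) {d : ℂ} (hd : IsWave Q d) (p : ℂ × ℂ × ℂ) :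
    p ∈ unitTriples Q d ↔
      IsWave Q p.1 ∧ IsWave Q p.2.1 ∧ IsWave Q p.2.2 ∧ p.1 + p.2.1 + p.2.2 = d := by
  classical
  obtain ⟨a, b, c⟩ := p
  constructor
  · intro h
    unfold unitTriples at h
    rcases Finset.mem_union.1 h with h | h
    · rcases Finset.mem_union.1 h with h | h <;> obtain ⟨x, hx, h⟩ := Finset.mem_image.1 h <;>
        simp only [Prod.mk.injEq] at h <;> obtain ⟨rfl, rfl, rfl⟩ := h
      · have := mem_waves.1 hx
        exact ⟨hd, this, this.neg he, by simp⟩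
      · have := mem_waves.1 (Finset.mem_of_mem_erase hx)
        exact ⟨this, hd, this.neg he, by simp⟩
    · obtain ⟨x, hx, h⟩ := Finset.mem_image.1 h
      simp only [Prod.mk.injEq] at h
      obtain ⟨rfl, rfl, rfl⟩ := h
      have := mem_waves.1 (Finset.mem_of_mem_erase (Finset.mem_of_mem_erase hx))
      exact ⟨this, this.neg he, hd, by simp⟩
  · rintro ⟨ha, hb, hc, h⟩
    simp only at ha hb hc h
    unfold unitTriples
    simp only [Finset.mem_union, Finset.mem_image, Finset.mem_erase, mem_waves, Prod.mk.injEq]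
    by_cases had : a = d
    · exact Or.inl (Or.inl ⟨b, hb, had.symm, rfl, by linear_combination had - h⟩)
    rcases unit_triple ha.norm hb.norm hc.norm hd.norm h with ⟨h1, _⟩ | ⟨h1, h2⟩ | ⟨h1, h2⟩
    · exact absurd h1 had
    · exact Or.inl (Or.inr ⟨a, ⟨had, ha⟩, rfl, h1.symm, h2.symm⟩)
    · by_cases hbd : b = d
      · exact Or.inl (Or.inr ⟨a, ⟨had, ha⟩, rfl, hbd.symm, by linear_combination hbd - h⟩)
      · refine Or.inr ⟨a, ⟨fun h3 => hbd ?_, had, ha⟩, rfl, h2.symm, h1.symm⟩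
        rw [h2, h3, neg_neg]

/-- The coefficient counts the triples in `unitTriples`. This is the source of the normalization
√(μ/β): it makes the lowest order solvable. -/
theorem conv3_leadR [NeZero Q] (he : Even Q) {k : quasilattice Q} (hk : IsWave Q k) :
    conv3 (leadR Q) (leadR Q) (leadR Q) k = beta Q := by
  classical
  rw [← card_unitTriples he hk]
  let g : {p : quasilattice Q × quasilattice Q × quasilattice Q //
      (p.1 : ℂ) + (p.2.1 : ℂ) + (p.2.2 : ℂ) = (k : ℂ)} → ℂ × ℂ × ℂ :=
    fun p => (p.1.1, p.1.2.1, p.1.2.2)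
  have hg : Function.Injective g := fun p q h => by
    simp only [g, Prod.mk.injEq] at h
    exact Subtype.ext (Prod.ext (Subtype.ext h.1) (Prod.ext (Subtype.ext h.2.1) (Subtype.ext h.2.2)))
  let F : ℂ × ℂ × ℂ → ℝ := fun x => if x ∈ unitTriples Q k then 1 else 0
  have h1 : ∑' p, F (g p) = ∑' x, F x := by
    refine hg.tsum_eq fun x hx => ?_
    have hx' : x ∈ unitTriples Q k := by
      by_contra h; exact hx (by simp [F, h])
    obtain ⟨ha, hb, hc, h⟩ := (mem_unitTriples he hk x).1 hx'
    exact ⟨⟨(⟨_, ha.mem⟩, ⟨_, hb.mem⟩, ⟨_, hc.mem⟩), h⟩, rfl⟩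
  have h2 : ∑' x, F x = (unitTriples Q k).card := by
    rw [tsum_eq_sum (s := unitTriples Q k) (fun x hx => by simp [F, hx])]
    simp [F]
  rw [← h2, ← h1]
  unfold conv3
  refine tsum_congr fun p => ?_
  have := mem_unitTriples he hk (g p)
  simp only [F, leadR, this]
  simp only [g]
  by_cases ha : IsWave Q p.1.1 <;> by_cases hb : IsWave Q p.1.2.1 <;>
    by_cases hc : IsWave Q p.1.2.2 <;> simp [ha, hb, hc, p.2]

end UnitVectors
end
end SwiftHohenberg

namespace SwiftHohenberg
noncomputable section

/-! ### Construction of the formal solution with real coefficients. -/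

section FormalSolution
variable {Q : ℕ} {A : Type*} [NormedCommRing A]

/-- The symbol `(1 - |k|²)²` of `(1 + Δ)²`. -/
def symbol (k : ℂ) : ℝ := (1 - ‖k‖ ^ 2) ^ 2

theorem symbol_nonneg (k : ℂ) : 0 ≤ symbol k := sq_nonneg _

theorem IsWave.symbol {k : ℂ} (h : IsWave Q k) : symbol k = 0 := by
  simp [SwiftHohenberg.symbol, h.norm]

theorem symbol_ne_zero [NeZero Q] (he : Even Q) {k : quasilattice Q} (h : ¬ IsWave Q k) :
    symbol k ≠ 0 := by
  intro h0
  apply h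
  rw [isWave_iff he]
  have h1 : ‖(k : ℂ)‖ ^ 2 = 1 := by
    have := pow_eq_zero_iff two_ne_zero |>.1 h0
    linarith
  exact (pow_eq_one_iff_of_nonneg (norm_nonneg _) two_ne_zero).1 h1

theorem isWave_rotate_iff [NeZero Q] (he : Even Q) {k k' : quasilattice Q}
    (hk : (k' : ℂ) = waveVector Q 1 * k) : IsWave Q k' ↔ IsWave Q k := by
  rw [isWave_iff he, isWave_iff he, hk, norm_mul, norm_waveVector, one_mul]

theorem symbol_rotate {k k' : ℂ} (hk : k' = waveVector Q 1 * k) : symbol k' = symbol k := by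
  rw [hk, symbol, symbol, norm_mul, norm_waveVector, one_mul]

theorem isWave_unitPoint (Q : ℕ) [NeZero Q] : IsWave Q (unitPoint Q) := ⟨0, rfl⟩

/-- The order `n` part of the cube of a power series with coefficients `u`. -/
def cubeSum (u : ℕ → quasilattice Q → A) (n : ℕ) : quasilattice Q → A :=
  ∑ p ∈ Finset.HasAntidiagonal.antidiagonal n,
      ∑ q ∈ Finset.HasAntidiagonal.antidiagonal p.2, conv3 (u p.1) (u q.1) (u q.2)

theorem cubeSum_congr {u u' : ℕ → quasilattice Q → A} {n : ℕ} (h : ∀ j ≤ n, u j = u' j) :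
    cubeSum u n = cubeSum u' n := by
  refine Finset.sum_congr rfl fun p hp => Finset.sum_congr rfl fun q hq => ?_
  have h1 := Finset.HasAntidiagonal.mem_antidiagonal.1 hp
  have h2 := Finset.HasAntidiagonal.mem_antidiagonal.1 hq
  rw [h p.1 (by omega), h q.1 (by omega), h q.2 (by omega)]

/-- Changing the last coefficient changes the cube linearly. -/
theorem cubeSum_sub [CompleteSpace A] {x y : ℕ → quasilattice Q → A} {N : ℕ} (hN : 0 < N)
    (hx : ∀ n, Summable fun k => ‖x n k‖) (hy : ∀ n, Summable fun k => ‖y n k‖)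
    (hxy : ∀ j < N, x j = y j) :
    cubeSum x N - cubeSum y N = conv3 (x N - y N) (x 0) (x 0) + conv3 (x 0) (x N - y N) (x 0)
      + conv3 (x 0) (x 0) (x N - y N) := by
  -- Telescoping of each product. As x and y agree below N, only the index triples (N,0,0), (0,N,0)
  -- and (0,0,N) survive.
  have hterm : cubeSum x N - cubeSum y N
      = (∑ p ∈ Finset.HasAntidiagonal.antidiagonal N,
          ∑ q ∈ Finset.HasAntidiagonal.antidiagonal p.2, conv3 (x p.1 - y p.1) (x q.1) (x q.2))
        + (∑ p ∈ Finset.HasAntidiagonal.antidiagonal N,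
          ∑ q ∈ Finset.HasAntidiagonal.antidiagonal p.2, conv3 (y p.1) (x q.1 - y q.1) (x q.2))
        + (∑ p ∈ Finset.HasAntidiagonal.antidiagonal N,
          ∑ q ∈ Finset.HasAntidiagonal.antidiagonal p.2, conv3 (y p.1) (y q.1) (x q.2 - y q.2)) := by
    unfold cubeSum
    simp only [← Finset.sum_sub_distrib, ← Finset.sum_add_distrib]
    refine Finset.sum_congr rfl fun p _ => Finset.sum_congr rfl fun q _ => ?_
    rw [conv3_sub₁ (hx _) (hy _) (hx _) (hx _), conv3_sub₂ (hy _) (hx _) (hy _) (hx _),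
      conv3_sub₃ (hy _) (hy _) (hx _) (hy _)]
    abel
  have hz : ∀ j, j < N → x j - y j = 0 := fun j hj => by rw [hxy j hj, sub_self]
  have h0 : y 0 = x 0 := (hxy 0 hN).symm
  rw [hterm]
  congr 1
  · congr 1
    · rw [Finset.sum_eq_single_of_mem (N, 0) (Finset.HasAntidiagonal.mem_antidiagonal.2 (by simp))]
      · simp
      · intro p hp hne
        have h1 := Finset.HasAntidiagonal.mem_antidiagonal.1 hp
        have h2 : p.1 < N := by
          rcases Nat.lt_or_ge p.1 N with h | h
          · exact h
          · exact absurd (Prod.ext (by simp only; omega) (by simp only; omega)) hne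
        exact Finset.sum_eq_zero fun q _ => by rw [hz _ h2, conv3_zero₁]
    · rw [Finset.sum_eq_single_of_mem (0, N) (Finset.HasAntidiagonal.mem_antidiagonal.2 (by simp))]
      · rw [Finset.sum_eq_single_of_mem (N, 0) (Finset.HasAntidiagonal.mem_antidiagonal.2 (by simp))]
        · simp [h0]
        · intro q hq hne
          have h1 := Finset.HasAntidiagonal.mem_antidiagonal.1 hq
          simp only at h1
          have h2 : q.1 < N := by
            rcases Nat.lt_or_ge q.1 N with h | h
            · exact h
            · exact absurd (Prod.ext (by simp only; omega) (by simp only; omega)) hne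
          rw [hz _ h2, conv3_zero₂]
      · intro p hp hne
        have h1 := Finset.HasAntidiagonal.mem_antidiagonal.1 hp
        refine Finset.sum_eq_zero fun q hq => ?_
        have h3 := Finset.HasAntidiagonal.mem_antidiagonal.1 hq
        have h2 : p.2 < N := by
          rcases Nat.lt_or_ge p.2 N with h | h
          · exact h
          · exact absurd (Prod.ext (by simp only; omega) (by simp only; omega)) hne
        rw [hz _ (by omega), conv3_zero₂]
  · rw [Finset.sum_eq_single_of_mem (0, N) (Finset.HasAntidiagonal.mem_antidiagonal.2 (by simp))]
    · rw [Finset.sum_eq_single_of_mem (0, N) (Finset.HasAntidiagonal.mem_antidiagonal.2 (by simp))]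
      · simp [h0]
      · intro q hq hne
        have h1 := Finset.HasAntidiagonal.mem_antidiagonal.1 hq
        simp only at h1
        have h2 : q.2 < N := by
          rcases Nat.lt_or_ge q.2 N with h | h
          · exact h
          · exact absurd (Prod.ext (by simp only; omega) (by simp only; omega)) hne
        rw [hz _ h2, conv3_zero₃]
    · intro p hp hne
      have h1 := Finset.HasAntidiagonal.mem_antidiagonal.1 hp
      refine Finset.sum_eq_zero fun q hq => ?_
      have h3 := Finset.HasAntidiagonal.mem_antidiagonal.1 hq
      have h2 : p.2 < N := by
        rcases Nat.lt_or_ge p.2 N with h | h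
        · exact h
        · exact absurd (Prod.ext (by simp only; omega) (by simp only; omega)) hne
      rw [hz _ (by omega), conv3_zero₃]

theorem RotInv.sum {κ : Type*} (t : Finset κ) {f : κ → quasilattice Q → A}
    (h : ∀ i ∈ t, RotInv (f i)) : RotInv (∑ i ∈ t, f i) := fun k k' hk => by
  simp only [Finset.sum_apply]
  exact Finset.sum_congr rfl fun i hi => h i hi k k' hk

theorem RotInv.cubeSum (hQ : Q ≠ 0) {u : ℕ → quasilattice Q → A} {n : ℕ}
    (h : ∀ j ≤ n, RotInv (u j)) : RotInv (cubeSum u n) := by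
  refine RotInv.sum _ fun p hp => RotInv.sum _ fun q hq => ?_
  have h1 := Finset.HasAntidiagonal.mem_antidiagonal.1 hp
  have h2 := Finset.HasAntidiagonal.mem_antidiagonal.1 hq
  exact (h _ (by omega)).conv3 hQ (h _ (by omega)) (h _ (by omega))

/-- The family `f` vanishes at all points of order larger than `n`. -/
def SuppLe (f : quasilattice Q → A) (n : ℕ) : Prop :=
  ∀ k : quasilattice Q, n < order Q k → f k = 0

theorem finite_order_le (Q n : ℕ) : {k : quasilattice Q | order Q k ≤ n}.Finite := by
  have h1 : (waveSum Q '' Set.Iic (fun _ => n)).Finite := (Set.finite_Iic _).image _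
  refine (h1.preimage (f := fun k : quasilattice Q => (k : ℂ))
    (Subtype.val_injective.injOn)).subset fun k hk => ?_
  obtain ⟨m, hm, hm'⟩ := exists_waveSum_eq k.2
  refine ⟨m, fun j => ?_, hm⟩
  have := Finset.single_le_sum (f := m) (fun _ _ => Nat.zero_le _) (Finset.mem_univ j)
  have hk' : order Q k ≤ n := hk
  exact this.trans (hm'.trans_le hk')

theorem SuppLe.summable {f : quasilattice Q → A} {n : ℕ} (h : SuppLe f n)
    (g : quasilattice Q → A → ℝ) (hg : ∀ k, g k 0 = 0) : Summable fun k => g k (f k) := by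
  refine summable_of_ne_finset_zero (s := (finite_order_le Q n).toFinset) fun k hk => ?_
  rw [h k (by simpa using hk), hg]

theorem SuppLe.summable_norm {f : quasilattice Q → A} {n : ℕ} (h : SuppLe f n) :
    Summable fun k => ‖f k‖ := h.summable (fun _ x => ‖x‖) fun _ => norm_zero

theorem SuppLe.conv3 {f g h : quasilattice Q → A} {a b c : ℕ} (hf : SuppLe f a) (hg : SuppLe g b)
    (hh : SuppLe h c) : SuppLe (conv3 f g h) (a + b + c) := by
  intro k hk
  unfold SwiftHohenberg.conv3
  refine (tsum_congr fun p => ?_).trans tsum_zero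
  have h1 := order_add_le (add_mem_quasilattice p.1.1.2 p.1.2.1.2) p.1.2.2.2
  have h2 := order_add_le p.1.1.2 p.1.2.1.2
  rw [p.2] at h1
  by_cases ha : a < order Q p.1.1
  · simp [hf _ ha]
  by_cases hb : b < order Q p.1.2.1
  · simp [hg _ hb]
  · simp [hh _ (show c < order Q p.1.2.2 by omega)]

/-- Orders are subadditive, and (2a + 1) + (2b + 1) + (2c + 1) = 2n + 3 when a + b + c = n. -/
theorem SuppLe.cubeSum {u : ℕ → quasilattice Q → A} {n : ℕ}
    (h : ∀ j ≤ n, SuppLe (u j) (2 * j + 1)) : SuppLe (cubeSum u n) (2 * n + 3) := by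
  intro k hk
  unfold SwiftHohenberg.cubeSum
  simp only [Finset.sum_apply]
  refine Finset.sum_eq_zero fun p hp => Finset.sum_eq_zero fun q hq => ?_
  have h1 := Finset.HasAntidiagonal.mem_antidiagonal.1 hp
  have h2 := Finset.HasAntidiagonal.mem_antidiagonal.1 hq
  exact ((h p.1 (by omega)).conv3 (h q.1 (by omega)) (h q.2 (by omega))) k (by omega)

theorem suppLe_leadR (Q : ℕ) : SuppLe (leadR Q) 1 := fun k hk => by
  unfold leadR
  rw [if_neg]
  intro h
  have := h.order_le
  omega

theorem rotInv_leadR [NeZero Q] (he : Even Q) : RotInv (leadR Q) := fun k k' hk => by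
  classical
  unfold leadR
  exact if_congr (isWave_rotate_iff he hk) rfl rfl

theorem leadR_wave {k : quasilattice Q} (h : IsWave Q k) : leadR Q k = 1 := if_pos h

theorem leadR_not_wave {k : quasilattice Q} (h : ¬ IsWave Q k) : leadR Q k = 0 := if_neg h

theorem beta_pos (hQ : 2 ≤ Q) : 0 < beta Q := by
  unfold beta
  have : (2 : ℝ) ≤ Q := by exact_mod_cast hQ
  linarith

open Classical in
/-- The component off the kernel of the coefficient of order `n + 1`. -/
def offKernel (u : ℕ → quasilattice Q → ℝ) (n : ℕ) : quasilattice Q → ℝ := fun k =>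
  if IsWave Q k then 0 else (u n k - (beta Q)⁻¹ * cubeSum u n k) / symbol k

/-- The component along the kernel of the coefficient of order `n + 1`. -/
def kernelCoeff [NeZero Q] (u : ℕ → quasilattice Q → ℝ) (n : ℕ) : ℝ :=
  -(2 * beta Q)⁻¹ * cubeSum (Function.update u (n + 1) (offKernel u n)) (n + 1) (unitPoint Q)

/-- The coefficient of order `n + 1` of the formal solution. -/
def nextTerm [NeZero Q] (u : ℕ → quasilattice Q → ℝ) (n : ℕ) : quasilattice Q → ℝ :=
  fun k => offKernel u n k + kernelCoeff u n * leadR Q k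

/-- The formal solution truncated at order `n`. -/
def truncSeq (Q : ℕ) [NeZero Q] : ℕ → ℕ → quasilattice Q → ℝ
  | 0 => fun j => if j = 0 then leadR Q else 0
  | n + 1 => Function.update (truncSeq Q n) (n + 1) (nextTerm (truncSeq Q n) n)

/-- The formal solution, with real coefficients. -/
def formalSeq (Q : ℕ) [NeZero Q] (n : ℕ) : quasilattice Q → ℝ := truncSeq Q n n

theorem truncSeq_eq [NeZero Q] {n j : ℕ} (h : j ≤ n) : truncSeq Q n j = formalSeq Q j := by
  induction n with
  | zero => obtain rfl : j = 0 := by omega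
            rfl
  | succ n ih =>
    rcases Nat.lt_or_ge n j with h1 | h1
    · obtain rfl : j = n + 1 := by omega
      rfl
    · rw [← ih h1]
      exact Function.update_of_ne (by omega) _ _

theorem formalSeq_zero [NeZero Q] : formalSeq Q 0 = leadR Q := rfl

theorem offKernel_congr {u u' : ℕ → quasilattice Q → ℝ} {n : ℕ} (h : ∀ j ≤ n, u j = u' j) :
    offKernel u n = offKernel u' n := by
  unfold offKernel
  rw [cubeSum_congr h, h n le_rfl]

/-- Only the terms of order at most n enter: `kernelCoeff` overwrites the slot n + 1 before reading
it. -/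
theorem formalSeq_succ [NeZero Q] (n : ℕ) :
    formalSeq Q (n + 1) = nextTerm (formalSeq Q) n := by
  have h1 : formalSeq Q (n + 1) = nextTerm (truncSeq Q n) n := Function.update_self _ _ _
  have h2 : ∀ j ≤ n, truncSeq Q n j = formalSeq Q j := fun j hj => truncSeq_eq hj
  rw [h1]
  unfold nextTerm kernelCoeff
  rw [offKernel_congr h2]
  have h3 : cubeSum (Function.update (truncSeq Q n) (n + 1) (offKernel (formalSeq Q) n)) (n + 1)
      = cubeSum (Function.update (formalSeq Q) (n + 1) (offKernel (formalSeq Q) n)) (n + 1) := by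
    refine cubeSum_congr fun j hj => ?_
    rcases eq_or_ne j (n + 1) with rfl | hne
    · simp
    · rw [Function.update_of_ne hne, Function.update_of_ne hne, h2 j (by omega)]
  rw [h3]

theorem suppLe_offKernel {u : ℕ → quasilattice Q → ℝ} {n : ℕ}
    (h : ∀ j ≤ n, SuppLe (u j) (2 * j + 1)) : SuppLe (offKernel u n) (2 * n + 3) := fun k hk => by
  unfold offKernel
  rw [h n le_rfl k (by omega), SuppLe.cubeSum h k hk]
  simp

theorem suppLe_formalSeq [NeZero Q] (n : ℕ) : SuppLe (formalSeq Q n) (2 * n + 1) := by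
  induction n using Nat.strong_induction_on with
  | _ n ih =>
    cases n with
    | zero => exact suppLe_leadR Q
    | succ n =>
      intro k hk
      rw [formalSeq_succ, nextTerm, suppLe_offKernel (fun j hj => ih j (by omega)) k (by omega),
        suppLe_leadR Q k (by omega)]
      simp

theorem rotInv_offKernel [NeZero Q] (he : Even Q) {u : ℕ → quasilattice Q → ℝ} {n : ℕ}
    (h : ∀ j ≤ n, RotInv (u j)) : RotInv (offKernel u n) := fun k k' hk => by
  have h1 : cubeSum u n k' = cubeSum u n k := RotInv.cubeSum (NeZero.ne Q) h k k' hk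
  classical
  unfold offKernel
  rw [h n le_rfl k k' hk, h1, symbol_rotate hk]
  exact if_congr (isWave_rotate_iff he hk) rfl rfl

theorem rotInv_formalSeq [NeZero Q] (he : Even Q) (n : ℕ) : RotInv (formalSeq Q n) := by
  induction n using Nat.strong_induction_on with
  | _ n ih =>
    cases n with
    | zero => exact rotInv_leadR he
    | succ n =>
      intro k k' hk
      rw [formalSeq_succ, nextTerm, nextTerm, rotInv_leadR he k k' hk,
        rotInv_offKernel he (fun j hj => ih j (by omega)) k k' hk]

theorem offKernel_wave {u : ℕ → quasilattice Q → ℝ} {n : ℕ} {k : quasilattice Q}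
    (h : IsWave Q k) : offKernel u n k = 0 := if_pos h

theorem conv3_smul_leadR [NeZero Q] (he : Even Q) (a : ℝ) {k : quasilattice Q} (h : IsWave Q k) :
    conv3 (fun k => a * leadR Q k) (leadR Q) (leadR Q) k = a * beta Q := by
  have hs := (suppLe_leadR Q).summable_norm
  rw [conv3_const_mul a hs hs hs, conv3_leadR he h]

/-- The solvability condition at each order. -/
theorem formalSeq_solvable [NeZero Q] (hQ : 2 ≤ Q) (he : Even Q) (n : ℕ) :
    formalSeq Q n (unitPoint Q) = (beta Q)⁻¹ * cubeSum (formalSeq Q) n (unitPoint Q) := by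
  have hβ := (beta_pos hQ).ne'
  have hw := isWave_unitPoint Q
  cases n with
  | zero =>
    have : cubeSum (formalSeq Q) 0 = conv3 (leadR Q) (leadR Q) (leadR Q) := by
      simp [cubeSum, formalSeq_zero]
    rw [this, conv3_leadR he hw, formalSeq_zero, leadR_wave hw, inv_mul_cancel₀ hβ]
  | succ n =>
    have hs := fun j => (suppLe_formalSeq (Q := Q) j).summable_norm
    set v := offKernel (formalSeq Q) n with hv
    set y := Function.update (formalSeq Q) (n + 1) v with hy
    have hys : ∀ j, Summable fun k => ‖y j k‖ := fun j => by
      rcases eq_or_ne j (n + 1) with rfl | hne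
      · simp only [hy, Function.update_self]
        exact (suppLe_offKernel fun j _ => suppLe_formalSeq j).summable_norm
      · simp only [hy, Function.update_of_ne hne]
        exact hs j
    have key := cubeSum_sub (Nat.succ_pos n) hs hys fun j hj => by
      rw [hy, Function.update_of_ne (by omega)]
    set α := kernelCoeff (formalSeq Q) n with hα
    have hdiff : formalSeq Q (n + 1) - y (n + 1) = fun k => α * leadR Q k := by
      rw [hy, Function.update_self, formalSeq_succ]
      funext k
      simp only [Pi.sub_apply, nextTerm]
      ring
    simp only [Nat.succ_eq_add_one] at key
    rw [hdiff, formalSeq_zero] at key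
    have key1 := congrFun key (unitPoint Q)
    simp only [Pi.sub_apply, Pi.add_apply] at key1
    rw [conv3_rotate_args (leadR Q) (fun k => α * leadR Q k),
      conv3_rotate_args (leadR Q) (leadR Q) (fun k => α * leadR Q k),
      conv3_rotate_args (leadR Q) (fun k => α * leadR Q k), conv3_smul_leadR he α hw] at key1
    have h1 : formalSeq Q (n + 1) (unitPoint Q) = α := by
      rw [formalSeq_succ, nextTerm, offKernel_wave hw, leadR_wave hw]
      ring
    have h2 : α = -(2 * beta Q)⁻¹ * cubeSum y (n + 1) (unitPoint Q) := rfl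
    rw [h1]
    -- Adding α times the leading term changes the cube at a basic wavevector by 3αβ. With c the
    -- cube before this change, solvability reads α = β⁻¹(c + 3αβ), i.e. α = -c/(2β), the value
    -- taken by `kernelCoeff`.
    have h3 : cubeSum (formalSeq Q) (n + 1) (unitPoint Q)
        = cubeSum y (n + 1) (unitPoint Q) + 3 * (α * beta Q) := by linarith
    rw [h3]
    have h4 : cubeSum y (n + 1) (unitPoint Q) = -(2 * beta Q) * α := by
      rw [h2]; field_simp
    rw [h4]
    field_simp
    ring

/-- The equations of all orders for the formal solution. -/
theorem symbol_mul_formalSeq [NeZero Q] (hQ : 2 ≤ Q) (he : Even Q) (n : ℕ) (k : quasilattice Q) :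
    symbol k * formalSeq Q (n + 1) k
      = formalSeq Q n k - (beta Q)⁻¹ * cubeSum (formalSeq Q) n k := by
  by_cases h : IsWave Q k
  · rw [h.symbol, zero_mul]
    obtain ⟨j, hj⟩ := h
    rw [(rotInv_formalSeq he n).apply_waveVector hj,
      (RotInv.cubeSum (NeZero.ne Q) fun j _ => rotInv_formalSeq he j).apply_waveVector hj,
      formalSeq_solvable hQ he, sub_self]
  · rw [formalSeq_succ, nextTerm, leadR_not_wave h, offKernel, if_neg h, mul_zero, add_zero,
      mul_div_cancel₀ _ (symbol_ne_zero he h)]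

end FormalSolution

/-! ### The formal solution in H_s, its uniqueness, and the embedding of H_s in ℓ¹. -/

section Complexification
variable {Q : ℕ}

/-- A family of real coefficients as a family of complex coefficients. -/
def toC (f : quasilattice Q → ℝ) : Coeffs Q := fun k => (f k : ℂ)

theorem conv3_toC {f g h : quasilattice Q → ℝ} (hf : Summable fun k => ‖f k‖)
    (hg : Summable fun k => ‖g k‖) (hh : Summable fun k => ‖h k‖) :
    conv3 (toC f) (toC g) (toC h) = toC (conv3 f g h) := by
  funext k
  exact (map_conv3 Complex.ofRealHom Complex.continuous_ofReal hf hg hh k).symm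

theorem cubeSum_toC {u : ℕ → quasilattice Q → ℝ} (hu : ∀ n, Summable fun k => ‖u n k‖) (n : ℕ) :
    cubeSum (fun n => toC (u n)) n = toC (cubeSum u n) := by
  unfold cubeSum
  simp only [conv3_toC (hu _) (hu _) (hu _)]
  funext k
  simp [toC]

theorem toC_leadR : toC (leadR Q) = leading Q := by
  classical
  funext k
  by_cases h : IsWave Q k
  · rw [toC, leadR, if_pos h, leading, if_pos (show ∃ j : Fin Q, (k : ℂ) = waveVector Q j from h),
      Complex.ofReal_one]
  · rw [toC, leadR, if_neg h, leading,
      if_neg (show ¬ ∃ j : Fin Q, (k : ℂ) = waveVector Q j from h), Complex.ofReal_zero]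

theorem isFormalSolution_formalSeq [NeZero Q] (hQ : 2 ≤ Q) (he : Even Q) (s : ℝ) :
    IsFormalSolution Q s fun n => toC (formalSeq Q n) where
  mem n := (suppLe_formalSeq n).summable (fun k x => weight Q s k * ‖(x : ℂ)‖ ^ 2) (by simp)
  rot n k k' hk := by simp only [toC, rotInv_formalSeq he n k k' hk]
  zero := toC_leadR
  order_zero := by
    funext k
    simp only [linOp, formalSeq_zero, toC]
    by_cases h : IsWave Q k
    · have := h.symbol
      rw [symbol] at this
      rw [this]; simp
    · rw [leadR_not_wave h]; simp
  order_succ n := by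
    have h1 := cubeSum_toC (fun n => (suppLe_formalSeq (Q := Q) n).summable_norm) n
    change linOp Q _ = _ - _ • cubeSum (fun n => toC (formalSeq Q n)) n
    rw [h1]
    funext k
    have h2 := symbol_mul_formalSeq hQ he n k
    simp only [linOp, toC, Pi.sub_apply, Pi.smul_apply, smul_eq_mul]
    rw [symbol] at h2
    rw [← Complex.ofReal_mul, h2]
    push_cast
    rfl

/-- The norm of the embedding of `H_s` into `ℓ¹`. -/
def embedConst (Q : ℕ) (s : ℝ) : ℝ := Real.sqrt (∑' k : quasilattice Q, (weight Q s k)⁻¹)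

/-- Cauchy–Schwarz after splitting off the square root of the weight; the inverse weights are
summable because s > Q/4. -/
theorem l1Bound_coeff (hQ : Q ≠ 0) (he : Even Q) {s : ℝ} (hs : (Q : ℝ) / 4 < s) (V : Hs Q s) :
    L1Bound (fun k => ‖V.coeff k‖) (embedConst Q s * ‖V‖) := by
  intro t
  have hV : Summable fun k => weight Q s k * ‖V.coeff k‖ ^ 2 := V.2
  have h1 : ∀ k, ‖V.coeff k‖
      = Real.sqrt (weight Q s k)⁻¹ * Real.sqrt (weight Q s k * ‖V.coeff k‖ ^ 2) := fun k => by
    rw [← Real.sqrt_mul (inv_nonneg.2 (weight_pos Q s k).le),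
      inv_mul_cancel_left₀ (weight_pos Q s k).ne', Real.sqrt_sq (norm_nonneg _)]
  calc ∑ k ∈ t, ‖V.coeff k‖
      = ∑ k ∈ t, Real.sqrt (weight Q s k)⁻¹ * Real.sqrt (weight Q s k * ‖V.coeff k‖ ^ 2) :=
        Finset.sum_congr rfl fun k _ => h1 k
    _ ≤ Real.sqrt (∑ k ∈ t, (weight Q s k)⁻¹)
        * Real.sqrt (∑ k ∈ t, weight Q s k * ‖V.coeff k‖ ^ 2) :=
        Real.sum_sqrt_mul_sqrt_le t (fun k => inv_nonneg.2 (weight_pos Q s k).le)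
          fun k => mul_nonneg (weight_pos Q s k).le (sq_nonneg _)
    _ ≤ embedConst Q s * Real.sqrt (‖V‖ ^ 2) := by
        rw [Hs.norm_sq]
        unfold embedConst
        gcongr
        · exact (summable_inv_weight hQ he hs).sum_le_tsum t
            fun k _ => inv_nonneg.2 (weight_pos Q s k).le
        · exact hV.sum_le_tsum t fun k _ => mul_nonneg (weight_pos Q s k).le (sq_nonneg _)
    _ = _ := by rw [Real.sqrt_sq (norm_nonneg _)]

theorem MemHs.summable_norm (hQ : Q ≠ 0) (he : Even Q) {s : ℝ} (hs : (Q : ℝ) / 4 < s)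
    {V : Coeffs Q} (hV : MemHs Q s V) : Summable fun k => ‖V k‖ :=
  (l1Bound_coeff hQ he hs (⟨V, hV⟩ : Hs Q s)).summable fun _ => norm_nonneg _

theorem conv3_leading [NeZero Q] (he : Even Q) {k : quasilattice Q} (h : IsWave Q k) :
    conv3 (leading Q) (leading Q) (leading Q) k = beta Q := by
  have hs := (suppLe_leadR Q).summable_norm
  rw [← toC_leadR, conv3_toC hs hs hs, toC, conv3_leadR he h]

/-- The equation of order n + 1 determines the coefficient off the kernel. The kernel component a of
the difference of two solutions enters the solvability condition of the next order as a = 3a, so it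
vanishes. -/
theorem formalSolution_unique [NeZero Q] (hQ : 2 ≤ Q) (he : Even Q) {s : ℝ}
    (hs : (Q : ℝ) / 4 < s) {U V : ℕ → Coeffs Q} (hU : IsFormalSolution Q s U)
    (hV : IsFormalSolution Q s V) : V = U := by
  have hβ : (beta Q : ℂ) ≠ 0 := Complex.ofReal_ne_zero.2 (beta_pos hQ).ne'
  have sU := fun n => (hU.mem n).summable_norm (NeZero.ne Q) he hs
  have sV := fun n => (hV.mem n).summable_norm (NeZero.ne Q) he hs
  have hw := isWave_unitPoint Q
  have hlead : leading Q (unitPoint Q) = 1 := by rw [← toC_leadR, toC, leadR_wave hw]; simp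
  have hsolv : ∀ {W : ℕ → Coeffs Q}, IsFormalSolution Q s W → ∀ n,
      W n (unitPoint Q) = (beta Q : ℂ)⁻¹ * cubeSum W n (unitPoint Q) := fun {W} hW n => by
    have h1 := congrFun (hW.order_succ n) (unitPoint Q)
    change linOp Q (W (n + 1)) (unitPoint Q) = (W n - _ • cubeSum W n) (unitPoint Q) at h1
    have h2 := hw.symbol
    rw [symbol] at h2
    rw [linOp, h2, Complex.ofReal_zero, zero_mul] at h1
    simp only [Pi.sub_apply, Pi.smul_apply, smul_eq_mul] at h1
    exact (sub_eq_zero.1 h1.symm)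
  funext n
  induction n using Nat.strong_induction_on with
  | _ n ih =>
    cases n with
    | zero => rw [hU.zero, hV.zero]
    | succ n =>
      have heq : ∀ j ≤ n, V j = U j := fun j hj => ih j (by omega)
      have hlin : linOp Q (V (n + 1)) = linOp Q (U (n + 1)) := by
        rw [hV.order_succ, hU.order_succ]
        change V n - _ • cubeSum V n = U n - _ • cubeSum U n
        rw [cubeSum_congr heq, heq n le_rfl]
      have hoff : ∀ k : quasilattice Q, ¬ IsWave Q k → V (n + 1) k = U (n + 1) k := fun k hk => by
        have h1 := congrFun hlin k
        simp only [linOp] at h1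
        exact mul_left_cancel₀ (Complex.ofReal_ne_zero.2 (symbol_ne_zero he hk)) h1
      set a := V (n + 1) (unitPoint Q) - U (n + 1) (unitPoint Q) with ha
      have hdiff : V (n + 1) - U (n + 1) = fun k => a * leading Q k := by
        funext k
        rw [← toC_leadR, toC]
        by_cases hk : IsWave Q k
        · rw [leadR_wave hk]
          obtain ⟨j, hj⟩ := hk
          have hVr : RotInv (V (n + 1)) := hV.rot (n + 1)
          have hUr : RotInv (U (n + 1)) := hU.rot (n + 1)
          rw [Pi.sub_apply, hVr.apply_waveVector hj, hUr.apply_waveVector hj]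
          simp [ha]
        · rw [leadR_not_wave hk, Pi.sub_apply, hoff k hk]
          simp
      have key := cubeSum_sub (Nat.succ_pos n) sV sU fun j hj => heq j (by omega)
      simp only [Nat.succ_eq_add_one] at key
      rw [hdiff, hV.zero] at key
      have key1 := congrFun key (unitPoint Q)
      have sL : Summable fun k => ‖leading Q k‖ := by rw [← hU.zero]; exact sU 0
      simp only [Pi.sub_apply, Pi.add_apply] at key1
      rw [conv3_rotate_args (leading Q) (fun k => a * leading Q k),
        conv3_rotate_args (leading Q) (leading Q) (fun k => a * leading Q k),
        conv3_rotate_args (leading Q) (fun k => a * leading Q k),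
        conv3_const_mul a sL sL sL (unitPoint Q), conv3_leading he hw] at key1
      have h3 := hsolv hV (n + 1)
      have h4 := hsolv hU (n + 1)
      have h5 : a = (beta Q : ℂ)⁻¹ *
          (cubeSum V (n + 1) (unitPoint Q) - cubeSum U (n + 1) (unitPoint Q)) := by
        rw [mul_sub, ← h3, ← h4]
      rw [key1] at h5
      have h6 : a = 3 * a := by
        calc a = (beta Q : ℂ)⁻¹ * (a * beta Q + a * beta Q + a * beta Q) := h5
          _ = 3 * a * ((beta Q : ℂ)⁻¹ * beta Q) := by ring
          _ = 3 * a := by rw [inv_mul_cancel₀ hβ, mul_one]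
      have ha0 : a = 0 := by linear_combination (-1 / 2 : ℂ) * h6
      have := hdiff
      rw [ha0] at this
      simp only [zero_mul] at this
      exact sub_eq_zero.1 this

end Complexification
end
end SwiftHohenberg

namespace SwiftHohenberg
noncomputable section

/-! ### Weighted ℓ¹ algebras. -/

section Weights
variable {Q : ℕ}

/-- A submultiplicative weight on the quasilattice, bounded below by `1`. -/
structure IsWeight (W : quasilattice Q → ℝ) : Prop where
  one_le : ∀ k, 1 ≤ W k
  le_mul : ∀ p q r k : quasilattice Q, (p : ℂ) + q + r = k → W k ≤ W p * W q * W r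

theorem isWeight_one : IsWeight (fun _ : quasilattice Q => (1 : ℝ)) :=
  ⟨fun _ => le_rfl, fun _ _ _ _ _ => by norm_num⟩

theorem IsWeight.pos {W : quasilattice Q → ℝ} (hW : IsWeight W) (k : quasilattice Q) : 0 < W k :=
  lt_of_lt_of_le one_pos (hW.one_le k)

theorem order_le_of_sum_eq {p q r k : quasilattice Q} (h : (p : ℂ) + q + r = k) :
    order Q k ≤ order Q p + order Q q + order Q r := by
  rw [← h]
  have h1 := order_add_le (add_mem_quasilattice p.2 q.2) r.2
  have h2 := order_add_le p.2 q.2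
  omega

/-- The exponential weight `exp (ρ N_k)`. -/
def expWeight (Q : ℕ) (ρ : ℝ) (k : quasilattice Q) : ℝ := Real.exp (ρ * order Q k)

theorem isWeight_expWeight {ρ : ℝ} (hρ : 0 ≤ ρ) : IsWeight (expWeight Q ρ) where
  one_le k := Real.one_le_exp (by positivity)
  le_mul p q r k h := by
    unfold expWeight
    rw [← Real.exp_add, ← Real.exp_add, ← mul_add, ← mul_add]
    gcongr
    exact_mod_cast order_le_of_sum_eq h

theorem IsWeight.summable {W : quasilattice Q → ℝ} (hW : IsWeight W) {f : quasilattice Q → ℝ}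
    {a : ℝ} (hf : L1Bound (fun k => W k * ‖f k‖) a) : Summable fun k => ‖f k‖ :=
  Summable.of_nonneg_of_le (fun _ => norm_nonneg _)
    (fun k => le_mul_of_one_le_left (norm_nonneg _) (hW.one_le k))
    (hf.summable fun k => mul_nonneg (hW.pos k).le (norm_nonneg _))

/-- Submultiplicativity distributes the weight of k over the three factors, which reduces to the
unweighted case. -/
theorem IsWeight.l1Bound_conv3 {W : quasilattice Q → ℝ} (hW : IsWeight W)
    {f g h : quasilattice Q → ℝ} {a b c : ℝ} (hf : L1Bound (fun k => W k * ‖f k‖) a)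
    (hg : L1Bound (fun k => W k * ‖g k‖) b) (hh : L1Bound (fun k => W k * ‖h k‖) c) :
    L1Bound (fun k => W k * ‖conv3 f g h k‖) (a * b * c) := by
  have h0 : ∀ (f : quasilattice Q → ℝ) k, 0 ≤ W k * ‖f k‖ := fun f k =>
    mul_nonneg (hW.pos k).le (norm_nonneg _)
  refine (hf.conv3 hg hh (h0 f) (h0 g) (h0 h)).mono (fun k => ?_) le_rfl
  have := norm_mul_conv3_le (W k) (hW.summable hf) (hW.summable hg) (hW.summable hh)
    (hf.summable (h0 f)) (hg.summable (h0 g)) (hh.summable (h0 h)) (h0 f) (h0 g) (h0 h) k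
    fun p q r hk => by
      rw [norm_mul, Real.norm_of_nonneg (hW.pos k).le, norm_mul, norm_mul]
      calc W k * (‖f p‖ * ‖g q‖ * ‖h r‖) ≤ (W p * W q * W r) * (‖f p‖ * ‖g q‖ * ‖h r‖) := by
            gcongr; exact hW.le_mul p q r k hk
        _ = _ := by ring
  rwa [norm_mul, Real.norm_of_nonneg (hW.pos k).le] at this

theorem L1Bound.norm_add {W f g : quasilattice Q → ℝ} {a b : ℝ} (hW : ∀ k, 0 ≤ W k)
    (hf : L1Bound (fun k => W k * ‖f k‖) a) (hg : L1Bound (fun k => W k * ‖g k‖) b) :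
    L1Bound (fun k => W k * ‖f k + g k‖) (a + b) :=
  (hf.add hg).mono (fun k => by
    rw [← mul_add]; exact mul_le_mul_of_nonneg_left (norm_add_le _ _) (hW k)) le_rfl

theorem L1Bound.norm_const_mul {W f : quasilattice Q → ℝ} {a : ℝ} (c : ℝ)
    (hf : L1Bound (fun k => W k * ‖f k‖) a) :
    L1Bound (fun k => W k * ‖c * f k‖) (|c| * a) :=
  (hf.const_mul (abs_nonneg c)).mono (fun k => by rw [norm_mul, Real.norm_eq_abs]; linarith) le_rfl

theorem L1Bound.norm_finset_sum {κ : Type*} (t : Finset κ) {W : quasilattice Q → ℝ}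
    (hW : ∀ k, 0 ≤ W k) {f : κ → quasilattice Q → ℝ} {a : κ → ℝ}
    (h : ∀ j ∈ t, L1Bound (fun k => W k * ‖f j k‖) (a j)) :
    L1Bound (fun k => W k * ‖(∑ j ∈ t, f j) k‖) (∑ j ∈ t, a j) := by
  refine (L1Bound.sum t h).mono (fun k => ?_) le_rfl
  rw [Finset.sum_apply, ← Finset.mul_sum]
  exact mul_le_mul_of_nonneg_left (norm_sum_le _ _) (hW k)

theorem l1Bound_leadR (hQ : Q ≠ 0) : L1Bound (fun k => ‖leadR Q k‖) Q := by
  classical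
  intro s
  have h1 : ∑ k ∈ s, ‖leadR Q k‖ = ((s.filter fun k : quasilattice Q => IsWave Q k).card : ℝ) := by
    rw [Finset.card_filter]
    push_cast
    refine Finset.sum_congr rfl fun k _ => ?_
    by_cases h : IsWave Q k
    · rw [leadR_wave h, if_pos h]; simp
    · rw [leadR_not_wave h, if_neg h]; simp
  rw [h1]
  have h2 : (s.filter fun k : quasilattice Q => IsWave Q k).card ≤ (waves Q).card :=
    Finset.card_le_card_of_injOn (fun k : quasilattice Q => (k : ℂ))
      (fun k hk => mem_waves.2 (Finset.mem_filter.1 hk).2) Subtype.val_injective.injOn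
  rw [card_waves hQ] at h2
  exact_mod_cast h2

end Weights

/-! ### Sums of inverse binomial and multinomial coefficients. -/

section Factorials

theorem succ_le_choose {m i : ℕ} (h : i < m) : m + 1 ≤ (m + 1).choose (i + 1) := by
  have h1 : (m + 1) * m.choose i = (m + 1).choose (i + 1) * (i + 1) := Nat.add_one_mul_choose_eq m i
  have h2 : i + 1 ≤ m.choose i := by
    have := Nat.choose_le_choose i (show i + 1 ≤ m from h)
    rwa [Nat.choose_succ_self_right] at this
  have h3 : (m + 1) * (i + 1) ≤ (m + 1).choose (i + 1) * (i + 1) := by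
    rw [← h1]; exact Nat.mul_le_mul_left _ h2
  exact Nat.le_of_mul_le_mul_right h3 (Nat.succ_pos i)

/-- For n ≥ 1 the two extreme terms are 1 and each of the n - 1 others is at most 1/n. -/
theorem sum_inv_choose_le (n : ℕ) : ∑ p ∈ Finset.HasAntidiagonal.antidiagonal n,
    ((p.1.factorial : ℝ) * p.2.factorial / n.factorial) ≤ 3 := by
  have h1 : ∑ p ∈ Finset.HasAntidiagonal.antidiagonal n,
      ((p.1.factorial : ℝ) * p.2.factorial / n.factorial)
      = ∑ i ∈ Finset.range (n + 1), ((n.choose i : ℝ))⁻¹ := by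
    rw [Finset.Nat.sum_antidiagonal_eq_sum_range_succ_mk]
    refine Finset.sum_congr rfl fun i hi => ?_
    have hi' : i ≤ n := by have := Finset.mem_range.1 hi; omega
    rw [Nat.cast_choose ℝ hi', inv_div]
  rw [h1]
  cases n with
  | zero => norm_num
  | succ m =>
    rw [Finset.sum_range_succ, Finset.sum_range_succ']
    have h2 : ∑ i ∈ Finset.range m, (((m + 1).choose (i + 1) : ℝ))⁻¹
        ≤ ∑ i ∈ Finset.range m, ((m + 1 : ℝ))⁻¹ := by
      refine Finset.sum_le_sum fun i hi => ?_
      have := succ_le_choose (Finset.mem_range.1 hi)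
      gcongr
      exact_mod_cast this
    have h3 : ∑ i ∈ Finset.range m, ((m + 1 : ℝ))⁻¹ ≤ 1 := by
      rw [Finset.sum_const, Finset.card_range, nsmul_eq_mul, ← div_eq_mul_inv,
        div_le_one (by positivity)]
      linarith
    simp only [Nat.choose_zero_right, Nat.choose_self, Nat.cast_one, inv_one]
    linarith

theorem sum_inv_multinomial_le (n : ℕ) :
    ∑ p ∈ Finset.HasAntidiagonal.antidiagonal n, ∑ q ∈ Finset.HasAntidiagonal.antidiagonal p.2,
      ((p.1.factorial : ℝ) * (q.1.factorial * q.2.factorial) / n.factorial) ≤ 9 := by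
  have h1 : ∀ p ∈ Finset.HasAntidiagonal.antidiagonal n,
      ∑ q ∈ Finset.HasAntidiagonal.antidiagonal p.2,
        ((p.1.factorial : ℝ) * (q.1.factorial * q.2.factorial) / n.factorial)
      ≤ ((p.1.factorial : ℝ) * p.2.factorial / n.factorial) * 3 := fun p _ => by
    refine le_trans (le_of_eq ?_) (mul_le_mul_of_nonneg_left (sum_inv_choose_le p.2)
      (by positivity))
    rw [Finset.mul_sum]
    refine Finset.sum_congr rfl fun q _ => ?_
    have := (Nat.cast_ne_zero (R := ℝ)).2 (Nat.factorial_ne_zero p.2)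
    field_simp
  refine (Finset.sum_le_sum h1).trans ?_
  rw [← Finset.sum_mul]
  linarith [sum_inv_choose_le n]

theorem factorial_mul_le {a b c n : ℕ} (h : a + b + c = n) :
    a.factorial * (b.factorial * c.factorial) ≤ n.factorial := by
  have h1 := Nat.factorial_mul_factorial_dvd_factorial_add b c
  have h2 := Nat.factorial_mul_factorial_dvd_factorial_add a (b + c)
  rw [← add_assoc, h] at h2
  exact Nat.le_of_dvd (Nat.factorial_pos n) ((Nat.mul_dvd_mul_left _ h1).trans h2)

end Factorials

/-! ### Gevrey estimates of the formal solution in ℓ¹. -/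

section Gevrey
variable {Q : ℕ}

/-- With r = a! b! c!/n! ≤ 1 and e ≥ 1 one has r^e ≤ r, and the sum of all r is at most 9. Cubing
therefore costs a factor independent of n. -/
theorem l1Bound_cubeSum {x : ℕ → quasilattice Q → ℝ} {y : ℕ → ℝ} {e n : ℕ} {M : ℝ} (he : 1 ≤ e)
    (hM : 0 ≤ M) (hx : ∀ j ≤ n, L1Bound (fun k => ‖x j k‖) (y j * (j.factorial : ℝ) ^ e))
    (hy : ∀ a b c, a + b + c = n → y a * y b * y c ≤ M) :
    L1Bound (fun k => ‖cubeSum x n k‖) (9 * M * (n.factorial : ℝ) ^ e) := by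
  have hx1 : ∀ j ≤ n, L1Bound (fun k => 1 * ‖x j k‖) (y j * (j.factorial : ℝ) ^ e) := by
    simpa only [one_mul] using hx
  have key : ∀ p ∈ Finset.HasAntidiagonal.antidiagonal n,
      ∀ q ∈ Finset.HasAntidiagonal.antidiagonal p.2,
      L1Bound (fun k => 1 * ‖conv3 (x p.1) (x q.1) (x q.2) k‖)
        (M * (n.factorial : ℝ) ^ e *
          ((p.1.factorial : ℝ) * (q.1.factorial * q.2.factorial) / n.factorial)) := by
    intro p hp q hq
    have h1 := Finset.HasAntidiagonal.mem_antidiagonal.1 hp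
    have h2 := Finset.HasAntidiagonal.mem_antidiagonal.1 hq
    have h3 : p.1 + q.1 + q.2 = n := by omega
    refine (isWeight_one.l1Bound_conv3 (hx1 _ (by omega)) (hx1 _ (by omega))
      (hx1 _ (by omega))).mono (fun _ => le_rfl) ?_
    set r : ℝ := (p.1.factorial : ℝ) * (q.1.factorial * q.2.factorial) / n.factorial with hr
    have hn : (0 : ℝ) < n.factorial := by exact_mod_cast Nat.factorial_pos n
    have hr0 : 0 ≤ r := by positivity
    have hr1 : r ≤ 1 := by
      rw [hr, div_le_one hn]
      exact_mod_cast factorial_mul_le h3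
    have h4 : (p.1.factorial : ℝ) * (q.1.factorial * q.2.factorial) = r * n.factorial := by
      rw [hr]; field_simp
    calc y p.1 * (p.1.factorial : ℝ) ^ e * (y q.1 * (q.1.factorial : ℝ) ^ e)
          * (y q.2 * (q.2.factorial : ℝ) ^ e)
        = y p.1 * y q.1 * y q.2
          * ((p.1.factorial : ℝ) * (q.1.factorial * q.2.factorial)) ^ e := by
          rw [mul_pow, mul_pow]; ring
      _ = y p.1 * y q.1 * y q.2 * (r ^ e * (n.factorial : ℝ) ^ e) := by rw [h4, mul_pow]
      _ ≤ M * (r * (n.factorial : ℝ) ^ e) := by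
          have := hy _ _ _ h3
          have h5 : r ^ e ≤ r := by
            simpa using pow_le_pow_of_le_one hr0 hr1 he
          gcongr
      _ = _ := by ring
  have h6 := L1Bound.norm_finset_sum (Finset.HasAntidiagonal.antidiagonal n)
    (W := fun _ => (1 : ℝ)) (fun _ => zero_le_one)
    (f := fun p => ∑ q ∈ Finset.HasAntidiagonal.antidiagonal p.2, conv3 (x p.1) (x q.1) (x q.2))
    fun p hp => L1Bound.norm_finset_sum (Finset.HasAntidiagonal.antidiagonal p.2)
      (W := fun _ => (1 : ℝ)) (fun _ => zero_le_one) fun q hq => key p hp q hq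
  refine h6.mono (fun k => by rw [one_mul]; exact le_rfl) ?_
  have h7 := sum_inv_multinomial_le n
  simp_rw [← Finset.mul_sum]
  calc _ ≤ M * (n.factorial : ℝ) ^ e * 9 := by gcongr
    _ = _ := by ring

theorem one_le_ell (hQ : 8 ≤ Q) (he : Even Q) : 1 ≤ ell Q := by
  obtain ⟨h, rfl⟩ := he
  -- A residue prime to Q other than ±1 gives φ(Q) ≥ 3, hence φ(Q) ≥ 4 by parity. With h = Q/2, the
  -- residue is h + 1 for h even and h + 2 for h odd.
  have hcop : ∃ a, 1 < a ∧ a + 1 < h + h ∧ (h + h).Coprime a := by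
    rcases Nat.even_or_odd h with hh | hh
    · refine ⟨h + 1, by omega, by omega, ?_⟩
      rw [← two_mul]
      refine Nat.Coprime.mul_left ?_ (by simp)
      rw [Nat.coprime_two_left]
      exact hh.add_one
    · refine ⟨h + 2, by omega, by omega, ?_⟩
      rw [← two_mul]
      refine Nat.Coprime.mul_left ?_ ?_
      · rw [Nat.coprime_two_left]
        exact hh.add_even even_two
      · simpa using hh
  obtain ⟨a, ha1, ha2, ha3⟩ := hcop
  have h3 : 3 ≤ (h + h).totient := by
    unfold Nat.totient
    have : ({1, a, h + h - 1} : Finset ℕ) ⊆ (Finset.range (h + h)).filter (h + h).Coprime := by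
      intro x hx
      simp only [Finset.mem_insert, Finset.mem_singleton] at hx
      rw [Finset.mem_filter, Finset.mem_range]
      rcases hx with rfl | rfl | rfl
      · exact ⟨by omega, Nat.coprime_one_right _⟩
      · exact ⟨by omega, ha3⟩
      · refine ⟨by omega, ?_⟩
        have h4 : h + h = (h + h - 1) + 1 := by omega
        conv_lhs => rw [h4]
        simp
    have h5 := Finset.card_le_card this
    rwa [Finset.card_eq_three.2 ⟨1, a, h + h - 1, by omega, by omega, by omega, rfl⟩] at h5
  have h6 := totient_eq_ell (Q := h + h) (by omega)
  omega

/-- On the support N ≤ 2n + 3, so 1 + N² ≤ 10(n + 1)², and the small divisor bound costs its power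
2l. The factor (n + 1)^{4l} is exactly what leads from (n!)^{4l} to ((n + 1)!)^{4l}. -/
theorem l1Bound_offKernel [NeZero Q] (hQ : 3 ≤ Q) (he : Even Q) {u : ℕ → quasilattice Q → ℝ}
    {n : ℕ} {B : ℝ} (hu : ∀ j ≤ n, SuppLe (u j) (2 * j + 1))
    (hB : L1Bound (fun k => ‖u n k - (beta Q)⁻¹ * cubeSum u n k‖) B) :
    L1Bound (fun k => ‖offKernel u n k‖)
      ((10 : ℝ) ^ (2 * ell Q) * ((n : ℝ) + 1) ^ (4 * ell Q) * B) := by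
  refine (hB.const_mul (show 0 ≤ (10 : ℝ) ^ (2 * ell Q) * ((n : ℝ) + 1) ^ (4 * ell Q)
    by positivity)).mono (fun k => ?_) le_rfl
  by_cases hk : IsWave Q k
  · rw [offKernel_wave hk, norm_zero]; positivity
  rcases Nat.lt_or_ge (2 * n + 3) (order Q k) with h | h
  · rw [suppLe_offKernel hu k h, norm_zero]; positivity
  rw [offKernel, if_neg hk, norm_div, Real.norm_of_nonneg (symbol_nonneg _),
    div_eq_inv_mul]
  refine mul_le_mul_of_nonneg_right ?_ (norm_nonneg _)
  have hpos : 0 < symbol (k : ℂ) := lt_of_le_of_ne (symbol_nonneg _) (symbol_ne_zero he hk).symm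
  have h1 := small_divisor hQ k.2 fun h => hk ((isWave_iff he k).2 h)
  have h2 : (symbol (k : ℂ))⁻¹ ≤ (1 + (order Q k : ℝ) ^ 2) ^ (2 * ell Q) := by
    rw [inv_le_iff_one_le_mul₀' hpos]; exact h1
  refine h2.trans ?_
  have h3 : (order Q k : ℝ) ≤ 2 * n + 3 := by exact_mod_cast h
  calc (1 + (order Q k : ℝ) ^ 2) ^ (2 * ell Q) ≤ (10 * ((n : ℝ) + 1) ^ 2) ^ (2 * ell Q) := by
        refine pow_le_pow_left₀ (by positivity) ?_ _
        have h0 : (0 : ℝ) ≤ n := by positivity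
        nlinarith [show (0 : ℝ) ≤ order Q k by positivity]
    _ = _ := by
        rw [mul_pow, ← pow_mul]
        congr 2
        ring

/-- The induction uses the bound A at order 0 and δ Kⁿ (n!)^e at orders n ≥ 1. A small δ is needed
because the kernel coefficient depends on the cube of the same order; there the earlier terms
contribute at least two factors of positive order, so δ occurs squared. -/
theorem gevrey_l1 (hQ : 8 ≤ Q) (he : Even Q) [NeZero Q] :
    ∃ A K : ℝ, 0 < A ∧ 0 < K ∧ ∀ n, L1Bound (fun k => ‖formalSeq Q n k‖)
      (A * K ^ n * (n.factorial : ℝ) ^ (4 * ell Q)) := by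
  have hl := one_le_ell hQ he
  set e := 4 * ell Q with he'
  have he1 : 1 ≤ e := by omega
  have hQ8 : (8 : ℝ) ≤ Q := by exact_mod_cast hQ
  set A : ℝ := (Q : ℝ) with hA
  -- With this δ, 9Aδ² = δ/2 and η = δ²/A ≤ δ/2, so the kernel and off-kernel parts add up to at
  -- most δ. The choice K = C/η turns the loss C Kⁿ into η K^{n+1}.
  set δ : ℝ := 1 / (18 * A) with hδ
  set C : ℝ := (10 : ℝ) ^ (2 * ell Q) * (A + 9 * A ^ 3) with hC
  set η : ℝ := δ ^ 2 / A with hη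
  set K : ℝ := C / η with hK
  have hA0 : 0 < A := by linarith
  have hδ0 : 0 < δ := by positivity
  have hη0 : 0 < η := by positivity
  have hC0 : 0 < C := by positivity
  have hK0 : 0 < K := by positivity
  have hδ1 : δ ≤ 1 := by rw [hδ, div_le_one (by positivity)]; linarith
  have hβ1 : 1 ≤ beta Q := by unfold beta; linarith
  have hβ0 : 0 < beta Q := by linarith
  have hδA : A * δ = 1 / 18 := by rw [hδ]; field_simp
  have hηδ : η + 9 * (A * δ ^ 2) ≤ δ := by
    have h1 : η ≤ δ / 2 := by
      rw [hη, div_le_iff₀ hA0]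
      nlinarith
    have h2 : A * δ ^ 2 = δ / 18 := by rw [pow_two, ← mul_assoc, hδA]; ring
    linarith
  have hCη : C = η * K := by rw [hK]; field_simp
  have key : ∀ n, L1Bound (fun k => ‖formalSeq Q n k‖)
      ((if n = 0 then A else δ * K ^ n) * (n.factorial : ℝ) ^ e) := by
    intro n
    induction n using Nat.strong_induction_on with
    | _ n ih =>
      cases n with
      | zero => simpa [formalSeq_zero] using l1Bound_leadR (NeZero.ne Q)
      | succ n =>
        set f : ℝ := ((n + 1).factorial : ℝ) ^ e with hf
        have hf0 : 0 ≤ f := by positivity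
        have hff : f = ((n : ℝ) + 1) ^ e * (n.factorial : ℝ) ^ e := by
          rw [hf, Nat.factorial_succ]; push_cast; rw [mul_pow]
        have hyA : ∀ j, (if j = 0 then A else δ * K ^ j) ≤ A * K ^ j := fun j => by
          split_ifs with h
          · rw [h]; simp
          · gcongr; linarith
        have hy0 : ∀ j, 0 ≤ (if j = 0 then A else δ * K ^ j) := fun j => by
          split_ifs <;> positivity
        have hcube := l1Bound_cubeSum (x := formalSeq Q) (n := n) he1 (M := A ^ 3 * K ^ n) (by positivity)
          (fun j hj => ih j (by omega)) fun a b c habc => by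
            calc _ ≤ (A * K ^ a) * (A * K ^ b) * (A * K ^ c) := by
                  have := hyA a; have := hyA b; have := hyA c
                  have := hy0 a; have := hy0 b; have := hy0 c
                  gcongr
              _ = A ^ 3 * K ^ n := by rw [← habc, pow_add, pow_add]; ring
        have hrhs : L1Bound (fun k => ‖formalSeq Q n k - (beta Q)⁻¹ * cubeSum (formalSeq Q) n k‖)
            ((A + 9 * A ^ 3) * K ^ n * (n.factorial : ℝ) ^ e) := by
          refine ((ih n (by omega)).add hcube).mono (fun k => ?_) ?_
          · refine (norm_sub_le _ _).trans ?_
            gcongr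
            rw [norm_mul, Real.norm_of_nonneg (by positivity)]
            exact mul_le_of_le_one_left (norm_nonneg _) (inv_le_one_of_one_le₀ hβ1)
          · have := hyA n
            calc _ ≤ A * K ^ n * (n.factorial : ℝ) ^ e
                  + 9 * (A ^ 3 * K ^ n) * (n.factorial : ℝ) ^ e := by gcongr
              _ = _ := by ring
        have hv : L1Bound (fun k => ‖offKernel (formalSeq Q) n k‖) (η * K ^ (n + 1) * f) := by
          refine (l1Bound_offKernel (by omega) he (fun j _ => suppLe_formalSeq j) hrhs).mono
            (fun _ => le_rfl) (le_of_eq ?_)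
          rw [show η * K ^ (n + 1) = η * K * K ^ n by ring, ← hCη, hff, hC]
          ring
        -- An index triple of sum n + 1 either contains n + 1, giving A²η = Aδ², or has at least two
        -- nonzero entries, giving at most Aδ² since δ ≤ A.
        have hcube2 : L1Bound (fun k => ‖cubeSum (Function.update (formalSeq Q) (n + 1)
            (offKernel (formalSeq Q) n)) (n + 1) k‖) (9 * (A * δ ^ 2 * K ^ (n + 1)) * f) := by
          refine l1Bound_cubeSum (y := fun j => if j = 0 then A else if j = n + 1 then
            η * K ^ (n + 1) else δ * K ^ j) he1 (by positivity) (fun j hj => ?_) ?_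
          · rcases eq_or_ne j (n + 1) with rfl | hne
            · simp only [Function.update_self, if_true, Nat.add_eq_zero_iff, one_ne_zero, and_false,
                if_false]
              exact hv
            · have := ih j (by omega)
              simp only [Function.update_of_ne hne, if_neg hne]
              exact this
          · intro a b c habc
            have hηA : A * η = δ ^ 2 := by rw [hη]; field_simp
            by_cases h1 : a = n + 1
            · obtain rfl : b = 0 := by omega
              obtain rfl : c = 0 := by omega
              simp only [h1, if_true, Nat.add_eq_zero_iff, one_ne_zero, and_false, if_false]
              rw [← hηA]; apply le_of_eq; ring
            by_cases h2 : b = n + 1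
            · obtain rfl : a = 0 := by omega
              obtain rfl : c = 0 := by omega
              simp only [h2, if_true, Nat.add_eq_zero_iff, one_ne_zero, and_false, if_false]
              rw [← hηA]; apply le_of_eq; ring
            by_cases h3 : c = n + 1
            · obtain rfl : a = 0 := by omega
              obtain rfl : b = 0 := by omega
              simp only [h3, if_true, Nat.add_eq_zero_iff, one_ne_zero, and_false, if_false]
              rw [← hηA]; apply le_of_eq; ring
            simp only [if_neg h1, if_neg h2, if_neg h3]
            have hp : K ^ (n + 1) = K ^ a * K ^ b * K ^ c := by
              rw [← habc, pow_add, pow_add]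
            rw [hp]
            have hKa : 0 < K ^ a * K ^ b * K ^ c := by positivity
            split_ifs with ha hb hc hc hb hc hc
            all_goals first
              | (exfalso; omega)
              | skip
            · rw [ha]; apply le_of_eq; simp; ring
            · rw [hb]; apply le_of_eq; simp; ring
            · rw [hc]; apply le_of_eq; simp; ring
            · calc δ * K ^ a * (δ * K ^ b) * (δ * K ^ c)
                  = δ * δ ^ 2 * (K ^ a * K ^ b * K ^ c) := by ring
                _ ≤ A * δ ^ 2 * (K ^ a * K ^ b * K ^ c) := by gcongr; linarith
        set α := kernelCoeff (formalSeq Q) n with hα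
        -- The leading term has ℓ¹ norm at most Q, and Q/(2β) ≤ 1.
        have hαle : |α| * Q ≤ 9 * (A * δ ^ 2 * K ^ (n + 1)) * f := by
          have h1 := hcube2.le (unitPoint Q)
          have h2 : |α| = (2 * beta Q)⁻¹ * ‖cubeSum (Function.update (formalSeq Q) (n + 1)
              (offKernel (formalSeq Q) n)) (n + 1) (unitPoint Q)‖ := by
            rw [hα, kernelCoeff, abs_mul, abs_neg, abs_of_pos (by positivity), Real.norm_eq_abs]
          have h3 : (2 * beta Q)⁻¹ * Q ≤ 1 := by
            rw [inv_mul_le_iff₀ (by positivity), beta]; linarith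
          rw [h2]
          calc _ = ((2 * beta Q)⁻¹ * Q) * ‖cubeSum (Function.update (formalSeq Q) (n + 1)
              (offKernel (formalSeq Q) n)) (n + 1) (unitPoint Q)‖ := by ring
            _ ≤ 1 * (9 * (A * δ ^ 2 * K ^ (n + 1)) * f) := by gcongr
            _ = _ := one_mul _
        refine (hv.add ((l1Bound_leadR (NeZero.ne Q)).const_mul (abs_nonneg α))).mono
          (fun k => ?_) ?_
        · rw [formalSeq_succ, nextTerm]
          refine (norm_add_le _ _).trans ?_
          rw [norm_mul, Real.norm_eq_abs α]
        · rw [if_neg (Nat.succ_ne_zero n)]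
          calc _ ≤ η * K ^ (n + 1) * f + 9 * (A * δ ^ 2 * K ^ (n + 1)) * f := by gcongr
            _ = (η + 9 * (A * δ ^ 2)) * (K ^ (n + 1) * f) := by ring
            _ ≤ δ * (K ^ (n + 1) * f) := by gcongr
            _ = _ := by ring
  refine ⟨A, K, hA0, hK0, fun n => (key n).mono (fun _ => le_rfl) ?_⟩
  gcongr
  split_ifs with h
  · rw [h]; simp
  · gcongr; linarith

end Gevrey
end
end SwiftHohenberg

namespace SwiftHohenberg
noncomputable section

/-! ### Between H_s and ℓ¹ with exponential weights. -/

section SobolevNorm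
variable {Q : ℕ}

theorem exists_rpow_le_exp (s : ℝ) {ρ : ℝ} (hρ : 0 < ρ) :
    ∃ C : ℝ, 0 < C ∧ ∀ x : ℝ, 0 ≤ x → (1 + x ^ 2) ^ s ≤ C * Real.exp (ρ * x) := by
  obtain ⟨p, hp⟩ := exists_nat_ge s
  set a : ℝ := ρ / (p + 1) with ha
  have ha0 : 0 < a := by positivity
  refine ⟨(1 + 2 / a ^ 2) ^ (p + 1), by positivity, fun x hx => ?_⟩
  have h1 : 1 + x ^ 2 ≤ (1 + 2 / a ^ 2) * Real.exp (a * x) := by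
    have h2 : (a * x) ^ 2 / 2 ≤ Real.exp (a * x) := by
      have := Real.quadratic_le_exp_of_nonneg (show 0 ≤ a * x by positivity)
      nlinarith [show 0 ≤ a * x by positivity]
    have h3 : (1 : ℝ) ≤ Real.exp (a * x) := Real.one_le_exp (by positivity)
    have h4 : x ^ 2 = 2 / a ^ 2 * ((a * x) ^ 2 / 2) := by field_simp
    rw [h4, add_mul, one_mul]
    gcongr
  calc (1 + x ^ 2) ^ s ≤ (1 + x ^ 2) ^ ((p + 1 : ℕ) : ℝ) :=
        Real.rpow_le_rpow_of_exponent_le (by nlinarith [sq_nonneg x]) (by push_cast; linarith)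
    _ = (1 + x ^ 2) ^ (p + 1) := Real.rpow_natCast _ _
    _ ≤ ((1 + 2 / a ^ 2) * Real.exp (a * x)) ^ (p + 1) := pow_le_pow_left₀ (by positivity) h1 _
    _ = _ := by
        rw [mul_pow, ← Real.exp_nat_mul]
        congr 2
        push_cast
        rw [ha]; field_simp

theorem exists_sqrt_weight_le (Q : ℕ) (s : ℝ) {ρ : ℝ} (hρ : 0 < ρ) :
    ∃ C : ℝ, 0 < C ∧ ∀ k : quasilattice Q, Real.sqrt (weight Q s k) ≤ C * expWeight Q ρ k := by
  obtain ⟨C, hC, h⟩ := exists_rpow_le_exp s (show 0 < 2 * ρ by linarith)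
  refine ⟨Real.sqrt C, Real.sqrt_pos.2 hC, fun k => ?_⟩
  rw [Real.sqrt_le_iff]
  refine ⟨by unfold expWeight; positivity, ?_⟩
  rw [mul_pow, Real.sq_sqrt hC.le, expWeight, ← Real.exp_nat_mul]
  refine (h _ (Nat.cast_nonneg _)).trans (le_of_eq ?_)
  congr 2
  push_cast; ring

theorem sqrt_weight_mul_sq (s : ℝ) (U : Coeffs Q) (k : quasilattice Q) :
    weight Q s k * ‖U k‖ ^ 2 = (Real.sqrt (weight Q s k) * ‖U k‖) ^ 2 := by
  rw [mul_pow, Real.sq_sqrt (weight_pos Q s k).le]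

/-- ℓ¹ is contained in ℓ²: each weighted term is at most B, so its square is at most B times itself.
-/
theorem memHs_of_l1Bound {s B : ℝ} {U : Coeffs Q}
    (h : L1Bound (fun k => Real.sqrt (weight Q s k) * ‖U k‖) B) : MemHs Q s U := by
  have h0 : ∀ k, 0 ≤ Real.sqrt (weight Q s k) * ‖U k‖ := fun k => by positivity
  refine Summable.of_nonneg_of_le (fun k => mul_nonneg (weight_pos Q s k).le (sq_nonneg _))
    (fun k => ?_) ((h.summable h0).mul_left B)
  rw [sqrt_weight_mul_sq, pow_two]
  exact mul_le_mul_of_nonneg_right (h.le k) (h0 k)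

theorem norm_le_of_l1Bound {s B : ℝ} (V : Hs Q s)
    (h : L1Bound (fun k => Real.sqrt (weight Q s k) * ‖V.coeff k‖) B) : ‖V‖ ≤ B := by
  have h0 : ∀ k, 0 ≤ Real.sqrt (weight Q s k) * ‖V.coeff k‖ := fun k => by positivity
  refine abs_le_of_sq_le_sq' ?_ h.nonneg |>.2
  rw [Hs.norm_sq]
  have hV : Summable fun k => weight Q s k * ‖V.coeff k‖ ^ 2 := V.2
  calc ∑' k, weight Q s k * ‖V.coeff k‖ ^ 2
      ≤ ∑' k, B * (Real.sqrt (weight Q s k) * ‖V.coeff k‖) := by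
        refine hV.tsum_le_tsum (fun k => ?_) ((h.summable h0).mul_left B)
        rw [sqrt_weight_mul_sq, pow_two]
        exact mul_le_mul_of_nonneg_right (h.le k) (h0 k)
    _ = B * ∑' k, Real.sqrt (weight Q s k) * ‖V.coeff k‖ := tsum_mul_left
    _ ≤ B * B := mul_le_mul_of_nonneg_left (h.tsum_le h0) h.nonneg
    _ = B ^ 2 := (pow_two B).symm

theorem norm_toC (f : quasilattice Q → ℝ) (k : quasilattice Q) : ‖toC f k‖ = ‖f k‖ :=
  Complex.norm_real _

/-- A constant comparing the norm of `H_s` with the `ℓ¹` norm of weight `exp (ρ N_k)`. -/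
theorem exists_sobolev_const (Q : ℕ) (s : ℝ) {ρ : ℝ} (hρ : 0 < ρ) :
    ∃ C : ℝ, 0 < C ∧ ∀ (f : Coeffs Q) (B : ℝ),
      L1Bound (fun k => expWeight Q ρ k * ‖f k‖) B →
      MemHs Q s f ∧ ∀ V : Hs Q s, V.coeff = f → ‖V‖ ≤ C * B := by
  obtain ⟨C, hC, h⟩ := exists_sqrt_weight_le Q s hρ
  refine ⟨C, hC, fun f B hf => ?_⟩
  have h1 : L1Bound (fun k => Real.sqrt (weight Q s k) * ‖f k‖) (C * B) :=
    (hf.const_mul hC.le).mono (fun k => by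
      rw [← mul_assoc]
      exact mul_le_mul_of_nonneg_right (h k) (norm_nonneg _)) le_rfl
  exact ⟨memHs_of_l1Bound h1, fun V hV => norm_le_of_l1Bound V (by rw [hV]; exact h1)⟩

theorem SuppLe.l1Bound_expWeight {f : quasilattice Q → ℝ} {n : ℕ} {ρ B : ℝ} (hρ : 0 ≤ ρ)
    (hf : SuppLe f n) (h : L1Bound (fun k => ‖f k‖) B) :
    L1Bound (fun k => expWeight Q ρ k * ‖f k‖) (Real.exp (ρ * n) * B) := by
  refine (h.const_mul (Real.exp_pos (ρ * n)).le).mono (fun k => ?_) le_rfl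
  rcases Nat.lt_or_ge n (order Q k) with hk | hk
  · rw [hf k hk]; simp
  · refine mul_le_mul_of_nonneg_right ?_ (norm_nonneg _)
    unfold expWeight
    gcongr

/-- The Gevrey bounds in the `ℓ¹` norm of weight `exp (ρ N_k)`, in terms of the radius `R`. -/
def GevreyL1 (Q : ℕ) (u : ℕ → quasilattice Q → ℝ) (ρ γ R : ℝ) : Prop :=
  ∀ n, L1Bound (fun k => expWeight Q ρ k * ‖u n k‖)
    (γ * ((n.factorial : ℝ) / R ^ n) ^ (4 * ell Q))

theorem exists_gevreyBound (hQ : 8 ≤ Q) (he : Even Q) [NeZero Q] (s : ℝ) :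
    ∃ K : ℝ, 0 < K ∧ GevreyBound Q s (fun n => toC (formalSeq Q n)) K := by
  obtain ⟨A, K, hA, hK, h⟩ := gevrey_l1 hQ he
  obtain ⟨C, hC, hsob⟩ := exists_sobolev_const Q s one_pos
  refine ⟨K * Real.exp 2, by positivity, C * A * Real.exp 1, fun n => ?_⟩
  have h1 := (suppLe_formalSeq n).l1Bound_expWeight zero_le_one (h n)
  have h2 := hsob (toC (formalSeq Q n)) _ (by simpa only [norm_toC] using h1)
  refine ⟨⟨_, h2.1⟩, rfl, (h2.2 ⟨_, h2.1⟩ rfl).trans (le_of_eq ?_)⟩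
  have h3 : Real.exp (1 * ((2 * n + 1 : ℕ) : ℝ)) = Real.exp 1 * Real.exp 2 ^ n := by
    rw [← Real.exp_nat_mul, ← Real.exp_add]
    congr 1
    push_cast; ring
  rw [h3, mul_pow]
  ring

/-- On N ≤ 2n + 1 the weight exp(ρN) costs exp(ρ) exp(2ρ)ⁿ. The gap between K^{1/4l} and K' absorbs
the geometric factor. -/
theorem exists_gevreyL1 (hQ : 8 ≤ Q) (he : Even Q) [NeZero Q] {s : ℝ} (hs : (Q : ℝ) / 4 < s)
    {K K' : ℝ} (hK : 0 < K) (hG : GevreyBound Q s (fun n => toC (formalSeq Q n)) K)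
    (hK' : K ^ (1 / (4 * (ell Q : ℝ))) < K') :
    ∃ ρ γ R : ℝ, 0 < ρ ∧ 0 < γ ∧ 1 / K' < R ∧ GevreyL1 Q (formalSeq Q) ρ γ R := by
  have hl := one_le_ell hQ he
  have hl' : (1 : ℝ) ≤ ell Q := by exact_mod_cast hl
  obtain ⟨γ, hγ⟩ := hG
  set κ := K ^ (1 / (4 * (ell Q : ℝ))) with hκ
  have hκ0 : 0 < κ := Real.rpow_pos_of_pos hK _
  have hK'0 : 0 < K' := hκ0.trans hK'
  set d := (κ + K') / 2 with hd
  have hd0 : 0 < d := by positivity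
  have hdκ : κ < d := by rw [hd]; linarith
  have hdK : d < K' := by rw [hd]; linarith
  -- Chosen so that K e^{2ρ} = d^{4l}, where d is the midpoint of κ = K^{1/4l} and K'; the radius is
  -- then R = 1/d > 1/K'.
  set ρ := 2 * (ell Q : ℝ) * Real.log (d / κ) with hρ
  have hlog : 0 < Real.log (d / κ) := Real.log_pos (by rwa [one_lt_div hκ0])
  have hρ0 : 0 < ρ := by positivity
  have hexp : K * Real.exp (2 * ρ) = d ^ (4 * ell Q) := by
    have h1 : K = κ ^ (4 * ell Q) := by
      rw [hκ, ← Real.rpow_natCast, ← Real.rpow_mul hK.le]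
      push_cast
      rw [one_div_mul_cancel (by positivity), Real.rpow_one]
    have h2 : Real.exp (2 * ρ) = (d / κ) ^ (4 * ell Q) := by
      rw [← Real.exp_log (show 0 < d / κ by positivity), ← Real.exp_nat_mul, hρ]
      congr 1
      push_cast; ring
    rw [h2]
    nth_rewrite 1 [h1]
    rw [← mul_pow]
    congr 1
    field_simp
  set γ' := embedConst Q s * |γ| * Real.exp ρ + 1 with hγ'
  have hemb : 0 ≤ embedConst Q s := Real.sqrt_nonneg _
  refine ⟨ρ, γ', 1 / d, hρ0, by positivity, one_div_lt_one_div_of_lt hd0 hdK, fun n => ?_⟩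
  obtain ⟨V, hV, hVn⟩ := hγ n
  have h1 := l1Bound_coeff (NeZero.ne Q) he hs V
  rw [hV] at h1
  simp only [norm_toC] at h1
  have h2 := (suppLe_formalSeq n).l1Bound_expWeight hρ0.le h1
  refine h2.mono (fun _ => le_rfl) ?_
  have h3 : Real.exp (ρ * ((2 * n + 1 : ℕ) : ℝ)) = Real.exp ρ * Real.exp (2 * ρ) ^ n := by
    rw [← Real.exp_nat_mul, ← Real.exp_add]
    congr 1
    push_cast; ring
  have h4 : ((n.factorial : ℝ) / (1 / d) ^ n) ^ (4 * ell Q)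
      = (K * Real.exp (2 * ρ)) ^ n * (n.factorial : ℝ) ^ (4 * ell Q) := by
    rw [hexp, one_div, inv_pow, div_inv_eq_mul, mul_pow, ← pow_mul, ← pow_mul, mul_comm n]
    ring
  rw [h3, h4]
  have h5 : ‖V‖ ≤ |γ| * K ^ n * (n.factorial : ℝ) ^ (4 * ell Q) := by
    refine hVn.trans ?_
    gcongr
    exact le_abs_self γ
  calc _ ≤ Real.exp ρ * Real.exp (2 * ρ) ^ n * (embedConst Q s *
        (|γ| * K ^ n * (n.factorial : ℝ) ^ (4 * ell Q))) := by gcongr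
    _ = (embedConst Q s * |γ| * Real.exp ρ) *
        ((K * Real.exp (2 * ρ)) ^ n * (n.factorial : ℝ) ^ (4 * ell Q)) := by
        rw [mul_pow]; ring
    _ ≤ _ := by
        gcongr
        rw [hγ']; linarith

end SobolevNorm

/-! ### The truncated Laplace transform of monomials. -/

section Laplace

/-- The truncated Laplace transform of `ζ ^ m / m!`. -/
def lap (c ν : ℝ) (m : ℕ) : ℝ :=
  (1 / ν) * ∫ ζ in (0 : ℝ)..c, Real.exp (-ζ / ν) * (ζ ^ m / m.factorial)

/-- The partial sums in the remainder of the truncated Laplace transform. -/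
def lapSum (ν ζ : ℝ) (m : ℕ) : ℝ :=
  ∑ j ∈ Finset.range (m + 1), ν ^ (m - j) * (ζ ^ j / j.factorial)

variable {c ν : ℝ}

theorem lapSum_succ (ν ζ : ℝ) (m : ℕ) :
    lapSum ν ζ (m + 1) = ν * lapSum ν ζ m + ζ ^ (m + 1) / (m + 1).factorial := by
  unfold lapSum
  rw [Finset.sum_range_succ, Finset.mul_sum]
  congr 1
  · refine Finset.sum_congr rfl fun j hj => ?_
    have : m + 1 - j = (m - j) + 1 := by have := Finset.mem_range.1 hj; omega
    rw [this, pow_succ]; ring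
  · simp

/-- Repeated integration by parts: `lapSum` collects the boundary terms. -/
theorem hasDerivAt_lapSum (hν : ν ≠ 0) (m : ℕ) (ζ : ℝ) :
    HasDerivAt (fun ζ => -(Real.exp (-ζ / ν) * lapSum ν ζ m))
      ((1 / ν) * (Real.exp (-ζ / ν) * (ζ ^ m / m.factorial))) ζ := by
  have hexp : HasDerivAt (fun ζ : ℝ => Real.exp (-ζ / ν)) (Real.exp (-ζ / ν) * (-1 / ν)) ζ :=
    ((hasDerivAt_id ζ).neg.div_const ν).exp
  induction m with
  | zero =>
    have h1 : (fun ζ => -(Real.exp (-ζ / ν) * lapSum ν ζ 0)) = fun ζ => -Real.exp (-ζ / ν) := by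
      funext ζ; simp [lapSum]
    rw [h1]
    exact hexp.neg.congr_deriv (by simp; ring)
  | succ m ih =>
    have h1 := ih.const_mul ν
    have h2 : HasDerivAt (fun ζ : ℝ => ζ ^ (m + 1) / ((m + 1).factorial : ℝ))
        (((m + 1 : ℕ) : ℝ) * ζ ^ m / ((m + 1).factorial : ℝ)) ζ := by
      simpa using (hasDerivAt_pow (m + 1) ζ).div_const ((m + 1).factorial : ℝ)
    have h3 := h1.sub (hexp.mul h2)
    have h4 : (fun ζ => -(Real.exp (-ζ / ν) * lapSum ν ζ (m + 1)))
        = fun ζ => ν * -(Real.exp (-ζ / ν) * lapSum ν ζ m)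
          - Real.exp (-ζ / ν) * (ζ ^ (m + 1) / ((m + 1).factorial : ℝ)) := by
      funext ζ
      rw [lapSum_succ]
      ring
    rw [h4]
    refine h3.congr_deriv ?_
    · rw [Nat.factorial_succ]
      have := (Nat.cast_ne_zero (R := ℝ)).2 (Nat.factorial_ne_zero m)
      push_cast
      field_simp
      ring

theorem continuous_lap_integrand (ν : ℝ) (m : ℕ) :
    Continuous fun ζ : ℝ => Real.exp (-ζ / ν) * (ζ ^ m / m.factorial) := by fun_prop

/-- The full Laplace transform of ζ^m/m! is ν^m; the right-hand side is the missing tail beyond c.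
-/
theorem lap_eq (hν : ν ≠ 0) (c : ℝ) (m : ℕ) :
    ν ^ m - lap c ν m = Real.exp (-c / ν) * lapSum ν c m := by
  have h1 := intervalIntegral.integral_eq_sub_of_hasDerivAt (a := 0) (b := c)
    (fun ζ _ => hasDerivAt_lapSum hν m ζ)
    (((continuous_lap_integrand ν m).const_mul (1 / ν)).intervalIntegrable 0 c)
  rw [intervalIntegral.integral_const_mul] at h1
  have h2 : lapSum ν 0 m = ν ^ m := by
    unfold lapSum
    rw [Finset.sum_eq_single_of_mem 0 (by simp)]
    · simp
    · intro j _ hj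
      simp [zero_pow hj]
  unfold lap
  rw [h1, h2]
  simp

theorem lap_nonneg (hc : 0 ≤ c) (hν : 0 < ν) (m : ℕ) : 0 ≤ lap c ν m := by
  unfold lap
  refine mul_nonneg (by positivity) (intervalIntegral.integral_nonneg hc fun ζ hζ => ?_)
  have := hζ.1
  positivity

/-- The kernel e^{-ζ/ν}/ν has mass at most 1 on [0, c], and ζ^m/m! is largest at c. -/
theorem lap_le (hc : 0 ≤ c) (hν : 0 < ν) (m : ℕ) : lap c ν m ≤ c ^ m / m.factorial := by
  have h1 : lap c ν m ≤ lap c ν 0 * (c ^ m / m.factorial) := by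
    unfold lap
    rw [mul_assoc, ← intervalIntegral.integral_mul_const]
    refine mul_le_mul_of_nonneg_left ?_ (by positivity)
    refine intervalIntegral.integral_mono_on hc
      ((continuous_lap_integrand ν m).intervalIntegrable _ _)
      (((continuous_lap_integrand ν 0).mul continuous_const).intervalIntegrable _ _) fun ζ hζ => ?_
    have h0 := hζ.1
    have h2 := hζ.2
    simp only [pow_zero, Nat.factorial_zero, Nat.cast_one, div_one, mul_one]
    gcongr
  have h2 : lap c ν 0 ≤ 1 := by
    have h3 := lap_eq hν.ne' c 0
    have h4 : 0 ≤ Real.exp (-c / ν) * lapSum ν c 0 := by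
      unfold lapSum; simp; positivity
    rw [pow_zero] at h3
    linarith
  exact h1.trans (mul_le_of_le_one_left (by positivity) h2)

/-- For m ≥ c/ν the function e^{-ζ/ν} ζ^m increases on [0, c], its maximum being at mν ≥ c. So the
integrand is bounded by its value at c. -/
theorem lap_le_tail (hc : 0 < c) (hν : 0 < ν) {m : ℕ} (hm : c / ν ≤ m) :
    lap c ν m ≤ (c / ν) * Real.exp (-c / ν) * (c ^ m / m.factorial) := by
  have h1 : ∀ ζ ∈ Set.Icc 0 c, Real.exp (-ζ / ν) * (ζ ^ m / m.factorial)
      ≤ Real.exp (-c / ν) * (c ^ m / m.factorial) := fun ζ hζ => by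
    have h2 : (ζ / c) ^ m ≤ Real.exp ((ζ - c) / ν) := by
      have h3 : ζ / c ≤ Real.exp (ζ / c - 1) := by
        have := Real.add_one_le_exp (ζ / c - 1); linarith
      calc (ζ / c) ^ m ≤ Real.exp (ζ / c - 1) ^ m :=
            pow_le_pow_left₀ (div_nonneg hζ.1 hc.le) h3 m
        _ = Real.exp (m * (ζ / c - 1)) := by rw [← Real.exp_nat_mul]
        _ ≤ Real.exp ((ζ - c) / ν) := by
            rw [Real.exp_le_exp]
            have h4 : ζ / c - 1 ≤ 0 := by
              rw [sub_nonpos, div_le_one hc]; exact hζ.2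
            calc (m : ℝ) * (ζ / c - 1) ≤ (c / ν) * (ζ / c - 1) :=
                  mul_le_mul_of_nonpos_right hm h4
              _ = _ := by field_simp
    have h5 : ζ ^ m = (ζ / c) ^ m * c ^ m := by rw [← mul_pow]; congr 1; field_simp
    have h6 : Real.exp (-c / ν) = Real.exp (-ζ / ν) * Real.exp ((ζ - c) / ν) := by
      rw [← Real.exp_add]; congr 1; ring
    rw [h5, h6]
    calc _ = Real.exp (-ζ / ν) * (ζ / c) ^ m * (c ^ m / m.factorial) := by ring
      _ ≤ _ := by gcongr
  have h7 : ∫ ζ in (0 : ℝ)..c, Real.exp (-ζ / ν) * (ζ ^ m / m.factorial)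
      ≤ ∫ ζ in (0 : ℝ)..c, Real.exp (-c / ν) * (c ^ m / m.factorial) :=
    intervalIntegral.integral_mono_on hc.le
      ((continuous_lap_integrand ν m).intervalIntegrable _ _)
      (continuous_const.intervalIntegrable _ _) h1
  rw [intervalIntegral.integral_const, smul_eq_mul, sub_zero] at h7
  unfold lap
  calc _ ≤ (1 / ν) * (c * (Real.exp (-c / ν) * (c ^ m / m.factorial))) := by gcongr
    _ = _ := by ring

end Laplace
end
end SwiftHohenberg

namespace SwiftHohenberg
noncomputable section

/-! ### The approximate quasipattern against the optimally truncated series. -/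

section LaplaceSeries
variable {Q : ℕ}

/-- The factorial (4ln + 2l)! of the Borel transform absorbs the Gevrey growth (n!)^{4l}. -/
theorem factorial_pow_le (j n i : ℕ) : n.factorial ^ j ≤ (j * n + i).factorial := by
  refine le_trans ?_ (Nat.factorial_le (Nat.le_add_right (j * n) i))
  induction j with
  | zero => simp
  | succ j ih =>
    rw [pow_succ, Nat.succ_mul]
    exact (Nat.mul_le_mul_right _ ih).trans (Nat.le_of_dvd (Nat.factorial_pos _)
      (Nat.factorial_mul_factorial_dvd_factorial_add _ _))

theorem factorial_le_mul_pow {m j : ℕ} (h : j ≤ m) :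
    (m.factorial : ℝ) ≤ j.factorial * (m : ℝ) ^ (m - j) := by
  have h1 := Nat.factorial_mul_descFactorial (n := m) (k := m - j) (Nat.sub_le _ _)
  rw [Nat.sub_sub_self h] at h1
  rw [← h1]
  push_cast
  gcongr
  exact_mod_cast Nat.descFactorial_le_pow m (m - j)

/-- Since m!/j! ≤ m^{m-j}, each of the m + 1 terms is at most (νm)^{m-j} c^j ≤ d^m. -/
theorem lapSum_mul_factorial_le {c ν d : ℝ} (hc : 0 ≤ c) (hν : 0 ≤ ν) (hcd : c ≤ d) (m : ℕ)
    (hm : ν * m ≤ d) : lapSum ν c m * m.factorial ≤ (m + 1) * d ^ m := by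
  have hd := hc.trans hcd
  unfold lapSum
  rw [Finset.sum_mul]
  have h1 : ∀ j ∈ Finset.range (m + 1),
      ν ^ (m - j) * (c ^ j / j.factorial) * m.factorial ≤ d ^ m := fun j hj => by
    have hj' : j ≤ m := by have := Finset.mem_range.1 hj; omega
    have hf : (0 : ℝ) < j.factorial := by positivity
    calc ν ^ (m - j) * (c ^ j / j.factorial) * m.factorial
        ≤ ν ^ (m - j) * (c ^ j / j.factorial) * (j.factorial * (m : ℝ) ^ (m - j)) := by
          gcongr
          exact factorial_le_mul_pow hj'
      _ = (ν * m) ^ (m - j) * c ^ j := by rw [mul_pow]; field_simp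
      _ ≤ d ^ (m - j) * d ^ j := by gcongr
      _ = d ^ m := by rw [← pow_add, Nat.sub_add_cancel hj']
  refine (Finset.sum_le_card_nsmul _ _ _ h1).trans ?_
  simp

/-- The superposition `∑ dₙ uₙ`. -/
def superpose (d : ℕ → ℝ) (u : ℕ → quasilattice Q → ℝ) : quasilattice Q → ℝ :=
  fun k => ∑' n, d n * u n k

variable {W : quasilattice Q → ℝ} {u : ℕ → quasilattice Q → ℝ} {b d : ℕ → ℝ}

theorem summable_superpose (hW : IsWeight W) (hu : ∀ n, L1Bound (fun k => W k * ‖u n k‖) (b n))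
    (hd : Summable fun n => |d n| * b n) (k : quasilattice Q) :
    Summable fun n => ‖d n * u n k‖ := by
  refine Summable.of_nonneg_of_le (fun n => norm_nonneg _) (fun n => ?_) hd
  rw [norm_mul, Real.norm_eq_abs]
  refine mul_le_mul_of_nonneg_left ?_ (abs_nonneg _)
  exact (le_mul_of_one_le_left (norm_nonneg _) (hW.one_le k)).trans ((hu n).le k)

theorem l1Bound_superpose (hW : IsWeight W)
    (hu : ∀ n, L1Bound (fun k => W k * ‖u n k‖) (b n))
    (hd : Summable fun n => |d n| * b n) :
    L1Bound (fun k => W k * ‖superpose d u k‖) (∑' n, |d n| * b n) := by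
  intro t
  have h1 := fun k => summable_superpose hW hu hd k
  calc ∑ k ∈ t, W k * ‖superpose d u k‖ ≤ ∑ k ∈ t, ∑' n, W k * ‖d n * u n k‖ := by
        refine Finset.sum_le_sum fun k _ => ?_
        rw [tsum_mul_left]
        exact mul_le_mul_of_nonneg_left (norm_tsum_le_tsum_norm (h1 k)) (hW.pos k).le
    _ = ∑' n, ∑ k ∈ t, W k * ‖d n * u n k‖ :=
        (Summable.tsum_finsetSum fun k _ => (h1 k).mul_left (W k)).symm
    _ ≤ ∑' n, |d n| * b n := by
        refine Summable.tsum_le_tsum (fun n => ?_)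
          (summable_sum fun k _ => (h1 k).mul_left (W k)) hd
        exact (hu n).norm_const_mul (d n) t

/-- The exponent of `ν` in front of the coefficient of order `n`. -/
def lapExp (Q n : ℕ) : ℕ := 4 * ell Q * n + 2 * ell Q

/-- The approximate quasipattern, with real coefficients. -/
def patternR (Q : ℕ) [NeZero Q] (c ν : ℝ) : quasilattice Q → ℝ :=
  superpose (fun n => lap c ν (lapExp Q n) / Real.sqrt (beta Q)) (formalSeq Q)

theorem factorial_ell_le (n : ℕ) :
    ((n.factorial : ℝ)) ^ (4 * ell Q) ≤ ((lapExp Q n).factorial : ℝ) := by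
  exact_mod_cast factorial_pow_le (4 * ell Q) n (2 * ell Q)

theorem gevrey_factor {R : ℝ} (hR : 0 < R) (n : ℕ) :
    ((n.factorial : ℝ) / R ^ n) ^ (4 * ell Q)
      = (n.factorial : ℝ) ^ (4 * ell Q) * (R ^ (2 * ell Q) / R ^ lapExp Q n) := by
  have : R ^ lapExp Q n = (R ^ n) ^ (4 * ell Q) * R ^ (2 * ell Q) := by
    rw [lapExp, pow_add, ← pow_mul, mul_comm n]
  rw [this, div_pow]
  field_simp

theorem lapExp_injective (hl : 1 ≤ ell Q) : Function.Injective (lapExp Q) := by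
  intro a b h
  unfold lapExp at h
  have : 4 * ell Q * a = 4 * ell Q * b := by omega
  exact Nat.eq_of_mul_eq_mul_left (by omega) this

theorem summable_geometric_lapExp (hl : 1 ≤ ell Q) {q : ℝ} (h0 : 0 ≤ q) (h1 : q < 1) :
    Summable fun n => ((lapExp Q n : ℝ) + 1) * q ^ lapExp Q n := by
  have h2 : Summable fun m : ℕ => ((m : ℝ) + 1) * q ^ m := by
    have h3 := summable_pow_mul_geometric_of_norm_lt_one 1 (r := q) (by rwa [Real.norm_of_nonneg h0])
    have h4 := summable_geometric_of_lt_one h0 h1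
    simpa [add_mul] using h3.add h4
  exact h2.comp_injective (lapExp_injective hl)

theorem lap_mul_gevrey_le {c ν R : ℝ} (hc : 0 ≤ c) (hν : 0 < ν) (hR : 0 < R) (n : ℕ) :
    lap c ν (lapExp Q n) * ((n.factorial : ℝ) / R ^ n) ^ (4 * ell Q)
      ≤ R ^ (2 * ell Q) * (((lapExp Q n : ℝ) + 1) * (c / R) ^ lapExp Q n) := by
  rw [gevrey_factor hR]
  have h1 := lap_le hc hν (lapExp Q n)
  have h2 := factorial_ell_le (Q := Q) n
  calc _ ≤ c ^ lapExp Q n / (lapExp Q n).factorial *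
        ((lapExp Q n).factorial * (R ^ (2 * ell Q) / R ^ lapExp Q n)) := by gcongr
    _ = R ^ (2 * ell Q) * (1 * (c / R) ^ lapExp Q n) := by rw [div_pow]; field_simp
    _ ≤ _ := by
        gcongr
        have : (0 : ℝ) ≤ lapExp Q n := Nat.cast_nonneg _
        linarith

/-- The index of truncation of the formal series. -/
def truncIndex (Q : ℕ) (c₂ ν : ℝ) : ℕ := ⌊c₂ / (4 * ell Q * ν)⌋₊

theorem truncIndex_le {c₂ ν : ℝ} (hl : 1 ≤ ell Q) (hc : 0 ≤ c₂) (hν : 0 < ν) :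
    4 * (ell Q : ℝ) * truncIndex Q c₂ ν * ν ≤ c₂ := by
  have hl' : (0 : ℝ) < ell Q := by exact_mod_cast hl
  have h := Nat.floor_le (show 0 ≤ c₂ / (4 * ell Q * ν) by positivity)
  rw [le_div_iff₀ (by positivity)] at h
  calc _ = (truncIndex Q c₂ ν : ℝ) * (4 * ell Q * ν) := by ring
    _ ≤ c₂ := h

theorem lt_truncIndex {c₂ ν : ℝ} (hl : 1 ≤ ell Q) (hν : 0 < ν) :
    c₂ < 4 * (ell Q : ℝ) * (truncIndex Q c₂ ν + 1) * ν := by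
  have hl' : (0 : ℝ) < ell Q := by exact_mod_cast hl
  have h := Nat.lt_floor_add_one (c₂ / (4 * ell Q * ν))
  rw [div_lt_iff₀ (by positivity)] at h
  calc c₂ < ((truncIndex Q c₂ ν : ℝ) + 1) * (4 * ell Q * ν) := h
    _ = _ := by ring

/-- Up to the truncation index the error is the tail e^{-c/ν} `lapSum`. Beyond it the transform
itself is exponentially small by `lap_le_tail`. In both cases a geometric factor of ratio (c +
3R)/(4R) < 1 remains. -/
theorem lap_sub_mul_gevrey_le {c ν R : ℝ} (hl : 1 ≤ ell Q) (hc : 0 < c) (hν : 0 < ν) (hcR : c < R)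
    (hνR : 8 * ell Q * ν ≤ R - c) (n : ℕ) :
    |lap c ν (lapExp Q n)
        - if n ≤ truncIndex Q ((c + R) / 2) ν then ν ^ lapExp Q n else 0| *
      ((n.factorial : ℝ) / R ^ n) ^ (4 * ell Q)
      ≤ Real.exp (-c / ν) *
        (R ^ (2 * ell Q) * (((lapExp Q n : ℝ) + 1) * ((c + 3 * R) / (4 * R)) ^ lapExp Q n)) := by
  have hR : 0 < R := hc.trans hcR
  have hl' : (0 : ℝ) < ell Q := by exact_mod_cast hl
  set m := lapExp Q n with hm
  set d := (c + 3 * R) / 4 with hd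
  have hmr : (m : ℝ) = 4 * ell Q * n + 2 * ell Q := by rw [hm, lapExp]; push_cast; ring
  have hcd : c ≤ d := by rw [hd]; linarith
  have hq : ((c + 3 * R) / (4 * R)) ^ m = d ^ m / R ^ m := by
    rw [← div_pow]; congr 1; rw [hd]; field_simp
  rw [gevrey_factor hR, hq, ← hm]
  have h2 := factorial_ell_le (Q := Q) n
  rw [← hm] at h2
  split_ifs with hn
  -- Here νm = 4lnν + 2lν ≤ (c + R)/2 + (R - c)/4 = d.
  · have h3 : ν * m ≤ d := by
      have h4 := truncIndex_le (c₂ := (c + R) / 2) hl (by positivity) hν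
      have h5 : 4 * (ell Q : ℝ) * n * ν ≤ 4 * (ell Q : ℝ) * truncIndex Q ((c + R) / 2) ν * ν := by
        gcongr
      rw [hmr, hd]
      nlinarith
    have h0 : 0 ≤ lapSum ν c m := Finset.sum_nonneg fun j _ => by positivity
    rw [abs_sub_comm, lap_eq hν.ne', abs_of_nonneg (by positivity)]
    calc _ ≤ Real.exp (-c / ν) * lapSum ν c m * (m.factorial * (R ^ (2 * ell Q) / R ^ m)) := by
          gcongr
      _ = Real.exp (-c / ν) * (R ^ (2 * ell Q) * (lapSum ν c m * m.factorial / R ^ m)) := by ring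
      _ ≤ Real.exp (-c / ν) * (R ^ (2 * ell Q) * (((m + 1) * d ^ m) / R ^ m)) := by
          have := lapSum_mul_factorial_le hc.le hν.le hcd m h3
          exact mul_le_mul_of_nonneg_left (mul_le_mul_of_nonneg_left
            (div_le_div_of_nonneg_right this (by positivity)) (by positivity)) (Real.exp_pos _).le
      _ = _ := by ring
  · have h3 : c / ν ≤ m := by
      rw [div_le_iff₀ hν, hmr]
      have h4 := lt_truncIndex (c₂ := (c + R) / 2) hl hν
      have h5 : (truncIndex Q ((c + R) / 2) ν : ℝ) + 1 ≤ n := by exact_mod_cast not_le.1 hn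
      have h6 : 4 * (ell Q : ℝ) * (truncIndex Q ((c + R) / 2) ν + 1) * ν
          ≤ 4 * (ell Q : ℝ) * n * ν := by gcongr
      nlinarith [mul_pos hl' hν]
    rw [sub_zero, abs_of_nonneg (lap_nonneg hc.le hν m)]
    calc _ ≤ (c / ν) * Real.exp (-c / ν) * (c ^ m / m.factorial) *
          (m.factorial * (R ^ (2 * ell Q) / R ^ m)) := by
          gcongr
          exact lap_le_tail hc hν h3
      _ = Real.exp (-c / ν) * (R ^ (2 * ell Q) * ((c / ν) * (c ^ m / R ^ m))) := by field_simp
      _ ≤ Real.exp (-c / ν) * (R ^ (2 * ell Q) * ((m + 1) * (d ^ m / R ^ m))) := by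
          gcongr
          linarith

variable [NeZero Q]

/-- The truncation of the formal series at the order `N`. -/
def partialPattern (Q : ℕ) [NeZero Q] (ν : ℝ) (N : ℕ) : quasilattice Q → ℝ :=
  fun k => ∑ n ∈ Finset.range (N + 1), ν ^ lapExp Q n / Real.sqrt (beta Q) * formalSeq Q n k

theorem exists_l1Bound_patternR {ρ γ R c : ℝ} (hl : 1 ≤ ell Q) (hρ : 0 ≤ ρ) (hc : 0 < c)
    (hcR : c < R) (hγ : 0 ≤ γ) (hG : GevreyL1 Q (formalSeq Q) ρ γ R) :
    ∃ C : ℝ, 0 < C ∧ ∀ ν : ℝ, 0 < ν →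
      L1Bound (fun k => expWeight Q ρ k * ‖patternR Q c ν k‖) C := by
  have hR : 0 < R := hc.trans hcR
  have hs := summable_geometric_lapExp (Q := Q) hl (q := c / R) (by positivity)
    (by rwa [div_lt_one hR])
  set a := fun n => ((lapExp Q n : ℝ) + 1) * (c / R) ^ lapExp Q n with ha
  have ha0 : ∀ n, 0 ≤ a n := fun n => by positivity
  set γ' := γ / Real.sqrt (beta Q) * R ^ (2 * ell Q) with hγ'
  have hγ0 : 0 ≤ γ' := by positivity
  refine ⟨γ' * ∑' n, a n + 1, by have : 0 ≤ ∑' n, a n := tsum_nonneg ha0; positivity, fun ν hν => ?_⟩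
  have hle : ∀ n, |lap c ν (lapExp Q n) / Real.sqrt (beta Q)| *
      (γ * ((n.factorial : ℝ) / R ^ n) ^ (4 * ell Q)) ≤ γ' * a n := fun n => by
    have h1 := lap_mul_gevrey_le (Q := Q) hc.le hν hR n
    rw [abs_of_nonneg (div_nonneg (lap_nonneg hc.le hν _) (Real.sqrt_nonneg _))]
    calc _ = γ / Real.sqrt (beta Q) *
          (lap c ν (lapExp Q n) * ((n.factorial : ℝ) / R ^ n) ^ (4 * ell Q)) := by ring
      _ ≤ γ / Real.sqrt (beta Q) * (R ^ (2 * ell Q) * a n) := by gcongr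
      _ = _ := by rw [hγ']; ring
  have hsum : Summable fun n => |lap c ν (lapExp Q n) / Real.sqrt (beta Q)| *
      (γ * ((n.factorial : ℝ) / R ^ n) ^ (4 * ell Q)) :=
    Summable.of_nonneg_of_le (fun n => by positivity) hle (hs.mul_left γ')
  refine (l1Bound_superpose (isWeight_expWeight hρ) hG hsum).mono (fun _ => le_rfl) ?_
  refine (hsum.tsum_le_tsum hle (hs.mul_left γ')).trans ?_
  rw [tsum_mul_left]
  linarith

theorem exists_l1Bound_patternR_sub {ρ γ R c : ℝ} (hl : 1 ≤ ell Q) (hρ : 0 ≤ ρ) (hc : 0 < c)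
    (hcR : c < R) (hγ : 0 ≤ γ) (hG : GevreyL1 Q (formalSeq Q) ρ γ R) :
    ∃ C : ℝ, 0 < C ∧ ∀ ν : ℝ, 0 < ν → 8 * ell Q * ν ≤ R - c →
      L1Bound (fun k => expWeight Q ρ k *
        ‖patternR Q c ν k - partialPattern Q ν (truncIndex Q ((c + R) / 2) ν) k‖)
        (C * Real.exp (-c / ν)) := by
  have hR : 0 < R := hc.trans hcR
  have hs := summable_geometric_lapExp (Q := Q) hl (q := (c + 3 * R) / (4 * R)) (by positivity)
    (by rw [div_lt_one (by positivity)]; linarith)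
  have hs' := summable_geometric_lapExp (Q := Q) hl (q := c / R) (by positivity)
    (by rwa [div_lt_one hR])
  set a := fun n => ((lapExp Q n : ℝ) + 1) * ((c + 3 * R) / (4 * R)) ^ lapExp Q n with ha
  have ha0 : ∀ n, 0 ≤ a n := fun n => by positivity
  set γ' := γ / Real.sqrt (beta Q) * R ^ (2 * ell Q) with hγ'
  have hγ0 : 0 ≤ γ' := by positivity
  refine ⟨γ' * ∑' n, a n + 1, by have : 0 ≤ ∑' n, a n := tsum_nonneg ha0; positivity, fun ν hν hνR => ?_⟩
  set N := truncIndex Q ((c + R) / 2) ν with hN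
  set d : ℕ → ℝ := fun n => (lap c ν (lapExp Q n) - if n ≤ N then ν ^ lapExp Q n else 0) /
    Real.sqrt (beta Q) with hd
  have hle : ∀ n, |d n| * (γ * ((n.factorial : ℝ) / R ^ n) ^ (4 * ell Q))
      ≤ γ' * Real.exp (-c / ν) * a n := fun n => by
    have h1 := lap_sub_mul_gevrey_le (Q := Q) hl hc hν hcR hνR n
    rw [hd]
    simp only
    rw [abs_div, abs_of_nonneg (Real.sqrt_nonneg (beta Q))]
    calc _ = γ / Real.sqrt (beta Q) *
          (|lap c ν (lapExp Q n) - if n ≤ N then ν ^ lapExp Q n else 0| *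
            ((n.factorial : ℝ) / R ^ n) ^ (4 * ell Q)) := by ring
      _ ≤ γ / Real.sqrt (beta Q) * (Real.exp (-c / ν) * (R ^ (2 * ell Q) * a n)) := by gcongr
      _ = _ := by rw [hγ']; ring
  have hsum : Summable fun n => |d n| * (γ * ((n.factorial : ℝ) / R ^ n) ^ (4 * ell Q)) :=
    Summable.of_nonneg_of_le (fun n => by positivity) hle (hs.mul_left _)
  have heq : ∀ k, patternR Q c ν k - partialPattern Q ν N k = superpose d (formalSeq Q) k := by
    intro k
    have h1 : partialPattern Q ν N k
        = ∑' n, (if n ≤ N then ν ^ lapExp Q n else 0) / Real.sqrt (beta Q) * formalSeq Q n k := by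
      rw [tsum_eq_sum (s := Finset.range (N + 1))]
      · refine Finset.sum_congr rfl fun n hn => ?_
        rw [if_pos (by have := Finset.mem_range.1 hn; omega)]
      · intro n hn
        rw [if_neg (by simpa using hn)]
        simp
    have h2 : Summable fun n => d n * formalSeq Q n k :=
      (summable_superpose (isWeight_expWeight hρ) hG hsum k).of_norm
    have h3 : Summable fun n =>
        (if n ≤ N then ν ^ lapExp Q n else 0) / Real.sqrt (beta Q) * formalSeq Q n k := by
      refine summable_of_ne_finset_zero (s := Finset.range (N + 1)) fun n hn => ?_
      rw [if_neg (by simpa using hn)]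
      simp
    rw [sub_eq_iff_eq_add, h1]
    unfold superpose
    rw [← h2.tsum_add h3]
    refine tsum_congr fun n => ?_
    rw [hd]
    ring
  simp only [heq]
  refine (l1Bound_superpose (isWeight_expWeight hρ) hG hsum).mono (fun _ => le_rfl) ?_
  refine (hsum.tsum_le_tsum hle (hs.mul_left _)).trans ?_
  rw [tsum_mul_left]
  have := Real.exp_pos (-c / ν)
  linarith

theorem rotInv_patternR (he : Even Q) (c ν : ℝ) : RotInv (patternR Q c ν) := fun k k' hk =>
  tsum_congr fun n => by rw [rotInv_formalSeq he n k k' hk]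

theorem rotInv_partialPattern (he : Even Q) (ν : ℝ) (N : ℕ) : RotInv (partialPattern Q ν N) :=
  fun k k' hk => Finset.sum_congr rfl fun n _ => by rw [rotInv_formalSeq he n k k' hk]

/-- Since 1/K' < R, the Borel series is dominated on [0, 1/K'] by a convergent geometric-type
series, and the sum may be exchanged with the integral. -/
theorem truncLaplace_formalSeq {ρ γ R K' ν : ℝ} (hl : 1 ≤ ell Q) (hρ : 0 ≤ ρ) (hK' : 0 < K')
    (hcR : 1 / K' < R) (hG : GevreyL1 Q (formalSeq Q) ρ γ R) :
    truncLaplace Q (fun n => toC (formalSeq Q n)) K' ν = toC (patternR Q (1 / K') ν) := by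
  funext k
  set c := 1 / K' with hc
  have hc0 : 0 < c := by positivity
  have hR : 0 < R := hc0.trans hcR
  clear_value c
  set β' := Real.sqrt (beta Q) with hβ'
  set f : ℕ → ℝ → ℝ := fun n ζ =>
    Real.exp (-ζ / ν) * (ζ ^ lapExp Q n / (lapExp Q n).factorial / β' * formalSeq Q n k) with hf
  have hu : ∀ n, |formalSeq Q n k| ≤ γ * ((n.factorial : ℝ) / R ^ n) ^ (4 * ell Q) := fun n =>
    (le_mul_of_one_le_left (norm_nonneg _) ((isWeight_expWeight hρ).one_le k)).trans ((hG n).le k)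
  set g : ℕ → ℝ := fun n => R ^ (2 * ell Q) * |γ| / β' *
    (((lapExp Q n : ℝ) + 1) * (c / R) ^ lapExp Q n) with hg
  have hgs : Summable g := (summable_geometric_lapExp (Q := Q) hl (q := c / R) (by positivity)
    (by rwa [div_lt_one hR])).mul_left _
  have hfg : ∀ n, ∀ ζ ∈ Set.Icc 0 c,
      |ζ ^ lapExp Q n / (lapExp Q n).factorial / β' * formalSeq Q n k| ≤ g n := by
    intro n ζ hζ
    have h0 := hζ.1
    have h1 := hζ.2
    have hβ0 : 0 ≤ β' := Real.sqrt_nonneg _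
    rw [abs_mul, abs_of_nonneg (by positivity)]
    have h2 := factorial_ell_le (Q := Q) n
    calc _ ≤ c ^ lapExp Q n / (lapExp Q n).factorial / β' *
          (|γ| * ((lapExp Q n).factorial * (R ^ (2 * ell Q) / R ^ lapExp Q n))) := by
          gcongr
          refine (hu n).trans ?_
          rw [gevrey_factor hR]
          gcongr
          exact le_abs_self γ
      _ = R ^ (2 * ell Q) * |γ| / β' * (1 * (c / R) ^ lapExp Q n) := by
          rw [div_pow]; field_simp
      _ ≤ _ := by
          rw [hg]
          simp only
          gcongr
          have : (0 : ℝ) ≤ lapExp Q n := Nat.cast_nonneg _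
          linarith
  have hcont : ∀ n, Continuous (f n) := fun n => by rw [hf]; fun_prop
  have hsum := intervalIntegral.hasSum_integral_of_dominated_convergence (μ := MeasureTheory.volume)
    (a := 0) (b := c) (F := f)
    (f := fun ζ => Real.exp (-ζ / ν) *
      ∑' n, ζ ^ lapExp Q n / (lapExp Q n).factorial / β' * formalSeq Q n k)
    (fun n ζ => Real.exp (-ζ / ν) * g n) (fun n => (hcont n).aestronglyMeasurable)
    (fun n => Filter.Eventually.of_forall fun ζ hζ => by
      rw [Set.uIoc_of_le hc0.le] at hζ
      rw [hf]
      simp only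
      rw [norm_mul, Real.norm_of_nonneg (Real.exp_pos _).le]
      exact mul_le_mul_of_nonneg_left (hfg n ζ ⟨hζ.1.le, hζ.2⟩) (Real.exp_pos _).le)
    (Filter.Eventually.of_forall fun ζ _ => hgs.mul_left _)
    (by
      simp only [tsum_mul_left]
      exact (by fun_prop : Continuous fun ζ : ℝ =>
        Real.exp (-ζ / ν) * ∑' n, g n).intervalIntegrable 0 c)
    (Filter.Eventually.of_forall fun ζ hζ => by
      rw [Set.uIoc_of_le hc0.le] at hζ
      have hs : Summable fun n =>
          ζ ^ lapExp Q n / (lapExp Q n).factorial / β' * formalSeq Q n k :=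
        Summable.of_norm (Summable.of_nonneg_of_le (fun _ => norm_nonneg _)
          (fun n => hfg n ζ ⟨hζ.1.le, hζ.2⟩) hgs)
      exact hs.hasSum.mul_left _)
  have hterm : ∀ n, ∫ ζ in (0 : ℝ)..c, f n ζ
      = (∫ ζ in (0 : ℝ)..c, Real.exp (-ζ / ν) * (ζ ^ lapExp Q n / (lapExp Q n).factorial)) *
        (formalSeq Q n k / β') := fun n => by
    rw [← intervalIntegral.integral_mul_const]
    refine intervalIntegral.integral_congr fun ζ _ => ?_
    rw [hf]
    ring
  have hborel : ∀ ζ, ((Real.exp (-ζ / ν) : ℝ) : ℂ) * borel Q (fun n => toC (formalSeq Q n)) ζ k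
      = ((Real.exp (-ζ / ν) *
      ∑' n, ζ ^ lapExp Q n / (lapExp Q n).factorial / β' * formalSeq Q n k : ℝ) : ℂ) := fun ζ => by
    rw [Complex.ofReal_mul, Complex.ofReal_tsum]
    congr 1
    unfold borel
    refine tsum_congr fun n => ?_
    rw [Complex.ofReal_mul]
    rfl
  unfold truncLaplace
  simp only [hborel]
  rw [← hc, intervalIntegral.integral_ofReal, ← Complex.ofReal_mul, toC, ← hsum.tsum_eq, patternR,
    superpose, ← tsum_mul_left]
  congr 1
  refine tsum_congr fun n => ?_
  rw [hterm, lap]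
  ring

end LaplaceSeries

/-! ### The residual of the truncated series. -/

section Residual
variable {Q : ℕ} {A : Type*} [NormedCommRing A] [CompleteSpace A]

theorem conv3_sum₁ {κ : Type*} (t : Finset κ) {f : κ → quasilattice Q → A} {g h : quasilattice Q → A}
    (hf : ∀ a, Summable fun k => ‖f a k‖) (hg : Summable fun k => ‖g k‖)
    (hh : Summable fun k => ‖h k‖) :
    conv3 (fun k => ∑ a ∈ t, f a k) g h = fun k => ∑ a ∈ t, conv3 (f a) g h k := by
  funext k
  unfold conv3
  rw [← Summable.tsum_finsetSum fun a _ => (summable_norm_fiber (hf a) hg hh k).of_norm]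
  exact tsum_congr fun p => by rw [Finset.sum_mul, Finset.sum_mul]

theorem conv3_sum {κ : Type*} (t : Finset κ) {f : κ → quasilattice Q → A}
    (hf : ∀ a, Summable fun k => ‖f a k‖) (k : quasilattice Q) :
    conv3 (fun k => ∑ a ∈ t, f a k) (fun k => ∑ a ∈ t, f a k) (fun k => ∑ a ∈ t, f a k) k
      = ∑ x ∈ t ×ˢ t ×ˢ t, conv3 (f x.1) (f x.2.1) (f x.2.2) k := by
  have hs : Summable fun k => ‖∑ a ∈ t, f a k‖ :=
    Summable.of_nonneg_of_le (fun _ => norm_nonneg _) (fun _ => norm_sum_le _ _)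
      (summable_sum fun a _ => hf a)
  rw [conv3_sum₁ t hf hs hs]
  simp only
  rw [Finset.sum_product]
  refine Finset.sum_congr rfl fun a _ => ?_
  rw [conv3_rotate_args, conv3_sum₁ t hf hs (hf a)]
  simp only
  rw [Finset.sum_product]
  refine Finset.sum_congr rfl fun b _ => ?_
  rw [conv3_rotate_args, conv3_sum₁ t hf (hf a) (hf b)]
  simp only
  refine Finset.sum_congr rfl fun c _ => ?_
  rw [conv3_rotate_args]

theorem sum_antidiagonal_eq_sum_cube {M : Type*} [AddCommMonoid M] {n N : ℕ} (h : n < N)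
    (f : ℕ × ℕ × ℕ → M) :
    ∑ p ∈ Finset.HasAntidiagonal.antidiagonal n, ∑ q ∈ Finset.HasAntidiagonal.antidiagonal p.2,
      f (p.1, q.1, q.2)
    = ∑ x ∈ (Finset.range (N + 1) ×ˢ Finset.range (N + 1) ×ˢ Finset.range (N + 1)) with
        x.1 + x.2.1 + x.2.2 = n, f x := by
  rw [Finset.sum_sigma']
  refine Finset.sum_nbij' (fun y => (y.1.1, y.2.1, y.2.2))
    (fun x => ⟨(x.1, x.2.1 + x.2.2), (x.2.1, x.2.2)⟩) ?_ ?_ ?_ ?_ ?_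
  · rintro ⟨⟨a, b⟩, ⟨c, d⟩⟩ hy
    simp only [Finset.mem_sigma, Finset.HasAntidiagonal.mem_antidiagonal] at hy
    simp only [Finset.mem_filter, Finset.mem_product, Finset.mem_range]
    omega
  · rintro ⟨a, b, c⟩ hx
    simp only [Finset.mem_filter, Finset.mem_product, Finset.mem_range] at hx
    simp only [Finset.mem_sigma, Finset.HasAntidiagonal.mem_antidiagonal]
    exact ⟨by omega, trivial⟩
  · rintro ⟨⟨a, b⟩, ⟨c, d⟩⟩ hy
    simp only [Finset.mem_sigma, Finset.HasAntidiagonal.mem_antidiagonal] at hy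
    obtain ⟨-, rfl⟩ := hy
    rfl
  · rintro ⟨a, b, c⟩ _
    rfl
  · rintro ⟨⟨a, b⟩, ⟨c, d⟩⟩ _
    rfl

variable [NeZero Q]

/-- The formal equations cancel all cubic terms of total index below N. What remains is the last
linear term and the cubic terms of total index at least N. -/
theorem residual_partialPattern (hQ : 2 ≤ Q) (he : Even Q) (ν : ℝ) (N : ℕ) (k : quasilattice Q) :
    symbol k * partialPattern Q ν N k - ν ^ (4 * ell Q) * partialPattern Q ν N k
      + conv3 (partialPattern Q ν N) (partialPattern Q ν N) (partialPattern Q ν N) k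
    = -(ν ^ (4 * ell Q) * (ν ^ lapExp Q N / Real.sqrt (beta Q) * formalSeq Q N k))
      + ∑ x ∈ (Finset.range (N + 1) ×ˢ Finset.range (N + 1) ×ˢ Finset.range (N + 1)) with
          N ≤ x.1 + x.2.1 + x.2.2,
        conv3 (fun k => ν ^ lapExp Q x.1 / Real.sqrt (beta Q) * formalSeq Q x.1 k)
          (fun k => ν ^ lapExp Q x.2.1 / Real.sqrt (beta Q) * formalSeq Q x.2.1 k)
          (fun k => ν ^ lapExp Q x.2.2 / Real.sqrt (beta Q) * formalSeq Q x.2.2 k) k := by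
  have hβ := beta_pos hQ
  set b := Real.sqrt (beta Q) with hb
  have hb0 : b ≠ 0 := (Real.sqrt_pos.2 hβ).ne'
  have hbb : b ^ 2 = beta Q := Real.sq_sqrt hβ.le
  set p : ℕ → ℝ := fun n => ν ^ lapExp Q n / b with hp
  have hps : ∀ n, p (n + 1) = ν ^ (4 * ell Q) * p n := fun n => by
    rw [hp]
    simp only [lapExp]
    rw [show 4 * ell Q * (n + 1) + 2 * ell Q = 4 * ell Q + (4 * ell Q * n + 2 * ell Q) by ring,
      pow_add]
    ring
  -- The three half powers √μ combine to one extra power of μ, i.e. a shift of the index by 1, and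
  -- the three factors β^{-1/2} leave β⁻¹ besides the one kept.
  have hppp : ∀ a c d, p a * p c * p d = p (a + c + d + 1) * (beta Q)⁻¹ := fun a c d => by
    have h1 : ν ^ lapExp Q (a + c + d + 1)
        = ν ^ lapExp Q a * ν ^ lapExp Q c * ν ^ lapExp Q d := by
      rw [← pow_add, ← pow_add]
      congr 1
      simp only [lapExp]
      ring
    rw [hp, ← hbb]
    simp only
    rw [h1]
    field_simp
  have hu := fun n => (suppLe_formalSeq (Q := Q) n).summable_norm
  have hpu : ∀ n, Summable fun k => ‖p n * formalSeq Q n k‖ := fun n => by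
    simpa only [norm_mul] using (hu n).mul_left ‖p n‖
  have hT : ∀ x : ℕ × ℕ × ℕ, conv3 (fun k => p x.1 * formalSeq Q x.1 k)
      (fun k => p x.2.1 * formalSeq Q x.2.1 k) (fun k => p x.2.2 * formalSeq Q x.2.2 k) k
      = p (x.1 + x.2.1 + x.2.2 + 1) * (beta Q)⁻¹ *
        conv3 (formalSeq Q x.1) (formalSeq Q x.2.1) (formalSeq Q x.2.2) k := fun x => by
    rw [conv3_const_mul _ (hu _) (hpu _) (hpu _), conv3_rotate_args,
      conv3_const_mul _ (hu _) (hpu _) (hu _), conv3_rotate_args,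
      conv3_const_mul _ (hu _) (hu _) (hu _), conv3_rotate_args, ← hppp]
    ring
  have hcube : conv3 (partialPattern Q ν N) (partialPattern Q ν N) (partialPattern Q ν N) k
      = ∑ x ∈ Finset.range (N + 1) ×ˢ Finset.range (N + 1) ×ˢ Finset.range (N + 1),
        conv3 (fun k => p x.1 * formalSeq Q x.1 k)
          (fun k => p x.2.1 * formalSeq Q x.2.1 k) (fun k => p x.2.2 * formalSeq Q x.2.2 k) k :=
    conv3_sum (Finset.range (N + 1)) hpu k
  have hlow : ∑ x ∈ (Finset.range (N + 1) ×ˢ Finset.range (N + 1) ×ˢ Finset.range (N + 1)) with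
          ¬ N ≤ x.1 + x.2.1 + x.2.2,
        conv3 (fun k => p x.1 * formalSeq Q x.1 k)
          (fun k => p x.2.1 * formalSeq Q x.2.1 k) (fun k => p x.2.2 * formalSeq Q x.2.2 k) k
      = ∑ n ∈ Finset.range N, p (n + 1) * ((beta Q)⁻¹ * cubeSum (formalSeq Q) n k) := by
    rw [← Finset.sum_fiberwise_of_maps_to (t := Finset.range N)
      (g := fun x : ℕ × ℕ × ℕ => x.1 + x.2.1 + x.2.2)
      (fun x hx => by simpa using (Finset.mem_filter.1 hx).2)]
    refine Finset.sum_congr rfl fun n hn => ?_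
    have hn' := Finset.mem_range.1 hn
    unfold cubeSum
    simp only [Finset.sum_apply]
    rw [sum_antidiagonal_eq_sum_cube hn'
      (fun x => conv3 (formalSeq Q x.1) (formalSeq Q x.2.1) (formalSeq Q x.2.2) k),
      Finset.filter_filter, Finset.mul_sum, Finset.mul_sum]
    refine Finset.sum_congr ?_ fun x hx => ?_
    · refine Finset.filter_congr fun x _ => ?_
      constructor
      · exact fun h => h.2
      · exact fun h => ⟨by omega, h⟩
    · rw [hT x, (Finset.mem_filter.1 hx).2]
      ring
  have hlin : symbol k * partialPattern Q ν N k - ν ^ (4 * ell Q) * partialPattern Q ν N k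
      = -(ν ^ (4 * ell Q) * (p N * formalSeq Q N k))
        - ∑ n ∈ Finset.range N, p (n + 1) * ((beta Q)⁻¹ * cubeSum (formalSeq Q) n k) := by
    have h1 : symbol k * partialPattern Q ν N k
        = ∑ n ∈ Finset.range N, p (n + 1) * (formalSeq Q n k
          - (beta Q)⁻¹ * cubeSum (formalSeq Q) n k) := by
      unfold partialPattern
      rw [Finset.sum_range_succ', mul_add, Finset.mul_sum]
      have h0 : symbol k * formalSeq Q 0 k = 0 := by
        rw [formalSeq_zero]
        by_cases h : IsWave Q k
        · rw [h.symbol, zero_mul]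
        · rw [leadR_not_wave h, mul_zero]
      have h2 : symbol k * (ν ^ lapExp Q 0 / b * formalSeq Q 0 k) = 0 := by
        rw [mul_left_comm, h0, mul_zero]
      rw [h2, add_zero]
      refine Finset.sum_congr rfl fun n _ => ?_
      rw [← symbol_mul_formalSeq hQ he]
      ring
    have h2 : ν ^ (4 * ell Q) * partialPattern Q ν N k
        = ∑ n ∈ Finset.range N, p (n + 1) * formalSeq Q n k
          + ν ^ (4 * ell Q) * (p N * formalSeq Q N k) := by
      unfold partialPattern
      rw [Finset.sum_range_succ, mul_add, Finset.mul_sum]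
      congr 1
      refine Finset.sum_congr rfl fun n _ => ?_
      rw [hps]
      ring
    rw [h1, h2]
    simp only [mul_sub, Finset.sum_sub_distrib]
    ring
  rw [hlin, hcube, ← Finset.sum_filter_add_sum_filter_not _
    (fun x : ℕ × ℕ × ℕ => N ≤ x.1 + x.2.1 + x.2.2), hlow]
  ring

end Residual
end
end SwiftHohenberg

namespace SwiftHohenberg
noncomputable section

/-! ### Exponential smallness of the residual, and the leading term. -/

section PartialPatternBounds
variable {Q : ℕ}

theorem gevrey_ratio_le {ν R : ℝ} (hν : 0 ≤ ν) (hR : 0 < R) (n : ℕ) :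
    ν ^ n * n.factorial / R ^ n ≤ (ν * n / R) ^ n := by
  rw [div_pow, mul_pow]
  gcongr
  exact_mod_cast Nat.factorial_le_pow n

/-- Up to the truncation index 4lnν ≤ c₂ ≤ R, and l ≥ 1. -/
theorem mul_div_le_quarter {c₂ ν R : ℝ} (hl : 1 ≤ ell Q) (hc : 0 ≤ c₂) (hcR : c₂ ≤ R) (hR : 0 < R)
    (hν : 0 < ν) {n : ℕ} (hn : n ≤ truncIndex Q c₂ ν) : ν * n / R ≤ 1 / 4 := by
  have hl' : (1 : ℝ) ≤ ell Q := by exact_mod_cast hl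
  have h1 := truncIndex_le hl hc hν
  have h2 : (n : ℝ) ≤ truncIndex Q c₂ ν := by exact_mod_cast hn
  have h3 : (n : ℝ) * ν ≤ ell Q * (truncIndex Q c₂ ν * ν) := by
    have : (n : ℝ) * ν ≤ truncIndex Q c₂ ν * ν := by gcongr
    have h0 : (0 : ℝ) ≤ truncIndex Q c₂ ν * ν := by positivity
    nlinarith
  rw [div_le_iff₀ hR]
  linarith

theorem gevrey_term_eq {ν R γ : ℝ} (n : ℕ) :
    ν ^ lapExp Q n / Real.sqrt (beta Q) * (γ * ((n.factorial : ℝ) / R ^ n) ^ (4 * ell Q))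
      = γ / Real.sqrt (beta Q) * ν ^ (2 * ell Q) *
        (ν ^ n * n.factorial / R ^ n) ^ (4 * ell Q) := by
  have : ν ^ lapExp Q n = (ν ^ n) ^ (4 * ell Q) * ν ^ (2 * ell Q) := by
    rw [lapExp, pow_add, ← pow_mul, mul_comm n]
  rw [this, mul_div_assoc (ν ^ n), mul_pow]
  ring

theorem gevrey_ratio_pow_le {c₂ ν R : ℝ} (hl : 1 ≤ ell Q) (hc : 0 ≤ c₂) (hcR : c₂ ≤ R) (hR : 0 < R)
    (hν : 0 < ν) {n : ℕ} (hn : n ≤ truncIndex Q c₂ ν) :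
    (ν ^ n * n.factorial / R ^ n) ^ (4 * ell Q) ≤ (1 / 4) ^ (4 * ell Q * n) := by
  rw [mul_comm (4 * ell Q) n, pow_mul (1 / 4 : ℝ)]
  have h1 := gevrey_ratio_le hν.le hR n
  have h2 := mul_div_le_quarter hl hc hcR hR hν hn
  gcongr
  exact h1.trans (by gcongr)

theorem exp_div_four_lt_one : Real.exp 1 / 4 < 1 := by
  have := Real.exp_one_lt_three
  linarith

/-- Write 1/4 = e⁻¹ · (e/4). Since 4l(S + 1)ν > c₂ ≥ c, the first factor yields e^{4l} e^{-c/ν}. The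
second, as e < 4, leaves a geometric decay in S for summing over triples. -/
theorem quarter_pow_le {c₂ c ν : ℝ} (hl : 1 ≤ ell Q) (hc : c ≤ c₂) (hν : 0 < ν) {S : ℕ}
    (hS : truncIndex Q c₂ ν ≤ S) :
    (1 / 4 : ℝ) ^ (4 * ell Q * S)
      ≤ Real.exp (4 * ell Q) * Real.exp (-c / ν) * (Real.exp 1 / 4) ^ S := by
  have h1 : (1 / 4 : ℝ) = Real.exp (-1) * (Real.exp 1 / 4) := by
    rw [← mul_div_assoc, ← Real.exp_add]; simp
  have h2 := lt_truncIndex (Q := Q) (c₂ := c₂) hl hν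
  have h3 : (truncIndex Q c₂ ν : ℝ) ≤ S := by exact_mod_cast hS
  rw [h1, mul_pow, ← Real.exp_nat_mul, ← Real.exp_add]
  have h4 : (Real.exp 1 / 4) ^ (4 * ell Q * S) ≤ (Real.exp 1 / 4) ^ S :=
    pow_le_pow_of_le_one (by positivity) exp_div_four_lt_one.le
      (Nat.le_mul_of_pos_left S (by omega))
  refine mul_le_mul (Real.exp_le_exp.2 ?_) h4 (by positivity) (Real.exp_pos _).le
  have h5 : c / ν ≤ 4 * (ell Q : ℝ) * (S + 1) := by
    rw [div_le_iff₀ hν]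
    refine hc.trans (h2.le.trans ?_)
    gcongr
  push_cast
  rw [neg_div]
  linarith

variable [NeZero Q]

theorem l1Bound_gevrey_term {ρ γ R c₂ ν : ℝ} (hl : 1 ≤ ell Q) (hγ : 0 ≤ γ) (hc : 0 ≤ c₂)
    (hcR : c₂ ≤ R) (hR : 0 < R) (hν : 0 < ν) (hG : GevreyL1 Q (formalSeq Q) ρ γ R) {n : ℕ}
    (hn : n ≤ truncIndex Q c₂ ν) :
    L1Bound (fun k => expWeight Q ρ k *
        ‖ν ^ lapExp Q n / Real.sqrt (beta Q) * formalSeq Q n k‖)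
      (γ / Real.sqrt (beta Q) * ν ^ (2 * ell Q) * (1 / 4) ^ (4 * ell Q * n)) := by
  refine ((hG n).norm_const_mul _).mono (fun _ => le_rfl) ?_
  rw [abs_of_nonneg (by positivity), gevrey_term_eq]
  gcongr
  exact gevrey_ratio_pow_le hl hc hcR hR hν hn

/-- The partial sums of the formal series solve the equation up to an exponentially small error. -/
theorem exists_l1Bound_residual {ρ γ R c : ℝ} (hQ : 2 ≤ Q) (he : Even Q) (hl : 1 ≤ ell Q)
    (hρ : 0 ≤ ρ) (hc : 0 < c) (hcR : c < R) (hγ : 0 ≤ γ) (hG : GevreyL1 Q (formalSeq Q) ρ γ R) :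
    ∃ C : ℝ, 0 < C ∧ ∀ ν : ℝ, 0 < ν → ν ≤ 1 →
      ∀ P, P = partialPattern Q ν (truncIndex Q ((c + R) / 2) ν) →
      L1Bound (fun k => expWeight Q ρ k * ‖symbol k * P k - ν ^ (4 * ell Q) * P k + conv3 P P P k‖)
        (C * ν ^ (4 * ell Q) * Real.exp (-c / ν)) := by
  have hR : 0 < R := hc.trans hcR
  set g := γ / Real.sqrt (beta Q) with hg
  have hg0 : 0 ≤ g := by positivity
  set r := Real.exp 1 / 4 with hr
  have hr0 : 0 ≤ r := by positivity
  have hr1 : r < 1 := exp_div_four_lt_one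
  have hr2 : 0 < 1 - r := by linarith
  set e := Real.exp (4 * ell Q) with he'
  refine ⟨g * e + g ^ 3 * e * (1 - r)⁻¹ ^ 3 + 1, by positivity, fun ν hν hν1 P hP => ?_⟩
  set c₂ := (c + R) / 2 with hc₂
  have hc₂0 : 0 ≤ c₂ := by positivity
  have hcc₂ : c ≤ c₂ := by rw [hc₂]; linarith
  have hc₂R : c₂ ≤ R := by rw [hc₂]; linarith
  set N := truncIndex Q c₂ ν with hN
  set E := Real.exp (-c / ν) with hE
  have hE0 : 0 < E := Real.exp_pos _
  set μ := ν ^ (4 * ell Q) with hμ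
  have hμ0 : 0 < μ := by positivity
  have hWp : ∀ k : quasilattice Q, 0 ≤ expWeight Q ρ k := fun k => (Real.exp_pos _).le
  have hterm := fun n (hn : n ≤ N) => l1Bound_gevrey_term hl hγ hc₂0 hc₂R hR hν hG hn
  simp only [← hg] at hterm
  subst hP
  have h1 : L1Bound (fun k => expWeight Q ρ k *
      ‖-μ * (ν ^ lapExp Q N / Real.sqrt (beta Q) * formalSeq Q N k)‖) (g * e * μ * E) := by
    refine ((hterm N le_rfl).norm_const_mul (-μ)).mono (fun _ => le_rfl) ?_
    rw [abs_neg, abs_of_pos hμ0]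
    have h2 : ν ^ (2 * ell Q) ≤ 1 := pow_le_one₀ hν.le hν1
    have h3 := quarter_pow_le hl hcc₂ hν (le_refl N)
    have h4 : r ^ N ≤ 1 := pow_le_one₀ hr0 hr1.le
    calc _ ≤ μ * (g * 1 * (e * E * 1)) := by
          gcongr
          exact h3.trans (by gcongr)
      _ = _ := by ring
  have h2 : ∀ x ∈ (Finset.range (N + 1) ×ˢ Finset.range (N + 1) ×ˢ Finset.range (N + 1)).filter
        (fun x : ℕ × ℕ × ℕ => N ≤ x.1 + x.2.1 + x.2.2),
      L1Bound (fun k => expWeight Q ρ k *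
        ‖conv3 (fun k => ν ^ lapExp Q x.1 / Real.sqrt (beta Q) * formalSeq Q x.1 k)
          (fun k => ν ^ lapExp Q x.2.1 / Real.sqrt (beta Q) * formalSeq Q x.2.1 k)
          (fun k => ν ^ lapExp Q x.2.2 / Real.sqrt (beta Q) * formalSeq Q x.2.2 k) k‖)
        (g ^ 3 * e * μ * E * (r ^ x.1 * (r ^ x.2.1 * r ^ x.2.2))) := by
    rintro ⟨a, b, d⟩ hx
    simp only [Finset.mem_filter, Finset.mem_product, Finset.mem_range] at hx
    obtain ⟨⟨ha, hb, hd⟩, hs⟩ := hx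
    refine ((isWeight_expWeight hρ).l1Bound_conv3 (hterm a (by omega)) (hterm b (by omega))
      (hterm d (by omega))).mono (fun _ => le_rfl) ?_
    have h3 := quarter_pow_le hl hcc₂ hν hs
    -- ν^{6l} ≤ ν^{4l} = μ. This factor μ in the residual later compensates the inverse damping rate
    -- 1/μ.
    have h4 : ν ^ (2 * ell Q) * ν ^ (2 * ell Q) * ν ^ (2 * ell Q) ≤ μ := by
      rw [← pow_add, ← pow_add]
      exact pow_le_pow_of_le_one hν.le hν1 (by omega)
    simp only
    calc _ = g ^ 3 * (ν ^ (2 * ell Q) * ν ^ (2 * ell Q) * ν ^ (2 * ell Q)) *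
          (1 / 4) ^ (4 * ell Q * (a + b + d)) := by
          rw [mul_add, mul_add, pow_add, pow_add]; ring
      _ ≤ g ^ 3 * μ * (e * E * r ^ (a + b + d)) := by gcongr
      _ = _ := by rw [pow_add, pow_add]; ring
  refine (L1Bound.norm_add hWp h1 (L1Bound.norm_finset_sum _ hWp h2)).mono (fun k => ?_) ?_
  · rw [residual_partialPattern hQ he, Finset.sum_apply, neg_mul]
  · have h3 : ∑ x ∈ (Finset.range (N + 1) ×ˢ Finset.range (N + 1) ×ˢ Finset.range (N + 1)).filter
        (fun x : ℕ × ℕ × ℕ => N ≤ x.1 + x.2.1 + x.2.2),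
        g ^ 3 * e * μ * E * (r ^ x.1 * (r ^ x.2.1 * r ^ x.2.2))
        ≤ g ^ 3 * e * μ * E * (1 - r)⁻¹ ^ 3 := by
      rw [← Finset.mul_sum]
      refine mul_le_mul_of_nonneg_left ?_ (by positivity)
      refine (Finset.sum_le_sum_of_subset_of_nonneg (Finset.filter_subset _ _)
        fun x _ _ => by positivity).trans ?_
      have h4 : ∑ a ∈ Finset.range (N + 1), r ^ a ≤ (1 - r)⁻¹ := by
        rw [← tsum_geometric_of_lt_one hr0 hr1]
        exact (summable_geometric_of_lt_one hr0 hr1).sum_le_tsum _ fun _ _ => by positivity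
      have h5 : 0 ≤ ∑ a ∈ Finset.range (N + 1), r ^ a := Finset.sum_nonneg fun _ _ => by positivity
      simp only [Finset.sum_product, ← Finset.mul_sum, ← Finset.sum_mul]
      rw [← mul_assoc, pow_succ, pow_two]
      gcongr
    calc _ ≤ g * e * μ * E + g ^ 3 * e * μ * E * (1 - r)⁻¹ ^ 3 := by gcongr
      _ = (g * e + g ^ 3 * e * (1 - r)⁻¹ ^ 3) * μ * E := by ring
      _ ≤ _ := by
          have : g * e + g ^ 3 * e * (1 - r)⁻¹ ^ 3 ≤ g * e + g ^ 3 * e * (1 - r)⁻¹ ^ 3 + 1 := by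
            linarith
          gcongr

/-- Each term of order n + 1 contains the small ratio x = ν(n + 1)/R at least to the power n + 1.
One factor x provides the gain ν and the others, at most 1/4 each, make the sum converge. -/
theorem exists_l1Bound_partialPattern_sub {ρ γ R c : ℝ} (hl : 1 ≤ ell Q)
    (hc : 0 < c) (hcR : c < R) (hγ : 0 ≤ γ) (hG : GevreyL1 Q (formalSeq Q) ρ γ R) :
    ∃ C : ℝ, 0 < C ∧ ∀ ν : ℝ, 0 < ν →
      L1Bound (fun k => expWeight Q ρ k *
        ‖partialPattern Q ν (truncIndex Q ((c + R) / 2) ν) k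
          - ν ^ (2 * ell Q) / Real.sqrt (beta Q) * leadR Q k‖)
        (C * ν ^ (2 * ell Q) * ν) := by
  have hR : 0 < R := hc.trans hcR
  set g := γ / Real.sqrt (beta Q) with hg
  have hg0 : 0 ≤ g := by positivity
  refine ⟨g * 2 / R + 1, by positivity, fun ν hν => ?_⟩
  set c₂ := (c + R) / 2 with hc₂
  have hc₂0 : 0 ≤ c₂ := by positivity
  have hc₂R : c₂ ≤ R := by rw [hc₂]; linarith
  set N := truncIndex Q c₂ ν with hN
  have hWp : ∀ k : quasilattice Q, 0 ≤ expWeight Q ρ k := fun k => (Real.exp_pos _).le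
  have h1 : ∀ n ∈ Finset.range N, L1Bound (fun k => expWeight Q ρ k *
      ‖(fun k => ν ^ lapExp Q (n + 1) / Real.sqrt (beta Q) * formalSeq Q (n + 1) k) k‖)
      (g * ν ^ (2 * ell Q) * (ν / R) * (1 / 2) ^ n) := fun n hn => by
    have hn' : n + 1 ≤ N := Finset.mem_range.1 hn
    refine ((hG (n + 1)).norm_const_mul _).mono (fun _ => le_rfl) ?_
    rw [abs_of_nonneg (by positivity), gevrey_term_eq, ← hg]
    have h2 := gevrey_ratio_le hν.le hR (n + 1)
    have h3 := mul_div_le_quarter hl hc₂0 hc₂R hR hν hn'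
    set x := ν * ((n + 1 : ℕ) : ℝ) / R with hx
    have hx0 : 0 ≤ x := by positivity
    have h4 : (ν ^ (n + 1) * ((n + 1).factorial : ℝ) / R ^ (n + 1)) ^ (4 * ell Q)
        ≤ (ν / R) * (1 / 2) ^ n := by
      calc _ ≤ (x ^ (n + 1)) ^ (4 * ell Q) := by gcongr
        _ ≤ x ^ (n + 1) := pow_le_of_le_one (by positivity)
            (pow_le_one₀ hx0 (h3.trans (by norm_num))) (by omega)
        _ = x * x ^ n := by ring
        _ ≤ x * (1 / 4) ^ n := by gcongr
        _ = (ν / R) * (((n + 1 : ℕ) : ℝ) * (1 / 4) ^ n) := by rw [hx]; ring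
        _ ≤ (ν / R) * (2 ^ n * (1 / 4) ^ n) := by
            gcongr
            exact_mod_cast Nat.lt_two_pow_self
        _ = _ := by rw [← mul_pow]; norm_num
    calc _ ≤ g * ν ^ (2 * ell Q) * ((ν / R) * (1 / 2) ^ n) := by gcongr
      _ = _ := by ring
  refine (L1Bound.norm_finset_sum _ hWp h1).mono (fun k => ?_) ?_
  · rw [partialPattern, Finset.sum_range_succ', Finset.sum_apply, formalSeq_zero]
    simp [lapExp]
  · rw [← Finset.mul_sum]
    have h2 : ∑ n ∈ Finset.range N, (1 / 2 : ℝ) ^ n ≤ 2 :=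
      (summable_geometric_two.sum_le_tsum _ fun _ _ => by positivity).trans_eq tsum_geometric_two
    calc _ ≤ g * ν ^ (2 * ell Q) * (ν / R) * 2 := by gcongr
      _ = (g * 2 / R) * ν ^ (2 * ell Q) * ν := by ring
      _ ≤ _ := by gcongr; linarith

end PartialPatternBounds
end
end SwiftHohenberg

namespace SwiftHohenberg
noncomputable section

/-! ### A contraction principle in weighted ℓ¹. -/

section FixedPoint
variable {Q : ℕ} {A : Type*} [NormedCommRing A] [CompleteSpace A]

/-- The contraction principle for families indexed by the quasilattice, in the weighted `ℓ¹` norm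
`∑ ‖wtₖ Uₖ‖` and among rotation invariant families. -/
theorem exists_fixedPoint {wt wi : quasilattice Q → A} (hw : ∀ k, wi k * wt k = 1)
    {Ψ : (quasilattice Q → A) → quasilattice Q → A} {P : quasilattice Q → A} {r η : ℝ}
    (hP : RotInv P) (hΨ : ∀ U, RotInv U → RotInv (Ψ U))
    (hL : ∀ U V B, RotInv U → RotInv V → L1Bound (fun k => ‖wt k * (U k - P k)‖) r →
      L1Bound (fun k => ‖wt k * (V k - P k)‖) r → L1Bound (fun k => ‖wt k * (U k - V k)‖) B →
      L1Bound (fun k => ‖wt k * (Ψ U k - Ψ V k)‖) (B / 2))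
    (hη : L1Bound (fun k => ‖wt k * (Ψ P k - P k)‖) η) (hηr : 2 * η ≤ r) :
    ∃ U, Ψ U = U ∧ RotInv U ∧ L1Bound (fun k => ‖wt k * (U k - P k)‖) (2 * η) := by
  have tri : ∀ {f g h : quasilattice Q → A} {a b c : ℝ},
      L1Bound (fun k => ‖wt k * (f k - g k)‖) a → L1Bound (fun k => ‖wt k * (g k - h k)‖) b →
      a + b ≤ c → L1Bound (fun k => ‖wt k * (f k - h k)‖) c := fun hf hg hc =>
    (hf.add hg).mono (fun k => by
      rw [← sub_add_sub_cancel _ _ _, mul_add]; exact norm_add_le _ _) hc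
  have hη0 := hη.nonneg
  set u : ℕ → quasilattice Q → A := fun n => Ψ^[n] P with hu
  have hus : ∀ n, u (n + 1) = Ψ (u n) := fun n => Function.iterate_succ_apply' Ψ n P
  -- The bound 2η - 2η/2ⁿ is the sum of the first n geometric steps; it keeps all iterates in the
  -- ball where the contraction estimate holds.
  have key : ∀ n, RotInv (u n) ∧ L1Bound (fun k => ‖wt k * (u (n + 1) k - u n k)‖) (η / 2 ^ n) ∧
      L1Bound (fun k => ‖wt k * (u n k - P k)‖) (2 * η - 2 * η / 2 ^ n) := by
    intro n
    induction n with
    | zero =>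
      refine ⟨hP, by simpa [hu] using hη, ?_⟩
      simp only [hu, Function.iterate_zero, id_eq, sub_self, mul_zero, norm_zero, pow_zero, div_one]
      intro s
      simp
    | succ n ih =>
      obtain ⟨h1, h2, h3⟩ := ih
      have h4 : RotInv (u (n + 1)) := by rw [hus]; exact hΨ _ h1
      have hpos : (0 : ℝ) ≤ 2 * η / 2 ^ n := by positivity
      have h5 : L1Bound (fun k => ‖wt k * (u (n + 1) k - P k)‖)
          (2 * η - 2 * η / 2 ^ (n + 1)) := tri h2 h3 (by rw [pow_succ]; apply le_of_eq; ring)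
      refine ⟨h4, ?_, h5⟩
      have hpos' : (0 : ℝ) ≤ 2 * η / 2 ^ (n + 1) := by positivity
      have h6 := hL (u (n + 1)) (u n) _ h4 h1 (h5.mono (fun _ => le_rfl) (by linarith))
        (h3.mono (fun _ => le_rfl) (by linarith)) h2
      rw [← hus, ← hus] at h6
      exact h6.mono (fun _ => le_rfl) (by rw [pow_succ]; apply le_of_eq; ring)
  have hcau : ∀ n j, L1Bound (fun k => ‖wt k * (u (n + j) k - u n k)‖) (2 * η / 2 ^ n) := by
    intro n j
    have : L1Bound (fun k => ‖wt k * (u (n + j) k - u n k)‖)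
        (2 * η / 2 ^ n - 2 * η / 2 ^ (n + j)) := by
      induction j with
      | zero =>
        simp only [add_zero, sub_self, mul_zero, norm_zero]
        intro s
        simp
      | succ j ih =>
        refine tri (key (n + j)).2.1 ih ?_
        rw [← add_assoc, pow_succ]
        apply le_of_eq; ring
    have hpos : (0 : ℝ) ≤ 2 * η / 2 ^ (n + j) := by positivity
    exact this.mono (fun _ => le_rfl) (by linarith)
  have hlim : ∀ k, ∃ y, Filter.Tendsto (fun n => wt k * u n k) Filter.atTop (nhds y) := fun k => by
    refine cauchySeq_tendsto_of_complete (cauchySeq_of_le_geometric_two (C := 2 * η) fun n => ?_)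
    rw [dist_comm, dist_eq_norm, ← mul_sub]
    exact ((key n).2.1.le k).trans (le_of_eq (by ring))
  choose y hy using hlim
  set U : quasilattice Q → A := fun k => wi k * y k with hU
  have hUlim : ∀ k, Filter.Tendsto (fun n => u n k) Filter.atTop (nhds (U k)) := fun k => by
    have := (hy k).const_mul (wi k)
    refine this.congr fun n => ?_
    rw [← mul_assoc, hw, one_mul]
  -- The limit is taken coefficientwise; bounds on finite partial sums pass to it.
  have htail : ∀ n, L1Bound (fun k => ‖wt k * (U k - u n k)‖) (2 * η / 2 ^ n) := by
    intro n s
    refine le_of_tendsto (x := Filter.atTop) (f := fun j => ∑ k ∈ s, ‖wt k * (u (n + j) k - u n k)‖)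
      (tendsto_finsetSum s fun k _ => ?_) (Filter.Eventually.of_forall fun j => hcau n j s)
    have h1 : Filter.Tendsto (fun j => u (n + j) k) Filter.atTop (nhds (U k)) := by
      simpa only [add_comm n] using (Filter.tendsto_add_atTop_iff_nat n).2 (hUlim k)
    exact ((h1.sub_const _).const_mul _).norm
  have hrot : RotInv U := fun k k' hk =>
    tendsto_nhds_unique (hUlim k')
      ((hUlim k).congr fun n => ((key n).1 k k' hk).symm)
  have hball : L1Bound (fun k => ‖wt k * (U k - P k)‖) (2 * η) := by
    have := htail 0
    simpa [hu] using this
  refine ⟨U, ?_, hrot, hball⟩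
  funext k
  -- Compare through Ψ uₙ = uₙ₊₁: each of the two distances is at most η/2ⁿ.
  have h1 : ∀ n : ℕ, ‖wt k * (Ψ U k - U k)‖ ≤ 2 * η * (1 / 2) ^ n := fun n => by
    have hpos : (0 : ℝ) ≤ 2 * η / 2 ^ n := by positivity
    have h2 := hL U (u n) _ hrot (key n).1 (hball.mono (fun _ => le_rfl) hηr)
      ((key n).2.2.mono (fun _ => le_rfl) (by linarith)) (htail n)
    rw [← hus] at h2
    have h3 : L1Bound (fun k => ‖wt k * (u (n + 1) k - U k)‖) (2 * η / 2 ^ (n + 1)) :=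
      (htail (n + 1)).mono (fun k => by rw [← norm_neg, ← mul_neg, neg_sub]) le_rfl
    refine ((tri h2 h3 le_rfl).le k).trans (le_of_eq ?_)
    rw [pow_succ, one_div, inv_pow]
    field_simp
    ring
  have h2 : ‖wt k * (Ψ U k - U k)‖ ≤ 0 := by
    refine ge_of_tendsto' (x := Filter.atTop) ?_ h1
    have := (tendsto_pow_atTop_nhds_zero_of_lt_one (r := (1 / 2 : ℝ)) (by norm_num)
      (by norm_num)).const_mul (2 * η)
    simpa using this
  have h3 := norm_le_zero_iff.1 h2
  have h4 : wi k * (wt k * (Ψ U k - U k)) = 0 := by rw [h3, mul_zero]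
  rwa [← mul_assoc, hw, one_mul, sub_eq_zero] at h4

end FixedPoint

/-! ### Duhamel's formula for one mode, in time-dependent weights. -/

section Duhamel

/-- Real continuous functions on `[0, T]`. -/
abbrev Path (T : ℝ) : Type := C(Set.Icc (0 : ℝ) T, ℝ)

/-- The extension of a path to `ℝ` by constants. -/
def Path.ext {T : ℝ} (hT : 0 ≤ T) (f : Path T) (t : ℝ) : ℝ := f (Set.projIcc 0 T hT t)

variable {T : ℝ} (hT : 0 ≤ T)

theorem Path.continuous_ext (f : Path T) : Continuous (f.ext hT) :=
  f.continuous.comp continuous_projIcc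

theorem Path.ext_of_mem (f : Path T) {t : ℝ} (ht : t ∈ Set.Icc 0 T) : f.ext hT t = f ⟨t, ht⟩ := by
  rw [Path.ext, Set.projIcc_of_mem hT ht]

theorem Path.ext_coe (f : Path T) (t : Set.Icc (0 : ℝ) T) : f.ext hT t = f t :=
  f.ext_of_mem hT t.2

/-- The solution of `x' = -a x + f`, `x(0) = x₀`. -/
def duhamelFun (a x₀ : ℝ) (f : Path T) (t : ℝ) : ℝ :=
  Real.exp (-a * t) * (x₀ + ∫ τ in (0 : ℝ)..t, Real.exp (a * τ) * f.ext hT τ)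

theorem hasDerivAt_duhamelFun (a x₀ : ℝ) (f : Path T) (t : ℝ) :
    HasDerivAt (duhamelFun hT a x₀ f) (-a * duhamelFun hT a x₀ f t + f.ext hT t) t := by
  have hc : Continuous fun τ => Real.exp (a * τ) * f.ext hT τ :=
    (by fun_prop : Continuous fun τ => Real.exp (a * τ)).mul (f.continuous_ext hT)
  have h1 : HasDerivAt (fun t => x₀ + ∫ τ in (0 : ℝ)..t, Real.exp (a * τ) * f.ext hT τ)
      (Real.exp (a * t) * f.ext hT t) t :=
    (intervalIntegral.integral_hasDerivAt_right (hc.intervalIntegrable _ _)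
      (hc.stronglyMeasurableAtFilter _ _) hc.continuousAt).const_add x₀
  have h2 : HasDerivAt (fun t => Real.exp (-a * t)) (Real.exp (-a * t) * -a) t := by
    simpa using ((hasDerivAt_id t).const_mul (-a)).exp
  refine (h2.mul h1).congr_deriv ?_
  have h3 : Real.exp (-a * t) * Real.exp (a * t) = 1 := by
    rw [← Real.exp_add]; simp
  unfold duhamelFun
  linear_combination f.ext hT t * h3

/-- The solution of `x' = -a x + f`, `x(0) = x₀`, as a path. -/
def duhamel (a x₀ : ℝ) (f : Path T) : Path T where
  toFun t := duhamelFun hT a x₀ f t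
  continuous_toFun := (continuous_iff_continuousAt.2 fun t =>
    (hasDerivAt_duhamelFun hT a x₀ f t).continuousAt).comp continuous_subtype_val

theorem duhamel_sub (a x₀ y₀ : ℝ) (f g : Path T) :
    duhamel hT a x₀ f - duhamel hT a y₀ g = duhamel hT a (x₀ - y₀) (f - g) := by
  ext t
  have hc : ∀ f : Path T, Continuous fun τ => Real.exp (a * τ) * f.ext hT τ := fun f =>
    (by fun_prop : Continuous fun τ => Real.exp (a * τ)).mul (f.continuous_ext hT)
  have h1 : ∫ τ in (0 : ℝ)..t, Real.exp (a * τ) * (f - g).ext hT τ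
      = (∫ τ in (0 : ℝ)..t, Real.exp (a * τ) * f.ext hT τ)
        - ∫ τ in (0 : ℝ)..t, Real.exp (a * τ) * g.ext hT τ := by
    rw [← intervalIntegral.integral_sub ((hc f).intervalIntegrable _ _)
      ((hc g).intervalIntegrable _ _)]
    refine intervalIntegral.integral_congr fun τ _ => ?_
    simp only [Path.ext, ContinuousMap.sub_apply]
    ring
  simp only [ContinuousMap.sub_apply, duhamel, ContinuousMap.coe_mk, duhamelFun, h1]
  ring

/-- A constant is stationary under the forcing a x. So the Picard map at a time-independent family
differs from it only through the initial value and the stationary residual. -/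
theorem duhamel_const (a x : ℝ) :
    duhamel hT a x (ContinuousMap.const _ (a * x)) = ContinuousMap.const _ x := by
  ext t
  have h1 : ∫ τ in (0 : ℝ)..t, Real.exp (a * τ) *
      Path.ext hT (ContinuousMap.const _ (a * x)) τ
      = Real.exp (a * t) * x - Real.exp (a * 0) * x := by
    refine intervalIntegral.integral_eq_sub_of_hasDerivAt (f := fun τ => Real.exp (a * τ) * x)
      (fun τ _ => ?_) (Continuous.intervalIntegrable
        ((by fun_prop : Continuous fun τ => Real.exp (a * τ)).mul (Path.continuous_ext hT _)) _ _)
    have := (((hasDerivAt_id τ).const_mul a).exp).mul_const x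
    refine this.congr_deriv ?_
    simp [Path.ext]
    ring
  simp only [duhamel, ContinuousMap.coe_mk, duhamelFun, h1, ContinuousMap.const_apply]
  have h3 : Real.exp (-a * t) * Real.exp (a * t) = 1 := by
    rw [← Real.exp_add]; simp
  simp only [mul_zero, Real.exp_zero, one_mul]
  linear_combination x * h3

/-- The weight `S exp (-b t)` as a path. -/
def expPath (T S b : ℝ) : Path T where
  toFun t := S * Real.exp (-b * t)
  continuous_toFun := by fun_prop

/-- `θ` bounds the integrals of `exp (-q (t - τ))` over the subintervals of `[0, T]`. -/
def DecayBound (T q θ : ℝ) : Prop := (0 < q ∧ 1 ≤ θ * q) ∨ (0 ≤ q ∧ T ≤ θ)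

theorem integral_exp_le {q θ t : ℝ} (h : DecayBound T q θ) (ht : t ∈ Set.Icc 0 T) :
    ∫ τ in (0 : ℝ)..t, Real.exp (q * τ) ≤ θ * Real.exp (q * t) := by
  rcases h with ⟨hq, h⟩ | ⟨hq, h⟩
  · have h1 : ∫ τ in (0 : ℝ)..t, Real.exp (q * τ) = Real.exp (q * t) / q - Real.exp (q * 0) / q := by
      refine intervalIntegral.integral_eq_sub_of_hasDerivAt (f := fun τ => Real.exp (q * τ) / q)
        (fun τ _ => ?_) (Continuous.intervalIntegrable (by fun_prop) _ _)
      refine ((((hasDerivAt_id τ).const_mul q).exp).div_const q).congr_deriv ?_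
      simp
      field_simp
    have h2 : 1 / q ≤ θ := by rwa [div_le_iff₀ hq]
    calc _ ≤ Real.exp (q * t) / q := by rw [h1]; simp; positivity
      _ = 1 / q * Real.exp (q * t) := by ring
      _ ≤ _ := by gcongr
  · calc ∫ τ in (0 : ℝ)..t, Real.exp (q * τ) ≤ ∫ τ in (0 : ℝ)..t, Real.exp (q * t) := by
          refine intervalIntegral.integral_mono_on ht.1
            (Continuous.intervalIntegrable (by fun_prop) _ _)
            (Continuous.intervalIntegrable (by fun_prop) _ _) fun τ hτ => ?_
          have := hτ.2
          gcongr
      _ = t * Real.exp (q * t) := by rw [intervalIntegral.integral_const]; simp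
      _ ≤ _ := by
          have := ht.2
          gcongr
          linarith

/-- A weight decaying like e^{-bt} acts as an additional damping b: the kernel becomes
e^{-(a+b)(t-τ)}, of integral at most θ. The rate a itself may be negative. -/
theorem norm_expPath_mul_duhamel_le {a b S θ : ℝ} (hS : 0 ≤ S) (h : DecayBound T (a + b) θ)
    (x₀ : ℝ) (f : Path T) :
    ‖expPath T S b * duhamel hT a x₀ f‖ ≤ S * |x₀| + θ * ‖expPath T S b * f‖ := by
  have hq : 0 ≤ a + b := by
    rcases h with h | h
    · exact h.1.le
    · exact h.1
  have hθ : 0 ≤ θ := by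
    rcases h with ⟨h1, h2⟩ | ⟨_, h2⟩
    · by_contra hn
      nlinarith
    · exact hT.trans h2
  refine (ContinuousMap.norm_le _ (by positivity)).2 fun t => ?_
  set n := ‖expPath T S b * f‖ with hn
  have hf : ∀ τ, S * Real.exp (-b * τ) * |f.ext hT τ| ≤ n ∨ τ ∉ Set.Icc 0 T := fun τ => by
    by_cases hτ : τ ∈ Set.Icc 0 T
    · left
      have h1 := (expPath T S b * f).norm_coe_le_norm ⟨τ, hτ⟩
      rw [f.ext_of_mem hT hτ]
      refine le_trans (le_of_eq ?_) h1
      rw [ContinuousMap.mul_apply, norm_mul, Real.norm_eq_abs, Real.norm_eq_abs]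
      congr 1
      exact (abs_of_nonneg (show 0 ≤ S * Real.exp (-b * τ) by positivity)).symm
    · exact Or.inr hτ
  have hc : Continuous fun τ => Real.exp (a * τ) * f.ext hT τ :=
    (by fun_prop : Continuous fun τ => Real.exp (a * τ)).mul (f.continuous_ext hT)
  have h1 : S * |∫ τ in (0 : ℝ)..t, Real.exp (a * τ) * f.ext hT τ|
      ≤ n * (θ * Real.exp ((a + b) * t)) := by
    calc S * |∫ τ in (0 : ℝ)..t, Real.exp (a * τ) * f.ext hT τ|
        ≤ S * ∫ τ in (0 : ℝ)..t, |Real.exp (a * τ) * f.ext hT τ| := by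
          gcongr
          exact intervalIntegral.abs_integral_le_integral_abs t.2.1
      _ = ∫ τ in (0 : ℝ)..t, S * |Real.exp (a * τ) * f.ext hT τ| := by
          rw [intervalIntegral.integral_const_mul]
      _ ≤ ∫ τ in (0 : ℝ)..t, n * Real.exp ((a + b) * τ) := by
          refine intervalIntegral.integral_mono_on t.2.1
            ((hc.abs.const_mul S).intervalIntegrable _ _)
            (Continuous.intervalIntegrable (by fun_prop) _ _) fun τ hτ => ?_
          have h2 := (hf τ).resolve_right (not_not.2 ⟨hτ.1, hτ.2.trans t.2.2⟩)
          rw [abs_mul, abs_of_pos (Real.exp_pos _)]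
          have h3 : Real.exp (a * τ) = Real.exp (-b * τ) * Real.exp ((a + b) * τ) := by
            rw [← Real.exp_add]; congr 1; ring
          calc S * (Real.exp (a * τ) * |f.ext hT τ|)
              = (S * Real.exp (-b * τ) * |f.ext hT τ|) * Real.exp ((a + b) * τ) := by
                rw [h3]; ring
            _ ≤ n * Real.exp ((a + b) * τ) := by gcongr
      _ = n * ∫ τ in (0 : ℝ)..t, Real.exp ((a + b) * τ) := by
          rw [intervalIntegral.integral_const_mul]
      _ ≤ _ := by
          gcongr
          exact integral_exp_le h t.2
  have hexp : Real.exp (-b * t) * Real.exp (-a * t) = Real.exp (-((a + b) * t)) := by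
    rw [← Real.exp_add]; congr 1; ring
  have hone : Real.exp (-((a + b) * t)) ≤ 1 := by
    rw [Real.exp_le_one_iff]
    have := mul_nonneg hq t.2.1
    linarith
  have hinv : Real.exp (-((a + b) * t)) * Real.exp ((a + b) * t) = 1 := by
    rw [← Real.exp_add]; simp
  rw [ContinuousMap.mul_apply, norm_mul, Real.norm_eq_abs, Real.norm_eq_abs]
  simp only [expPath, duhamel, ContinuousMap.coe_mk, duhamelFun]
  rw [abs_mul, abs_mul, abs_of_nonneg hS, abs_of_pos (Real.exp_pos _), abs_of_pos (Real.exp_pos _)]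
  set I := ∫ τ in (0 : ℝ)..t, Real.exp (a * τ) * f.ext hT τ with hI
  calc S * Real.exp (-b * t) * (Real.exp (-a * t) * |x₀ + I|)
      = Real.exp (-((a + b) * t)) * (S * |x₀ + I|) := by rw [← hexp]; ring
    _ ≤ Real.exp (-((a + b) * t)) * (S * (|x₀| + |I|)) := by
        gcongr
        exact abs_add_le _ _
    _ = Real.exp (-((a + b) * t)) * (S * |x₀|) + Real.exp (-((a + b) * t)) * (S * |I|) := by ring
    _ ≤ 1 * (S * |x₀|) + Real.exp (-((a + b) * t)) * (n * (θ * Real.exp ((a + b) * t))) := by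
        gcongr
    _ = S * |x₀| + θ * n := by linear_combination n * θ * hinv

end Duhamel
end
end SwiftHohenberg

namespace SwiftHohenberg
noncomputable section

/-! ### Time-dependent submultiplicative weights. -/

section PathWeights
variable {Q : ℕ} {A : Type*} [NormedCommRing A]

/-- A submultiplicative family of weights with values in a normed ring. -/
structure IsNormWeight (w : quasilattice Q → A) : Prop where
  norm_le : ∀ k x, ‖x‖ ≤ ‖w k * x‖
  norm_mul_le : ∀ p q r k : quasilattice Q, (p : ℂ) + q + r = k → ∀ x y z,
    ‖w k * (x * y * z)‖ ≤ ‖w p * x‖ * ‖w q * y‖ * ‖w r * z‖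

theorem IsNormWeight.summable {w : quasilattice Q → A} (hw : IsNormWeight w) {f : quasilattice Q → A}
    {a : ℝ} (hf : L1Bound (fun k => ‖w k * f k‖) a) : Summable fun k => ‖f k‖ :=
  Summable.of_nonneg_of_le (fun _ => norm_nonneg _) (fun k => hw.norm_le k (f k))
    (hf.summable fun _ => norm_nonneg _)

theorem IsNormWeight.l1Bound_conv3 [CompleteSpace A] {w : quasilattice Q → A} (hw : IsNormWeight w)
    {f g h : quasilattice Q → A} {a b c : ℝ} (hf : L1Bound (fun k => ‖w k * f k‖) a)
    (hg : L1Bound (fun k => ‖w k * g k‖) b) (hh : L1Bound (fun k => ‖w k * h k‖) c) :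
    L1Bound (fun k => ‖w k * conv3 f g h k‖) (a * b * c) := by
  have h0 : ∀ (f : quasilattice Q → A) k, 0 ≤ ‖w k * f k‖ := fun f k => norm_nonneg _
  refine (hf.conv3 hg hh (h0 f) (h0 g) (h0 h)).mono (fun k => ?_) le_rfl
  exact norm_mul_conv3_le (w k) (hw.summable hf) (hw.summable hg) (hw.summable hh)
    (hf.summable (h0 f)) (hg.summable (h0 g)) (hh.summable (h0 h)) (h0 f) (h0 g) (h0 h) k
    fun p q r hpqr => hw.norm_mul_le p q r k hpqr _ _ _

theorem L1Bound.norm_mul_add {w f g : quasilattice Q → A} {a b : ℝ}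
    (hf : L1Bound (fun k => ‖w k * f k‖) a) (hg : L1Bound (fun k => ‖w k * g k‖) b) :
    L1Bound (fun k => ‖w k * (f + g) k‖) (a + b) :=
  (hf.add hg).mono (fun k => by rw [Pi.add_apply, mul_add]; exact norm_add_le _ _) le_rfl

/-- The bound of a difference of cubes. -/
theorem IsNormWeight.l1Bound_cube_sub [CompleteSpace A] {w : quasilattice Q → A}
    (hw : IsNormWeight w) {U V : quasilattice Q → A} {B C : ℝ}
    (hU : L1Bound (fun k => ‖w k * U k‖) C) (hV : L1Bound (fun k => ‖w k * V k‖) C)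
    (hD : L1Bound (fun k => ‖w k * (U - V) k‖) B) :
    L1Bound (fun k => ‖w k * (conv3 U U U - conv3 V V V) k‖) (3 * C ^ 2 * B) := by
  rw [conv3_cube_sub (hw.summable hU) (hw.summable hV)]
  refine (((hw.l1Bound_conv3 hD hU hU).norm_mul_add (hw.l1Bound_conv3 hV hD hU)).norm_mul_add
    (hw.l1Bound_conv3 hV hV hD)).mono (fun _ => le_rfl) (le_of_eq (by ring))

variable {T : ℝ}

theorem expPath_apply (S b : ℝ) (t : Set.Icc (0 : ℝ) T) :
    expPath T S b t = S * Real.exp (-b * t) := rfl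

theorem expPath_nonneg {S b : ℝ} (hS : 0 ≤ S) (t : Set.Icc (0 : ℝ) T) : 0 ≤ expPath T S b t :=
  mul_nonneg hS (Real.exp_pos _).le

theorem isNormWeight_expPath {W b : quasilattice Q → ℝ} (hW : ∀ k, 0 < W k)
    (h1 : ∀ k, ∀ t ∈ Set.Icc 0 T, 1 ≤ W k * Real.exp (-b k * t))
    (h2 : ∀ p q r k : quasilattice Q, (p : ℂ) + q + r = k → ∀ t ∈ Set.Icc 0 T,
      W k * Real.exp (-b k * t) ≤ (W p * Real.exp (-b p * t)) * (W q * Real.exp (-b q * t)) *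
        (W r * Real.exp (-b r * t))) :
    IsNormWeight fun k => expPath T (W k) (b k) where
  norm_le k x := (ContinuousMap.norm_le _ (norm_nonneg _)).2 fun t => by
    refine le_trans ?_ ((expPath T (W k) (b k) * x).norm_coe_le_norm t)
    rw [ContinuousMap.mul_apply, norm_mul]
    refine le_mul_of_one_le_left (norm_nonneg _) ?_
    rw [Real.norm_of_nonneg (expPath_nonneg (hW k).le t)]
    exact h1 k t t.2
  norm_mul_le p q r k h x y z := (ContinuousMap.norm_le _ (by positivity)).2 fun t => by
    have e : ∀ (k : quasilattice Q) (x : Path T),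
        expPath T (W k) (b k) t * |x t| ≤ ‖expPath T (W k) (b k) * x‖ := fun k x => by
      refine le_trans (le_of_eq ?_) ((expPath T (W k) (b k) * x).norm_coe_le_norm t)
      rw [ContinuousMap.mul_apply, norm_mul, Real.norm_of_nonneg (expPath_nonneg (hW k).le t),
        Real.norm_eq_abs]
    have n := fun k => expPath_nonneg (T := T) (b := b k) (hW k).le t
    simp only [ContinuousMap.mul_apply]
    rw [norm_mul, Real.norm_of_nonneg (n k), norm_mul, norm_mul, Real.norm_eq_abs,
      Real.norm_eq_abs, Real.norm_eq_abs]
    calc expPath T (W k) (b k) t * (|x t| * |y t| * |z t|)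
        ≤ (expPath T (W p) (b p) t * expPath T (W q) (b q) t * expPath T (W r) (b r) t) *
          (|x t| * |y t| * |z t|) := by
          gcongr
          exact h2 p q r k h t t.2
      _ = (expPath T (W p) (b p) t * |x t|) * (expPath T (W q) (b q) t * |y t|) *
          (expPath T (W r) (b r) t * |z t|) := by ring
      _ ≤ _ := by
          have := mul_nonneg (n q) (abs_nonneg (y t))
          have := mul_nonneg (n r) (abs_nonneg (z t))
          have := mul_nonneg (n p) (abs_nonneg (x t))
          gcongr <;> apply e

end PathWeights

/-! ### The evolution of the coefficients as a fixed point. -/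

section MildSolution
variable {Q : ℕ} {T : ℝ} (hT : 0 ≤ T)

/-- The coefficients of the solution of the initial value problem, as functions of time. -/
structure IsCoeffSolution (μ : ℝ) (u₀ : quasilattice Q → ℝ) (U : quasilattice Q → Path T) :
    Prop where
  init : ∀ k, U k ⟨0, le_rfl, hT⟩ = u₀ k
  deriv : ∀ k, ∀ t : Set.Icc (0 : ℝ) T, HasDerivWithinAt (Path.ext hT (U k))
    (μ * U k t - symbol k * U k t - conv3 U U U k t) (Set.Icc 0 T) t

/-- The Picard map in the form of Duhamel, with the rates `a` and the shifts `g`. -/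
def picard (a g u₀ : quasilattice Q → ℝ) (U : quasilattice Q → Path T) : quasilattice Q → Path T :=
  fun k => duhamel hT (a k) (u₀ k) (g k • U k - conv3 U U U k)

theorem RotInv.picard (hQ : Q ≠ 0) {a g u₀ : quasilattice Q → ℝ} (ha : RotInv a) (hg : RotInv g)
    (hu : RotInv u₀) {U : quasilattice Q → Path T} (hU : RotInv U) :
    RotInv (picard hT a g u₀ U) := fun k k' hk => by
  unfold SwiftHohenberg.picard
  rw [ha k k' hk, hg k k' hk, hu k k' hk, hU k k' hk, hU.conv3 hQ hU hU k k' hk]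

/-- The shift g enters the rate and the forcing and cancels. It can thus be chosen to produce
damping on each mode and to cancel the linearized cube on the kernel. -/
theorem isCoeffSolution_of_picard_eq {μ : ℝ} {a g u₀ : quasilattice Q → ℝ}
    {U : quasilattice Q → Path T} (ha : ∀ k, a k = symbol k - μ + g k)
    (h : picard hT a g u₀ U = U) : IsCoeffSolution hT μ u₀ U where
  init k := by
    have h1 := congrFun h k
    rw [← h1]
    simp [picard, duhamel, duhamelFun]
  deriv k t := by
    have h1 := congrFun h k
    have h2 := (hasDerivAt_duhamelFun hT (a k) (u₀ k) (g k • U k - conv3 U U U k) t).hasDerivWithinAt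
      (s := Set.Icc 0 T)
    have h3 : ∀ s ∈ Set.Icc 0 T, Path.ext hT (U k) s
        = duhamelFun hT (a k) (u₀ k) (g k • U k - conv3 U U U k) s := fun s hs => by
      rw [Path.ext_of_mem hT _ hs, ← DFunLike.congr_fun h1 ⟨s, hs⟩]
      rfl
    refine (h2.congr h3 (h3 t t.2)).congr_deriv ?_
    rw [← h3 t t.2, Path.ext_coe, Path.ext_coe, ha k, ContinuousMap.sub_apply,
      ContinuousMap.smul_apply, smul_eq_mul]
    ring

theorem conv3_const {p : quasilattice Q → ℝ} (hp : Summable fun k => ‖p k‖) (k : quasilattice Q) :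
    conv3 (fun k => (ContinuousMap.const _ (p k) : Path T)) (fun k => ContinuousMap.const _ (p k))
      (fun k => ContinuousMap.const _ (p k)) k = ContinuousMap.const _ (conv3 p p p k) :=
  (map_conv3 (algebraMap ℝ (Path T)) (continuous_algebraMap ℝ (Path T)) hp hp hp k).symm

theorem norm_expPath_mul_const_le {S b : ℝ} (hS : 0 ≤ S) (hb : 0 ≤ b) (c : ℝ) :
    ‖expPath T S b * ContinuousMap.const _ c‖ ≤ S * |c| := by
  refine (ContinuousMap.norm_le _ (by positivity)).2 fun t => ?_
  rw [ContinuousMap.mul_apply, norm_mul, Real.norm_of_nonneg (expPath_nonneg hS t), expPath_apply]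
  refine mul_le_mul_of_nonneg_right ?_ (abs_nonneg _)
  refine mul_le_of_le_one_right hS (Real.exp_le_one_iff.2 ?_)
  have := mul_nonneg hb t.2.1
  linarith

theorem expPath_mul_inv {S b : ℝ} (hS : S ≠ 0) : expPath T S⁻¹ (-b) * expPath T S b = 1 := by
  ext t
  rw [ContinuousMap.mul_apply, expPath_apply, expPath_apply, ContinuousMap.one_apply]
  have : Real.exp (- -b * t) * Real.exp (-b * t) = 1 := by rw [← Real.exp_add]; simp
  linear_combination S⁻¹ * S * this + mul_inv_cancel₀ hS

/-- Contraction around the stationary family p. Its defect η consists of the distance to the initial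
value and of the residual of p multiplied by the inverse damping θ. -/
theorem exists_coeffSolution [NeZero Q] {μ : ℝ} {a b g S θ p u₀ : quasilattice Q → ℝ} {r η : ℝ}
    (hS : ∀ k, 0 < S k) (hb : ∀ k, 0 ≤ b k) (hθ : ∀ k, DecayBound T (a k + b k) (θ k))
    (ha : ∀ k, a k = symbol k - μ + g k) (hg : RotInv g) (hp : RotInv p) (hu : RotInv u₀)
    (hps : Summable fun k => ‖p k‖)
    (hL : ∀ (U V : quasilattice Q → Path T) (B : ℝ), RotInv U → RotInv V →
      L1Bound (fun k => ‖expPath T (S k) (b k) * (U k - ContinuousMap.const _ (p k))‖) r →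
      L1Bound (fun k => ‖expPath T (S k) (b k) * (V k - ContinuousMap.const _ (p k))‖) r →
      L1Bound (fun k => ‖expPath T (S k) (b k) * (U k - V k)‖) B →
      L1Bound (fun k => θ k * ‖expPath T (S k) (b k) *
        (g k • (U k - V k) - (conv3 U U U - conv3 V V V) k)‖) (B / 2))
    (hη : L1Bound (fun k => S k * |u₀ k - p k|
      + θ k * (S k * |symbol k * p k - μ * p k + conv3 p p p k|)) η) (hηr : 2 * η ≤ r) :
    ∃ U : quasilattice Q → Path T, RotInv U ∧ IsCoeffSolution hT μ u₀ U ∧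
      L1Bound (fun k => ‖expPath T (S k) (b k) * (U k - ContinuousMap.const _ (p k))‖) (2 * η) := by
  have hQ := NeZero.ne Q
  have harot : RotInv a := fun k k' hk => by rw [ha, ha, symbol_rotate hk, hg k k' hk]
  have hθ0 : ∀ k, 0 ≤ θ k := fun k => by
    rcases hθ k with ⟨h1, h2⟩ | ⟨_, h2⟩
    · by_contra hn
      nlinarith
    · exact hT.trans h2
  obtain ⟨U, h1, h2, h3⟩ := exists_fixedPoint
    (wt := fun k => expPath T (S k) (b k)) (wi := fun k => expPath T (S k)⁻¹ (-b k))
    (Ψ := picard hT a g u₀) (P := fun k => ContinuousMap.const _ (p k)) (r := r) (η := η)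
    (fun k => expPath_mul_inv (hS k).ne') (fun k k' hk => by simp only [hp k k' hk])
    (fun U hU => RotInv.picard hT hQ harot hg hu hU)
    (fun U V B hU hV hUr hVr hB => (hL U V B hU hV hUr hVr hB).mono (fun k => by
      unfold picard
      rw [duhamel_sub, sub_self]
      refine (norm_expPath_mul_duhamel_le hT (hS k).le (hθ k) _ _).trans (le_of_eq ?_)
      rw [abs_zero, mul_zero, zero_add, Pi.sub_apply, smul_sub]
      congr 3
      abel) le_rfl)
    (hη.mono (fun k => by
      unfold picard
      nth_rewrite 1 [← duhamel_const hT (a k) (p k)]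
      rw [duhamel_sub]
      refine (norm_expPath_mul_duhamel_le hT (hS k).le (hθ k) _ _).trans ?_
      refine add_le_add le_rfl (mul_le_mul_of_nonneg_left ?_ (hθ0 k))
      have h4 : g k • (ContinuousMap.const _ (p k) : Path T)
          - conv3 (fun k => (ContinuousMap.const _ (p k) : Path T))
            (fun k => ContinuousMap.const _ (p k)) (fun k => ContinuousMap.const _ (p k)) k
          - ContinuousMap.const _ (a k * p k)
          = ContinuousMap.const _ (-(symbol k * p k - μ * p k + conv3 p p p k)) := by
        rw [conv3_const hps]
        ext t
        simp only [ContinuousMap.sub_apply, ContinuousMap.smul_apply, ContinuousMap.const_apply,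
          smul_eq_mul, ha k]
        ring
      rw [h4]
      refine (norm_expPath_mul_const_le (hS k).le (hb k) _).trans (le_of_eq ?_)
      rw [abs_neg]) le_rfl) hηr
  exact ⟨U, h2, isCoeffSolution_of_picard_eq hT ha h1, h3⟩

end MildSolution
end
end SwiftHohenberg

namespace SwiftHohenberg
noncomputable section

/-! ### The cubic term near the leading pattern. -/

section Lipschitz
variable {Q : ℕ} {A : Type*} [NormedCommRing A] [NormedAlgebra ℝ A] [CompleteSpace A]

/-- The family of the constants of a real family. -/
def constFam (A : Type*) [NormedCommRing A] [NormedAlgebra ℝ A] (p : quasilattice Q → ℝ) :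
    quasilattice Q → A := fun k => algebraMap ℝ A (p k)

open Classical in
/-- The part of a family supported away from the basic wavevectors. -/
def offWaves (f : quasilattice Q → A) : quasilattice Q → A :=
  fun k => if IsWave Q k then 0 else f k

/-- The difference of two cubes, minus three times the action of `A₀²` on the kernel part. -/
def cubeRest (A₀ U V : quasilattice Q → A) : quasilattice Q → A :=
  conv3 (U - V) U (U - A₀) + conv3 (U - V) (U - A₀) A₀ + (conv3 (V - A₀) (U - V) U
    + conv3 A₀ (U - V) (U - A₀)) + (conv3 (V - A₀) V (U - V) + conv3 A₀ (V - A₀) (U - V))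
    + (conv3 (offWaves (U - V)) A₀ A₀ + conv3 (offWaves (U - V)) A₀ A₀
      + conv3 (offWaves (U - V)) A₀ A₀)

theorem conv3_kernel [NeZero Q] (he : Even Q) (a : ℝ) (d : A) {k : quasilattice Q}
    (hk : IsWave Q k) :
    conv3 (fun k => d * constFam A (leadR Q) k) (constFam A fun k => a * leadR Q k)
      (constFam A fun k => a * leadR Q k) k = (a ^ 2 * beta Q) • d := by
  have hs := (suppLe_leadR Q).summable_norm
  have hs1 : Summable fun k => ‖constFam A (leadR Q) k‖ :=
    ((suppLe_leadR Q).summable (fun _ x => ‖algebraMap ℝ A x‖) (by simp))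
  have hs2 : Summable fun k => ‖constFam A (fun k => a * leadR Q k) k‖ :=
    ((suppLe_leadR Q).summable (fun _ x => ‖algebraMap ℝ A (a * x)‖) (by simp))
  have hL : conv3 (constFam A (leadR Q)) (constFam A (leadR Q)) (constFam A (leadR Q)) k
      = algebraMap ℝ A (beta Q) := by
    rw [← conv3_leadR he hk]
    exact (map_conv3 (algebraMap ℝ A) (continuous_algebraMap ℝ A) hs hs hs k).symm
  have ha : (constFam A fun k => a * leadR Q k)
      = fun k => algebraMap ℝ A a * constFam A (leadR Q) k := by
    funext k
    exact map_mul _ _ _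
  rw [conv3_const_mul d hs1 hs2 hs2, ha]
  rw [ha] at hs2
  rw [conv3_rotate_args, conv3_const_mul _ hs1 hs2 hs1, conv3_rotate_args,
    conv3_const_mul _ hs1 hs1 hs1, hL, Algebra.smul_def]
  simp only [map_mul, map_pow]
  ring

/-- By rotation invariance U - V takes a single value on the basic wavevectors, on which 3A₀² acts
as 3a²β. Every term of `cubeRest` contains U - A₀, V - A₀ or the off-kernel part of U - V. -/
theorem cube_sub_eq [NeZero Q] (he : Even Q) (a : ℝ) {A₀ U V : quasilattice Q → A}
    (hA₀ : A₀ = constFam A fun k => a * leadR Q k) (hU : RotInv U) (hV : RotInv V)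
    (sU : Summable fun k => ‖U k‖) (sV : Summable fun k => ‖V k‖) {k : quasilattice Q}
    (hk : IsWave Q k) :
    (conv3 U U U - conv3 V V V) k
      = cubeRest A₀ U V k + (3 * (a ^ 2 * beta Q)) • (U k - V k) := by
  set d := U (unitPoint Q) - V (unitPoint Q) with hd
  have hker : ∀ k : quasilattice Q, IsWave Q k → U k - V k = d := fun k hk => by
    obtain ⟨j, hj⟩ := hk
    rw [hd, hU.apply_waveVector hj, hV.apply_waveVector hj]
  have hoff : offWaves (U - V) = (U - V) - fun k => d * constFam A (leadR Q) k := by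
    classical
    funext k
    by_cases h : IsWave Q k
    · simp [offWaves, h, constFam, leadR_wave h, hker k h]
    · simp [offWaves, h, constFam, leadR_not_wave h]
  have sA : Summable fun k => ‖A₀ k‖ := by
    rw [hA₀]
    exact ((suppLe_leadR Q).summable (fun _ x => ‖algebraMap ℝ A (a * x)‖) (by simp))
  have sL : Summable fun k => ‖d * constFam A (leadR Q) k‖ :=
    ((suppLe_leadR Q).summable (fun _ x => ‖d * algebraMap ℝ A x‖) (by simp))
  have sD : Summable fun k => ‖(U - V) k‖ :=
    Summable.of_nonneg_of_le (fun _ => norm_nonneg _) (fun k => norm_sub_le _ _) (sU.add sV)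
  have h1 := conv3_kernel (A := A) he a d hk
  rw [← hA₀] at h1
  have h2 : conv3 A₀ (U - V) A₀ = conv3 (U - V) A₀ A₀ := conv3_rotate_args _ _ _
  have h3 : conv3 A₀ A₀ (U - V) = conv3 (U - V) A₀ A₀ := by
    rw [conv3_rotate_args, h2]
  rw [conv3_cube_sub sU sV, cubeRest, hoff, conv3_sub₁ sD sL sA sA]
  rw [conv3_sub₃ sD sU sU sA, conv3_sub₂ sD sU sA sA, conv3_sub₁ sV sA sD sU,
    conv3_sub₃ sA sD sU sA, conv3_sub₁ sV sA sV sD, conv3_sub₂ sA sV sA sD, h2, h3]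
  simp only [Pi.add_apply, Pi.sub_apply]
  have h4 : (3 * (a ^ 2 * beta Q)) • d
      = (a ^ 2 * beta Q) • d + (a ^ 2 * beta Q) • d + (a ^ 2 * beta Q) • d := by
    rw [← add_smul, ← add_smul]
    congr 1
    ring
  rw [h1, hker k hk, h4]
  abel

/-- The Lipschitz estimate near `√(μ/β) ∑ⱼ exp (i kⱼ · x)` for the Picard map. -/
theorem lipschitz_near_leading [NeZero Q] (he : Even Q) {w wt : quasilattice Q → A}
    (hw : IsNormWeight w) {s g θ : quasilattice Q → ℝ} {a m a₀ ε δ κ B : ℝ} (hm : 0 < m)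
    (ham : a ^ 2 * beta Q = m ^ 2) (ha₀ : 0 ≤ a₀) (hε1 : ε ≤ 1) (hδ : 0 < δ)
    (hδ1 : δ ≤ 1) (hκ : 0 < κ) (hwt : ∀ k, wt k = s k • w k)
    (hs1 : ∀ k : quasilattice Q, IsWave Q k → s k = δ ∧ g k = 3 * m ^ 2 ∧ θ k = 1 / (2 * m ^ 2))
    (hs2 : ∀ k : quasilattice Q, ¬ IsWave Q k → s k = 1 ∧ g k = m ^ 2 ∧ θ k = 1 / (κ * m ^ 2))
    (hκδ : 8 * (1 + 3 * (a₀ + 2) ^ 2) ≤ κ * δ) (hεa : 48 * ε * (a₀ + 2) ≤ 1)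
    (hδa : 6 * δ * a₀ ^ 2 ≤ 1) {A₀ U V : quasilattice Q → A}
    (hA₀ : A₀ = constFam A fun k => a * leadR Q k) (hA : L1Bound (fun k => ‖w k * A₀ k‖) (a₀ * m))
    (hU : RotInv U) (hV : RotInv V) (hUA : L1Bound (fun k => ‖w k * (U - A₀) k‖) (2 * ε * m))
    (hVA : L1Bound (fun k => ‖w k * (V - A₀) k‖) (2 * ε * m))
    (hB : L1Bound (fun k => ‖wt k * (U - V) k‖) B) :
    L1Bound (fun k => θ k * ‖wt k * (g k • (U k - V k) - (conv3 U U U - conv3 V V V) k)‖)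
      (B / 2) := by
  classical
  have hB0 := hB.nonneg
  set C := a₀ + 2 with hC
  have hC0 : 0 < C := by positivity
  have hbig : ∀ {U : quasilattice Q → A}, L1Bound (fun k => ‖w k * (U - A₀) k‖) (2 * ε * m) →
      L1Bound (fun k => ‖w k * U k‖) (C * m) := fun hUA => by
    refine (hUA.norm_mul_add hA).mono (fun k => ?_) ?_
    · simp
    · rw [hC]; nlinarith
  have hwU := hbig hUA
  have hwV := hbig hVA
  have hwA : L1Bound (fun k => ‖w k * A₀ k‖) (C * m) :=
    hA.mono (fun _ => le_rfl) (by rw [hC]; nlinarith)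
  -- In the norm `wt` the kernel modes carry the factor δ and the others 1. The full difference
  -- costs 1/δ, which a large κ pays for off the kernel, whereas its off-kernel part costs nothing.
  have hD : L1Bound (fun k => ‖w k * (U - V) k‖) (B / δ) := by
    refine (hB.const_mul (show 0 ≤ δ⁻¹ by positivity)).mono (fun k => ?_)
      (le_of_eq (by rw [div_eq_inv_mul]))
    have h1 : δ ≤ s k := by
      by_cases h : IsWave Q k
      · exact (hs1 k h).1.ge
      · exact (hs2 k h).1 ▸ hδ1
    rw [hwt, smul_mul_assoc, norm_smul, Real.norm_of_nonneg (hδ.le.trans h1), ← mul_assoc]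
    refine le_mul_of_one_le_left (norm_nonneg _) ?_
    rw [← div_eq_inv_mul, one_le_div hδ]
    exact h1
  have hD' : L1Bound (fun k => ‖w k * offWaves (U - V) k‖) B := by
    refine hB.mono (fun k => ?_) le_rfl
    by_cases h : IsWave Q k
    · simp [offWaves, h]
    · simp [offWaves, h, hwt, (hs2 k h).1]
  have hX := hw.l1Bound_cube_sub hwU hwV hD
  have hY : L1Bound (fun k => ‖w k * cubeRest A₀ U V k‖)
      (12 * ε * C * m ^ 2 * (B / δ) + 3 * B * a₀ ^ 2 * m ^ 2) := by
    have e1 := hw.l1Bound_conv3 hD hwU hUA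
    have e2 := hw.l1Bound_conv3 hD hUA hwA
    have e3 := hw.l1Bound_conv3 hVA hD hwU
    have e4 := hw.l1Bound_conv3 hwA hD hUA
    have e5 := hw.l1Bound_conv3 hVA hwV hD
    have e6 := hw.l1Bound_conv3 hwA hVA hD
    have e7 := hw.l1Bound_conv3 hD' hA hA
    refine ((((e1.norm_mul_add e2).norm_mul_add (e3.norm_mul_add e4)).norm_mul_add
      (e5.norm_mul_add e6)).norm_mul_add ((e7.norm_mul_add e7).norm_mul_add e7)).mono
      (fun _ => le_rfl) (le_of_eq (by ring))
  have hsum := (((hD.const_mul (show 0 ≤ m ^ 2 by positivity)).add hX).const_mul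
    (show 0 ≤ 1 / (κ * m ^ 2) by positivity)).add
    (hY.const_mul (show 0 ≤ δ / (2 * m ^ 2) by positivity))
  refine hsum.mono (fun k => ?_) ?_
  · by_cases h : IsWave Q k
    · obtain ⟨h1, h2, h3⟩ := hs1 k h
      refine le_add_of_nonneg_of_le (by positivity) ?_
      rw [cube_sub_eq he a hA₀ hU hV (hw.summable hwU) (hw.summable hwV) h, h2, h3, ham, hwt, h1]
      rw [sub_add_cancel_right, mul_neg, norm_neg, smul_mul_assoc, norm_smul,
        Real.norm_of_nonneg hδ.le]
      apply le_of_eq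
      ring
    · obtain ⟨h1, h2, h3⟩ := hs2 k h
      refine le_add_of_le_of_nonneg ?_ (by positivity)
      rw [h2, h3, hwt, h1, one_smul]
      refine mul_le_mul_of_nonneg_left ?_ (by positivity)
      rw [mul_sub]
      refine (norm_sub_le _ _).trans (add_le_add (le_of_eq ?_) le_rfl)
      rw [mul_smul_comm, norm_smul, Real.norm_of_nonneg (by positivity), Pi.sub_apply]
  -- The off-kernel equations give at most B/8 by the size of κδ. The kernel equations give B/8 by
  -- the smallness of ε and B/4 by that of δ. The total is B/2.
  · have e1 : 1 / (κ * m ^ 2) * (m ^ 2 * (B / δ) + 3 * (C * m) ^ 2 * (B / δ))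
        = (1 + 3 * C ^ 2) / (κ * δ) * B := by field_simp
    have e2 : δ / (2 * m ^ 2) * (12 * ε * C * m ^ 2 * (B / δ) + 3 * B * a₀ ^ 2 * m ^ 2)
        = 6 * ε * C * B + 3 / 2 * δ * a₀ ^ 2 * B := by field_simp; ring
    have e3 : (1 + 3 * C ^ 2) / (κ * δ) ≤ 1 / 8 := by
      rw [div_le_iff₀ (by positivity)]; linarith
    rw [e1, e2]
    have e4 : 6 * ε * C ≤ 1 / 8 := by linarith
    have e5 : 3 / 2 * δ * a₀ ^ 2 ≤ 1 / 4 := by linarith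
    nlinarith [mul_le_mul_of_nonneg_right e3 hB0, mul_le_mul_of_nonneg_right e4 hB0,
      mul_le_mul_of_nonneg_right e5 hB0]

end Lipschitz
end
end SwiftHohenberg

namespace SwiftHohenberg
noncomputable section

/-! ### Evolution for small ν: shrinking weights and damping. -/

section SmallParameter
variable {Q : ℕ} {T : ℝ}

/-- The weight at time `0`. -/
def shrinkWeight (Q : ℕ) (ρ M : ℝ) (k : quasilattice Q) : ℝ :=
  Real.exp (ρ / 2 * order Q k + ρ / 2 * min (order Q k : ℝ) M)

/-- The rate of decay of the weight. -/
def shrinkRate (Q : ℕ) (σ M : ℝ) (k : quasilattice Q) : ℝ := σ * min (order Q k : ℝ) M / M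

theorem shrinkWeight_mul_exp {ρ M σ : ℝ} (k : quasilattice Q) (t : ℝ) :
    shrinkWeight Q ρ M k * Real.exp (-shrinkRate Q σ M k * t)
      = Real.exp (ρ / 2 * order Q k + (ρ / 2 - σ * t / M) * min (order Q k : ℝ) M) := by
  unfold shrinkWeight shrinkRate
  rw [← Real.exp_add]
  congr 1
  ring

theorem shrink_nonneg {ρ M σ : ℝ} (hσ : 0 ≤ σ) (hM : 0 < M) (hT : σ * T / M ≤ ρ / 2) {t : ℝ}
    (ht : t ∈ Set.Icc 0 T) : 0 ≤ ρ / 2 - σ * t / M := by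
  have : σ * t / M ≤ σ * T / M := by
    have := ht.2
    gcongr
  linarith

/-- The truncated order min(N, M) is still subadditive, and its coefficient ρ/2 - σt/M stays
nonnegative up to time T. -/
theorem isNormWeight_shrink {ρ M σ : ℝ} (hρ : 0 ≤ ρ) (hσ : 0 ≤ σ) (hM : 0 < M)
    (hT : σ * T / M ≤ ρ / 2) :
    IsNormWeight fun k => expPath T (shrinkWeight Q ρ M k) (shrinkRate Q σ M k) := by
  refine isNormWeight_expPath (fun k => Real.exp_pos _) (fun k t ht => ?_)
    fun p q r k h t ht => ?_
  · have h1 := shrink_nonneg hσ hM hT ht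
    rw [shrinkWeight_mul_exp]
    exact Real.one_le_exp (by positivity)
  · have h1 := shrink_nonneg hσ hM hT ht
    simp only [shrinkWeight_mul_exp]
    rw [← Real.exp_add, ← Real.exp_add, Real.exp_le_exp]
    have h2 : (order Q k : ℝ) ≤ order Q p + order Q q + order Q r := by
      exact_mod_cast order_le_of_sum_eq h
    have h3 : min (order Q k : ℝ) M
        ≤ min (order Q p : ℝ) M + min (order Q q : ℝ) M + min (order Q r : ℝ) M := by
      have hp : (0 : ℝ) ≤ order Q p := Nat.cast_nonneg _
      have hq : (0 : ℝ) ≤ order Q q := Nat.cast_nonneg _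
      have hr : (0 : ℝ) ≤ order Q r := Nat.cast_nonneg _
      rcases le_total (order Q p : ℝ) M with a | a <;> rcases le_total (order Q q : ℝ) M with b | b <;>
        rcases le_total (order Q r : ℝ) M with c | c <;>
        simp only [min_eq_left, min_eq_right, a, b, c] <;>
        first
        | exact (min_le_left _ _).trans h2
        | exact (min_le_right _ _).trans (by linarith)
    have h4 := mul_le_mul_of_nonneg_left h2 (show 0 ≤ ρ / 2 by positivity)
    have h5 := mul_le_mul_of_nonneg_left h3 h1
    linarith

theorem shrinkWeight_le {ρ M : ℝ} (hρ : 0 ≤ ρ) (k : quasilattice Q) :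
    shrinkWeight Q ρ M k ≤ expWeight Q ρ k := by
  unfold shrinkWeight expWeight
  rw [Real.exp_le_exp]
  have := mul_le_mul_of_nonneg_left (min_le_left (order Q k : ℝ) M) (show 0 ≤ ρ / 2 by positivity)
  linarith

/-- The weight exp(ρN/2) survives the shrinking at all times up to T; the final estimate is made in
it. -/
theorem expWeight_mul_norm_le {ρ M σ : ℝ} (hσ : 0 ≤ σ) (hM : 0 < M)
    (hT : σ * T / M ≤ ρ / 2) (k : quasilattice Q) (x : Path T) :
    expWeight Q (ρ / 2) k * ‖x‖
      ≤ ‖expPath T (shrinkWeight Q ρ M k) (shrinkRate Q σ M k) * x‖ := by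
  have hpos : 0 < expWeight Q (ρ / 2) k := Real.exp_pos _
  rw [← le_div_iff₀' hpos]
  refine (ContinuousMap.norm_le _ (by positivity)).2 fun t => ?_
  rw [le_div_iff₀' hpos]
  refine le_trans ?_ (ContinuousMap.norm_coe_le_norm _ t)
  rw [ContinuousMap.mul_apply, norm_mul]
  refine mul_le_mul_of_nonneg_right ?_ (norm_nonneg _)
  rw [Real.norm_of_nonneg (expPath_nonneg (show 0 ≤ shrinkWeight Q ρ M k from (Real.exp_pos _).le) t),
    expPath_apply, shrinkWeight_mul_exp, expWeight, Real.exp_le_exp]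
  have := shrink_nonneg hσ hM hT t.2
  have : 0 ≤ (ρ / 2 - σ * t / M) * min (order Q k : ℝ) M := by positivity
  linarith

/-- The damping by the linear operator and by the decay of the weight. -/
theorem damping_le (hQ : 3 ≤ Q) [NeZero Q] (he : Even Q) (hl : 1 ≤ ell Q) {κ a ν : ℝ} (hκ : 1 ≤ κ)
    (ha : 0 < a) (haκ : 2 * a ^ 2 * κ = 1) (hν : 0 < ν) (hνa : ν ≤ a) {k : quasilattice Q}
    (hk : ¬ IsWave Q k) :
    κ * ν ^ (4 * ell Q) ≤ symbol k + shrinkRate Q (κ * ν ^ (4 * ell Q)) (a / ν) k := by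
  have hM : 0 < a / ν := by positivity
  have hr : 0 ≤ shrinkRate Q (κ * ν ^ (4 * ell Q)) (a / ν) k := by
    unfold shrinkRate; positivity
  -- At orders above a/ν the weight decays at its full rate κν^{4l}. Below, the symbol must provide
  -- the damping.
  rcases le_total (a / ν) (order Q k : ℝ) with h | h
  · have h1 : shrinkRate Q (κ * ν ^ (4 * ell Q)) (a / ν) k = κ * ν ^ (4 * ell Q) := by
      unfold shrinkRate
      rw [min_eq_right h]
      field_simp
    have := symbol_nonneg (k : ℂ)
    linarith
  · have h1 := small_divisor hQ k.2 (fun h => hk ((isWave_iff he k).2 h))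
    -- Both 1 and N² are at most (a/ν)², and 2a²/ν² = 1/(κν²) by the choice of a. Hence the symbol
    -- is at least (κν²)^{2l} ≥ κν^{4l}, as κ ≥ 1.
    have h2 : (1 + (order Q k : ℝ) ^ 2) ≤ (κ * ν ^ 2)⁻¹ := by
      have e1 : (κ * ν ^ 2)⁻¹ = 2 * (a / ν) ^ 2 := by
        have : κ = 1 / (2 * a ^ 2) := by field_simp; linarith
        rw [this]; field_simp
      have e2 : 1 ≤ a / ν := by rwa [one_le_div hν]
      have e3 : (order Q k : ℝ) ^ 2 ≤ (a / ν) ^ 2 := by gcongr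
      have e4 : 1 ≤ (a / ν) ^ 2 := one_le_pow₀ e2
      rw [e1]; linarith
    have h3 : (κ * ν ^ 2) ^ (2 * ell Q) ≤ symbol k := by
      have e1 : 1 ≤ symbol k * ((κ * ν ^ 2)⁻¹) ^ (2 * ell Q) :=
        h1.trans (mul_le_mul_of_nonneg_left (pow_le_pow_left₀ (by positivity) h2 _)
          (symbol_nonneg _))
      rw [inv_pow, ← div_eq_mul_inv, one_le_div (by positivity)] at e1
      exact e1
    have h4 : κ * ν ^ (4 * ell Q) ≤ (κ * ν ^ 2) ^ (2 * ell Q) := by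
      rw [mul_pow, ← pow_mul, ← mul_assoc]
      norm_num
      refine mul_le_mul_of_nonneg_right ?_ (by positivity)
      exact le_self_pow₀ hκ (by omega)
    linarith

theorem l1Bound_shrink_const {ρ M σ B : ℝ} (hρ : 0 ≤ ρ) (hσ : 0 ≤ σ) (hM : 0 < M)
    {p : quasilattice Q → ℝ} (hp : L1Bound (fun k => expWeight Q ρ k * ‖p k‖) B) :
    L1Bound (fun k => ‖expPath T (shrinkWeight Q ρ M k) (shrinkRate Q σ M k)
      * constFam (Path T) p k‖) B :=
  hp.mono (fun k => (norm_expPath_mul_const_le (Real.exp_pos _).le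
    (by unfold shrinkRate; positivity) (p k)).trans
      (mul_le_mul_of_nonneg_right (shrinkWeight_le hρ k) (abs_nonneg _))) le_rfl

theorem expPath_smul (s S b : ℝ) : expPath T (s * S) b = s • expPath T S b := by
  ext t
  simp [expPath_apply, mul_assoc]

theorem exp_neg_div_le {c ν : ℝ} (hc : 0 < c) (hν : 0 < ν) (j : ℕ) :
    Real.exp (-c / ν) ≤ j.factorial / c ^ j * ν ^ j := by
  have h1 := Real.pow_div_factorial_le_exp (c / ν) (by positivity) j
  rw [neg_div, Real.exp_neg]
  have h2 : (j.factorial : ℝ) / c ^ j * ν ^ j = ((c / ν) ^ j / j.factorial)⁻¹ := by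
    rw [div_pow]; field_simp
  rw [h2]
  exact inv_anti₀ (by positivity) h1

set_option maxHeartbeats 1000000 in
open Classical in
/-- The solution for small values of the parameter. -/
theorem exists_coeffSolution_small [NeZero Q] (hQ : 8 ≤ Q) (he : Even Q) {ρ γ R c : ℝ}
    (hρ : 0 < ρ) (hc : 0 < c) (hcR : c < R) (hγ : 0 ≤ γ) (hG : GevreyL1 Q (formalSeq Q) ρ γ R) :
    ∃ α ν₀ C : ℝ, 0 < α ∧ 0 < ν₀ ∧ 0 < C ∧ ∀ ν : ℝ, 0 < ν → ν ≤ ν₀ → ∀ (T : ℝ) (hT : 0 ≤ T),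
      T * (ν ^ (4 * ell Q) * ν) ≤ α → ∃ U : quasilattice Q → Path T, RotInv U ∧
        IsCoeffSolution hT (ν ^ (4 * ell Q)) (patternR Q c ν) U ∧
        L1Bound (fun k => expWeight Q (ρ / 2) k * ‖U k - ContinuousMap.const _ (patternR Q c ν k)‖)
          (C * Real.exp (-c / ν)) := by
  have hl := one_le_ell hQ he
  have hl' : (1 : ℝ) ≤ ell Q := by exact_mod_cast hl
  have hβ := beta_pos (show 2 ≤ Q by omega)
  have hR : 0 < R := hc.trans hcR
  obtain ⟨C₁, hC₁, hdiff⟩ := exists_l1Bound_patternR_sub hl hρ.le hc hcR hγ hG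
  obtain ⟨C₂, hC₂, hres⟩ := exists_l1Bound_residual (by omega) he hl hρ.le hc hcR hγ hG
  obtain ⟨C₃, hC₃, hlead⟩ := exists_l1Bound_partialPattern_sub hl hc hcR hγ hG
  -- The leading term has norm at most a₀ m with m = ν^{2l}: there are Q basic wavevectors, of order
  -- at most 1. Then δ and ε are fixed from a₀, and κ last since it depends on δ.
  set a₀ : ℝ := Real.exp ρ * Q / Real.sqrt (beta Q) with ha₀
  have ha₀0 : 0 ≤ a₀ := by positivity
  set δ : ℝ := min 1 (1 / (6 * a₀ ^ 2 + 1)) with hδ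
  have hδ0 : 0 < δ := lt_min one_pos (by positivity)
  have hδ1 : δ ≤ 1 := min_le_left _ _
  have hδa : 6 * δ * a₀ ^ 2 ≤ 1 := by
    have h1 : δ ≤ 1 / (6 * a₀ ^ 2 + 1) := min_le_right _ _
    rw [le_div_iff₀ (by positivity)] at h1
    linarith
  set ε : ℝ := 1 / (48 * (a₀ + 2)) with hε
  have hε0 : 0 < ε := by positivity
  have hε1 : ε ≤ 1 := by rw [hε, div_le_one (by positivity)]; linarith
  have hεa : 48 * ε * (a₀ + 2) ≤ 1 := by rw [hε]; apply le_of_eq; field_simp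
  set κ : ℝ := 8 * (1 + 3 * (a₀ + 2) ^ 2) / δ with hκ
  have hκ1 : 1 ≤ κ := by
    rw [hκ, one_le_div hδ0]
    linarith [sq_nonneg (a₀ + 2)]
  have hκ0 : 0 < κ := by linarith
  have hκδ : 8 * (1 + 3 * (a₀ + 2) ^ 2) ≤ κ * δ := by
    rw [hκ, div_mul_cancel₀ _ hδ0.ne']
  set a₁ : ℝ := Real.sqrt (1 / (2 * κ)) with ha₁
  have ha₁0 : 0 < a₁ := Real.sqrt_pos.2 (by positivity)
  have ha₁κ : 2 * a₁ ^ 2 * κ = 1 := by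
    rw [ha₁, Real.sq_sqrt (by positivity)]; field_simp
  -- e^{-c/ν} is compared with ν^{2l+1} = νm, one power of ν smaller than the radius δεm of the
  -- ball.
  set j := 2 * ell Q + 1 with hj
  set C₅ : ℝ := 2 * (C₁ + C₂) * (j.factorial / c ^ j) with hC₅
  have hC₅0 : 0 < C₅ := by positivity
  -- The value of α is the condition κμT · ν/a₁ ≤ ρ/2, i.e. σT/M ≤ ρ/2. In the constant, 1/δ comes
  -- from dropping the kernel factor and the last C₁ from returning from P to the approximate
  -- pattern.
  refine ⟨ρ * a₁ / (2 * κ),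
    min (min 1 a₁) (min ((R - c) / (8 * ell Q)) (min (ε / C₃) (δ * ε / C₅))),
    2 * (C₁ + C₂) / δ + C₁, by positivity, ?_, by positivity, ?_⟩
  · have : 0 < R - c := by linarith
    refine lt_min (lt_min one_pos ha₁0) (lt_min (by positivity) (lt_min ?_ ?_)) <;> positivity
  intro ν hν hν₀ T hT hTα
  have hν1 : ν ≤ 1 := hν₀.trans ((min_le_left _ _).trans (min_le_left _ _))
  have hνa : ν ≤ a₁ := hν₀.trans ((min_le_left _ _).trans (min_le_right _ _))
  have hνR : 8 * ell Q * ν ≤ R - c := by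
    have := hν₀.trans ((min_le_right _ _).trans (min_le_left _ _))
    rw [le_div_iff₀ (by positivity)] at this
    linarith
  have hνε : C₃ * ν ≤ ε := by
    have := hν₀.trans ((min_le_right _ _).trans ((min_le_right _ _).trans (min_le_left _ _)))
    rw [le_div_iff₀ hC₃] at this
    linarith
  have hνδ : C₅ * ν ≤ δ * ε := by
    have := hν₀.trans ((min_le_right _ _).trans ((min_le_right _ _).trans (min_le_right _ _)))
    rw [le_div_iff₀ hC₅0] at this
    linarith
  set m := ν ^ (2 * ell Q) with hm
  have hm0 : 0 < m := by positivity
  have hμm : ν ^ (4 * ell Q) = m ^ 2 := by rw [hm, ← pow_mul]; congr 1; ring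
  set μ := ν ^ (4 * ell Q) with hμ
  have hμ0 : 0 < μ := by positivity
  set E := Real.exp (-c / ν) with hE
  have hE0 : 0 < E := Real.exp_pos _
  set M := a₁ / ν with hM
  have hM0 : 0 < M := by positivity
  set σ := κ * μ with hσ
  have hσ0 : 0 ≤ σ := by positivity
  have hTσ : σ * T / M ≤ ρ / 2 := by
    rw [hσ, hM, div_le_iff₀ (by positivity)]
    rw [le_div_iff₀ (by positivity)] at hTα
    have : κ * μ * T * ν ≤ ρ / 2 * a₁ := by linarith
    calc κ * μ * T = κ * μ * T * ν / ν := by field_simp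
      _ ≤ ρ / 2 * a₁ / ν := by gcongr
      _ = _ := by ring
  set w : quasilattice Q → Path T :=
    fun k => expPath T (shrinkWeight Q ρ M k) (shrinkRate Q σ M k) with hw
  have hwN : IsNormWeight w := isNormWeight_shrink hρ.le hσ0 hM0 hTσ
  set s : quasilattice Q → ℝ := fun k => if IsWave Q k then δ else 1 with hs
  set g : quasilattice Q → ℝ := fun k => if IsWave Q k then 3 * m ^ 2 else m ^ 2 with hg
  set θ : quasilattice Q → ℝ :=
    fun k => if IsWave Q k then 1 / (2 * m ^ 2) else 1 / (κ * m ^ 2) with hθ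
  have hs1 : ∀ k : quasilattice Q, IsWave Q k → s k = δ ∧ g k = 3 * m ^ 2 ∧ θ k = 1 / (2 * m ^ 2) :=
    fun k hk => ⟨if_pos hk, if_pos hk, if_pos hk⟩
  have hs2 : ∀ k : quasilattice Q, ¬ IsWave Q k →
      s k = 1 ∧ g k = m ^ 2 ∧ θ k = 1 / (κ * m ^ 2) :=
    fun k hk => ⟨if_neg hk, if_neg hk, if_neg hk⟩
  have hsδ : ∀ k, δ ≤ s k := fun k => by
    by_cases h : IsWave Q k
    · exact (hs1 k h).1.ge
    · exact (hs2 k h).1 ▸ hδ1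
  have hs01 : ∀ k, s k ≤ 1 := fun k => by
    by_cases h : IsWave Q k
    · exact (hs1 k h).1 ▸ hδ1
    · exact (hs2 k h).1.le
  have hs0 : ∀ k, 0 < s k := fun k => hδ0.trans_le (hsδ k)
  have hwt : ∀ k, expPath T (s k * shrinkWeight Q ρ M k) (shrinkRate Q σ M k) = s k • w k :=
    fun k => expPath_smul _ _ _
  set P := partialPattern Q ν (truncIndex Q ((c + R) / 2) ν) with hP
  have hdiff' := hdiff ν hν hνR
  have hres' := hres ν hν hν1 P hP
  have hlead' := hlead ν hν
  rw [← hP] at hdiff' hlead'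
  have hPs : SuppLe P (2 * truncIndex Q ((c + R) / 2) ν + 1) := fun k hk => by
    refine Finset.sum_eq_zero fun n hn => ?_
    rw [suppLe_formalSeq n k (by have := Finset.mem_range.1 hn; omega), mul_zero]
  set A₀ : quasilattice Q → Path T :=
    constFam (Path T) fun k => m / Real.sqrt (beta Q) * leadR Q k with hA₀
  have hA : L1Bound (fun k => ‖w k * A₀ k‖) (a₀ * m) := by
    have h1 : L1Bound (fun k => expWeight Q ρ k * ‖m / Real.sqrt (beta Q) * leadR Q k‖)
        (a₀ * m) := by
      have h2 := ((suppLe_leadR Q).l1Bound_expWeight hρ.le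
        (l1Bound_leadR (NeZero.ne Q))).norm_const_mul (m / Real.sqrt (beta Q))
      refine h2.mono (fun _ => le_rfl) (le_of_eq ?_)
      rw [abs_of_nonneg (by positivity), ha₀]
      push_cast
      ring_nf
    exact l1Bound_shrink_const hρ.le hσ0 hM0 h1
  have hPA : L1Bound (fun k => ‖w k * (constFam (Path T) P - A₀) k‖) (ε * m) := by
    have h1 : L1Bound (fun k => expWeight Q ρ k * ‖P k - m / Real.sqrt (beta Q) * leadR Q k‖)
        (ε * m) := hlead'.mono (fun _ => le_rfl) (by
        have := mul_le_mul_of_nonneg_right hνε hm0.le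
        change C₃ * m * ν ≤ ε * m
        linarith)
    refine (l1Bound_shrink_const (T := T) hρ.le hσ0 hM0 h1).mono (fun k => le_of_eq ?_) le_rfl
    simp only [hw, hA₀, Pi.sub_apply, constFam, map_sub]
  have hball : ∀ {U : quasilattice Q → Path T} {B : ℝ},
      L1Bound (fun k => ‖expPath T (s k * shrinkWeight Q ρ M k) (shrinkRate Q σ M k) *
        (U k - ContinuousMap.const _ (P k))‖) B →
      L1Bound (fun k => ‖w k * (U - constFam (Path T) P) k‖) (B / δ) := fun {U B} hU => by
    refine (hU.const_mul (show 0 ≤ δ⁻¹ by positivity)).mono (fun k => ?_)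
      (le_of_eq (by rw [div_eq_inv_mul]))
    rw [hwt, smul_mul_assoc, norm_smul, Real.norm_of_nonneg (hs0 k).le, ← mul_assoc]
    refine le_mul_of_one_le_left (norm_nonneg _) ?_
    rw [← div_eq_inv_mul, one_le_div hδ0]
    exact hsδ k
  have hballA : ∀ {U : quasilattice Q → Path T},
      L1Bound (fun k => ‖expPath T (s k * shrinkWeight Q ρ M k) (shrinkRate Q σ M k) *
        (U k - ContinuousMap.const _ (P k))‖) (δ * ε * m) →
      L1Bound (fun k => ‖w k * (U - A₀) k‖) (2 * ε * m) := fun {U} hU => by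
    refine ((hball hU).norm_mul_add hPA).mono (fun k => ?_) (le_of_eq ?_)
    · simp only [Pi.add_apply, Pi.sub_apply, sub_add_sub_cancel]
      exact le_rfl
    · field_simp; ring
  have ham : (m / Real.sqrt (beta Q)) ^ 2 * beta Q = m ^ 2 := by
    rw [div_pow, Real.sq_sqrt hβ.le]; field_simp
  have hLip : ∀ (U V : quasilattice Q → Path T) (B : ℝ), RotInv U → RotInv V →
      L1Bound (fun k => ‖expPath T (s k * shrinkWeight Q ρ M k) (shrinkRate Q σ M k) *
        (U k - ContinuousMap.const _ (P k))‖) (δ * ε * m) →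
      L1Bound (fun k => ‖expPath T (s k * shrinkWeight Q ρ M k) (shrinkRate Q σ M k) *
        (V k - ContinuousMap.const _ (P k))‖) (δ * ε * m) →
      L1Bound (fun k => ‖expPath T (s k * shrinkWeight Q ρ M k) (shrinkRate Q σ M k) *
        (U k - V k)‖) B →
      L1Bound (fun k => θ k * ‖expPath T (s k * shrinkWeight Q ρ M k) (shrinkRate Q σ M k) *
        (g k • (U k - V k) - (conv3 U U U - conv3 V V V) k)‖) (B / 2) := by
    intro U V B hU hV hUr hVr hB
    have h1 := hballA hUr
    have h2 := hballA hVr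
    simp only [hwt] at hB ⊢
    exact lipschitz_near_leading (wt := fun k => s k • w k) he hwN hm0 ham ha₀0 hε1 hδ0
      hδ1 hκ0 (fun _ => rfl) hs1 hs2 hκδ hεa hδa hA₀ hA hU hV h1 h2 hB
  -- The centre is the truncated sum P, whose residual is known; its distance C₁E to the initial
  -- value enters η.
  obtain ⟨U, hUrot, hUsol, hUb⟩ := exists_coeffSolution hT
    (μ := μ) (a := fun k => symbol k - μ + g k) (b := shrinkRate Q σ M) (g := g)
    (S := fun k => s k * shrinkWeight Q ρ M k) (θ := θ) (p := P) (u₀ := patternR Q c ν)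
    (r := δ * ε * m) (η := (C₁ + C₂) * E)
    (fun k => mul_pos (hs0 k) (Real.exp_pos _))
    (fun k => by unfold shrinkRate; positivity)
    (fun k => by
      have hr : 0 ≤ shrinkRate Q σ M k := by unfold shrinkRate; positivity
      left
      -- On the kernel the symbol vanishes and the shift 3μ leaves the rate 2μ. Off it the shift μ
      -- cancels -μ, and `damping_le` bounds the sum of the symbol and the rate of the weight.
      by_cases h : IsWave Q k
      · obtain ⟨-, h2, h3⟩ := hs1 k h
        rw [h2, h3, h.symbol, hμm]
        have hm2 : 0 < m ^ 2 := by positivity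
        refine ⟨by linarith, ?_⟩
        rw [div_mul_eq_mul_div, one_le_div (by positivity)]
        linarith
      · obtain ⟨-, h2, h3⟩ := hs2 k h
        have h4 := damping_le (by omega) he hl hκ1 ha₁0 ha₁κ hν hνa h
        rw [h2, h3, ← hμm, sub_add_cancel]
        have h5 : 0 < κ * μ := by positivity
        refine ⟨h5.trans_le h4, ?_⟩
        rw [div_mul_eq_mul_div, one_le_div h5, one_mul]
        exact h4)
    (fun k => rfl)
    (fun k k' hk => if_congr (isWave_rotate_iff he hk) rfl rfl)
    (rotInv_partialPattern he _ _) (rotInv_patternR he _ _) hPs.summable_norm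
    hLip
    (by
      -- The residual C₂μE multiplied by the inverse damping, at most 1/μ, contributes C₂E.
      have hθμ : ∀ k, θ k ≤ 1 / μ := fun k => by
        rw [hμm]
        have hm2 : 0 < m ^ 2 := by positivity
        by_cases h : IsWave Q k
        · rw [(hs1 k h).2.2]
          gcongr
          linarith
        · rw [(hs2 k h).2.2]
          gcongr
          exact le_mul_of_one_le_left hm2.le hκ1
      have hsW : ∀ k, s k * shrinkWeight Q ρ M k ≤ expWeight Q ρ k := fun k => by
        have h1 := shrinkWeight_le (M := M) hρ.le k
        have h2 : 0 < shrinkWeight Q ρ M k := Real.exp_pos _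
        exact (mul_le_of_le_one_left h2.le (hs01 k)).trans h1
      refine (hdiff'.add (hres'.const_mul (show 0 ≤ 1 / μ by positivity))).mono (fun k => ?_)
        (le_of_eq (by rw [← hE, ← hμ]; field_simp))
      have h3 : 0 < expWeight Q ρ k := Real.exp_pos _
      have h4 := hsW k
      have h5 := hθμ k
      simp only [Real.norm_eq_abs]
      have h6 : 0 ≤ s k * shrinkWeight Q ρ M k := (mul_pos (hs0 k) (Real.exp_pos _)).le
      gcongr)
    (by
      have h1 := exp_neg_div_le hc hν j
      calc 2 * ((C₁ + C₂) * E) ≤ 2 * ((C₁ + C₂) * (j.factorial / c ^ j * ν ^ j)) := by gcongr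
        _ = (C₅ * ν) * m := by rw [hC₅, hj, pow_succ ν, hm]; ring
        _ ≤ δ * ε * m := by gcongr)
  refine ⟨U, hUrot, hUsol, ?_⟩
  have h1 := hball hUb
  have h2 : L1Bound (fun k => expWeight Q (ρ / 2) k * ‖patternR Q c ν k - P k‖) (C₁ * E) :=
    hdiff'.mono (fun k => mul_le_mul_of_nonneg_right (by
      unfold expWeight
      rw [Real.exp_le_exp]
      have : 0 ≤ ρ / 2 * (order Q k : ℝ) := by positivity
      linarith) (norm_nonneg _)) le_rfl
  refine (h1.add h2).mono (fun k => ?_) (le_of_eq (by ring))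
  have h3 := expWeight_mul_norm_le hσ0 hM0 hTσ k (U k - ContinuousMap.const _ (P k))
  have h4 : ‖(ContinuousMap.const _ (patternR Q c ν k - P k) : Path T)‖ ≤ ‖patternR Q c ν k - P k‖ :=
    (ContinuousMap.norm_le _ (norm_nonneg _)).2 fun t => le_rfl
  have h5 : U k - ContinuousMap.const _ (patternR Q c ν k)
      = (U k - ContinuousMap.const _ (P k))
        - (ContinuousMap.const _ (patternR Q c ν k - P k) : Path T) := by
    ext t
    simp
  have h6 : 0 < expWeight Q (ρ / 2) k := Real.exp_pos _
  rw [h5]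
  calc _ ≤ expWeight Q (ρ / 2) k * (‖U k - ContinuousMap.const _ (P k)‖
        + ‖(ContinuousMap.const _ (patternR Q c ν k - P k) : Path T)‖) := by
        gcongr
        exact norm_sub_le _ _
    _ = expWeight Q (ρ / 2) k * ‖U k - ContinuousMap.const _ (P k)‖ + expWeight Q (ρ / 2) k *
        ‖(ContinuousMap.const _ (patternR Q c ν k - P k) : Path T)‖ := mul_add _ _ _
    _ ≤ _ := by
        gcongr
        exact h3

end SmallParameter
end
end SwiftHohenberg

namespace SwiftHohenberg
noncomputable section

/-! ### Evolution for ν bounded below. -/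

section LargeParameter
variable {Q : ℕ} {T : ℝ}

theorem isNormWeight_const {W : quasilattice Q → ℝ} (hW : IsWeight W) :
    IsNormWeight fun k => expPath T (W k) 0 := by
  refine isNormWeight_expPath (b := fun _ => 0) hW.pos (fun k t _ => ?_) fun p q r k h t _ => ?_
  · simpa using hW.one_le k
  · simpa using hW.le_mul p q r k h

theorem mul_norm_le_norm_expPath_mul {W : ℝ} (hW : 0 < W) (x : Path T) :
    W * ‖x‖ ≤ ‖expPath T W 0 * x‖ := by
  rw [← le_div_iff₀' hW]
  refine (ContinuousMap.norm_le _ (by positivity)).2 fun t => ?_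
  rw [le_div_iff₀' hW]
  refine le_trans (le_of_eq ?_) (ContinuousMap.norm_coe_le_norm _ t)
  rw [ContinuousMap.mul_apply, norm_mul, Real.norm_of_nonneg (expPath_nonneg hW.le t),
    expPath_apply]
  simp

theorem expWeight_mono {ρ ρ' : ℝ} (h : ρ ≤ ρ') (k : quasilattice Q) :
    expWeight Q ρ k ≤ expWeight Q ρ' k := by
  unfold expWeight
  gcongr

theorem symbol_le (k : quasilattice Q) : symbol k ≤ (1 + (order Q k : ℝ) ^ 2) ^ 2 := by
  have h1 := norm_le_order k.2
  have h2 : ‖(k : ℂ)‖ ^ 2 ≤ (order Q k : ℝ) ^ 2 := by gcongr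
  unfold symbol
  refine sq_le_sq' ?_ ?_ <;> nlinarith [sq_nonneg ‖(k : ℂ)‖]

theorem exists_symbol_le (Q : ℕ) {ρ : ℝ} (hρ : 0 < ρ) :
    ∃ C : ℝ, 0 < C ∧ ∀ k : quasilattice Q, symbol k ≤ C * expWeight Q ρ k := by
  obtain ⟨C, hC, h⟩ := exists_rpow_le_exp 2 hρ
  refine ⟨C, hC, fun k => (symbol_le k).trans ?_⟩
  have := h (order Q k) (Nat.cast_nonneg _)
  rwa [Real.rpow_two] at this

/-- The loss of weight caused by the linear operator. -/
theorem L1Bound.symbol_mul {ρ C B : ℝ} {F : quasilattice Q → ℝ}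
    (hC : ∀ k : quasilattice Q, symbol k ≤ C * expWeight Q (ρ / 2) k) (hC0 : 0 ≤ C)
    (hF0 : ∀ k, 0 ≤ F k) (hF : L1Bound (fun k => expWeight Q ρ k * F k) B) :
    L1Bound (fun k => expWeight Q (ρ / 2) k * (symbol k * F k)) (C * B) := by
  refine (hF.const_mul hC0).mono (fun k => ?_) le_rfl
  have h1 : expWeight Q ρ k = expWeight Q (ρ / 2) k * expWeight Q (ρ / 2) k := by
    unfold expWeight
    rw [← Real.exp_add]
    congr 1
    ring
  have h2 : 0 < expWeight Q (ρ / 2) k := Real.exp_pos _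
  calc expWeight Q (ρ / 2) k * (symbol k * F k)
      ≤ expWeight Q (ρ / 2) k * (C * expWeight Q (ρ / 2) k * F k) := by
        have := hF0 k
        gcongr
        exact hC k
    _ = _ := by rw [h1]; ring

/-- The solution for values of the parameter bounded below. -/
theorem exists_coeffSolution_large [NeZero Q] (hQ : 8 ≤ Q) (he : Even Q) {ρ γ R c : ℝ}
    (hρ : 0 < ρ) (hc : 0 < c) (hcR : c < R) (hγ : 0 ≤ γ) (hG : GevreyL1 Q (formalSeq Q) ρ γ R)
    {ν₀ : ℝ} (hν₀ : 0 < ν₀) :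
    ∃ α C : ℝ, 0 < α ∧ 0 < C ∧ ∀ ν : ℝ, ν₀ ≤ ν → ∀ (T : ℝ) (hT : 0 ≤ T),
      T * (ν ^ (4 * ell Q) * ν) ≤ α → ∃ U : quasilattice Q → Path T, RotInv U ∧
        IsCoeffSolution hT (ν ^ (4 * ell Q)) (patternR Q c ν) U ∧
        L1Bound (fun k => expWeight Q (ρ / 2) k * ‖U k - ContinuousMap.const _ (patternR Q c ν k)‖)
          (C * Real.exp (-c / ν)) := by
  have hl := one_le_ell hQ he
  obtain ⟨C₀, hC₀, hpat⟩ := exists_l1Bound_patternR hl hρ.le hc hcR hγ hG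
  obtain ⟨C₁, hC₁, hsym⟩ := exists_symbol_le Q (show 0 < ρ / 2 by positivity)
  set C := C₀ + 1 with hC
  set D := 1 / ν₀ with hD
  set D' := 1 / (ν₀ ^ (4 * ell Q) * ν₀) with hD'
  have hD0 : 0 < D := by positivity
  have hD'0 : 0 < D' := by positivity
  -- The bracket collects the Lipschitz constant (D, 3C²D') and the defect of p (the remaining
  -- terms), with Tμ ≤ αD and T ≤ αD'. Both are then small enough for a contraction in the unit
  -- ball.
  set α := 1 / (2 * (D + 3 * C ^ 2 * D' + (C₁ * C₀ * D' + C₀ * D + C₀ ^ 3 * D'))) with hα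
  have hα0 : 0 < α := by positivity
  have hαe : α * (D + 3 * C ^ 2 * D' + (C₁ * C₀ * D' + C₀ * D + C₀ ^ 3 * D')) = 1 / 2 := by
    rw [hα]; field_simp
  refine ⟨α, Real.exp (c / ν₀), hα0, Real.exp_pos _, fun ν hν T hT hTα => ?_⟩
  have hν0 : 0 < ν := hν₀.trans_le hν
  have hpat' := hpat ν hν0
  set p := patternR Q c ν with hp
  set μ := ν ^ (4 * ell Q) with hμ
  have hμ0 : 0 < μ := by positivity
  have hTμ : T * μ ≤ α * D := by
    rw [hD, mul_one_div, le_div_iff₀ hν₀]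
    calc T * μ * ν₀ ≤ T * μ * ν := by gcongr
      _ ≤ α := by linarith
  have hTD : T ≤ α * D' := by
    rw [hD', mul_one_div, le_div_iff₀ (by positivity)]
    calc T * (ν₀ ^ (4 * ell Q) * ν₀) ≤ T * (ν ^ (4 * ell Q) * ν) := by gcongr
      _ ≤ α := hTα
  have hWt : IsWeight (expWeight Q (ρ / 2)) := isWeight_expWeight (by positivity)
  set w : quasilattice Q → Path T := fun k => expPath T (expWeight Q (ρ / 2) k) 0 with hw
  have hwN : IsNormWeight w := isNormWeight_const hWt
  have hp2 : L1Bound (fun k => expWeight Q (ρ / 2) k * ‖p k‖) C₀ :=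
    hpat'.mono (fun k => mul_le_mul_of_nonneg_right (expWeight_mono (by linarith) k)
      (norm_nonneg _)) le_rfl
  have hbig : ∀ {U : quasilattice Q → Path T},
      L1Bound (fun k => ‖w k * (U k - ContinuousMap.const _ (p k))‖) 1 →
      L1Bound (fun k => ‖w k * U k‖) C := fun {U} hU => by
    refine (hU.add hp2).mono (fun k => ?_) (by rw [hC]; linarith)
    have h1 := norm_expPath_mul_const_le (T := T) (hWt.pos k).le (le_refl (0 : ℝ)) (p k)
    calc ‖w k * U k‖ = ‖w k * (U k - ContinuousMap.const _ (p k))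
          + w k * ContinuousMap.const _ (p k)‖ := by rw [← mul_add, sub_add_cancel]
      _ ≤ _ := (norm_add_le _ _).trans (add_le_add le_rfl h1)
  have hLip : ∀ (U V : quasilattice Q → Path T) (B : ℝ), RotInv U → RotInv V →
      L1Bound (fun k => ‖w k * (U k - ContinuousMap.const _ (p k))‖) 1 →
      L1Bound (fun k => ‖w k * (V k - ContinuousMap.const _ (p k))‖) 1 →
      L1Bound (fun k => ‖w k * (U k - V k)‖) B →
      L1Bound (fun k => T * ‖w k * (μ • (U k - V k) - (conv3 U U U - conv3 V V V) k)‖)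
        (B / 2) := by
    intro U V B _ _ hU hV hB
    have hX := hwN.l1Bound_cube_sub (hbig hU) (hbig hV) hB
    refine (((hB.const_mul hμ0.le).add hX).const_mul hT).mono (fun k => ?_) ?_
    · refine mul_le_mul_of_nonneg_left ?_ hT
      rw [mul_sub]
      refine (norm_sub_le _ _).trans (add_le_add (le_of_eq ?_) le_rfl)
      rw [mul_smul_comm, norm_smul, Real.norm_of_nonneg hμ0.le]
    · have hB0 := hB.nonneg
      have h1 : T * μ + 3 * C ^ 2 * T ≤ 1 / 2 := by
        rw [← hαe]
        have h2 : 3 * C ^ 2 * T ≤ 3 * C ^ 2 * (α * D') := by gcongr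
        have h3 : 0 ≤ α * (C₁ * C₀ * D' + C₀ * D + C₀ ^ 3 * D') := by positivity
        linarith
      have := mul_le_mul_of_nonneg_right h1 hB0
      linarith
  have hpcube := hWt.l1Bound_conv3 hp2 hp2 hp2
  have hpsym := L1Bound.symbol_mul hsym hC₁.le (fun k => norm_nonneg (p k)) hpat'
  set η := T * (C₁ * C₀ + μ * C₀ + C₀ * C₀ * C₀) with hη
  have hη1 : 2 * η ≤ 1 := by
    have h1 : T * (C₁ * C₀ + C₀ ^ 3) ≤ α * D' * (C₁ * C₀ + C₀ ^ 3) := by gcongr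
    have h2 : T * μ * C₀ ≤ α * D * C₀ := by gcongr
    have h3 : 0 ≤ α * (D + 3 * C ^ 2 * D') := by positivity
    rw [hη]
    linarith
  -- No damping is needed: the shift μ leaves the nonnegative symbol as rate, the inverse damping is
  -- the length T of the interval, and the centre is the initial value itself.
  obtain ⟨U, hUrot, hUsol, hUb⟩ := exists_coeffSolution hT
    (μ := μ) (a := fun k => symbol k - μ + μ) (b := fun _ => 0) (g := fun _ => μ)
    (S := expWeight Q (ρ / 2)) (θ := fun _ => T) (p := p) (u₀ := p) (r := 1) (η := η)
    hWt.pos (fun _ => le_rfl)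
    (fun k => Or.inr ⟨by rw [sub_add_cancel, add_zero]; exact symbol_nonneg _, le_rfl⟩)
    (fun _ => rfl) (fun _ _ _ => rfl) (rotInv_patternR he _ _) (rotInv_patternR he _ _)
    (hWt.summable hp2) hLip
    (by
      refine (((hpsym.add (hp2.const_mul hμ0.le)).add hpcube).const_mul hT).mono (fun k => ?_) le_rfl
      rw [sub_self, abs_zero, mul_zero, zero_add]
      refine mul_le_mul_of_nonneg_left ?_ hT
      have h1 := hWt.pos k
      have h2 := symbol_nonneg (k : ℂ)
      calc expWeight Q (ρ / 2) k * |symbol k * p k - μ * p k + conv3 p p p k|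
          ≤ expWeight Q (ρ / 2) k * (symbol k * ‖p k‖ + μ * ‖p k‖ + ‖conv3 p p p k‖) := by
            gcongr
            refine (abs_add_le _ _).trans (add_le_add ((abs_sub _ _).trans ?_) le_rfl)
            rw [abs_mul, abs_mul, abs_of_nonneg h2, abs_of_pos hμ0]
            rfl
        _ = _ := by ring)
    hη1
  refine ⟨U, hUrot, hUsol, hUb.mono (fun k => mul_norm_le_norm_expPath_mul (hWt.pos k) _) ?_⟩
  -- The deviation is at most 1, and 1 ≤ e^{c/ν₀} e^{-c/ν} because ν ≥ ν₀.
  refine hη1.trans ?_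
  rw [← Real.exp_add]
  refine Real.one_le_exp ?_
  have : c / ν ≤ c / ν₀ := by gcongr
  rw [neg_div]
  linarith

end LargeParameter
end
end SwiftHohenberg

namespace SwiftHohenberg
noncomputable section

/-! ### From solutions for the coefficients to solutions in H_s. -/

section Evolution
variable {Q : ℕ} {s : ℝ} {T : ℝ}

theorem Hs.coeff_sub (U V : Hs Q s) (k : quasilattice Q) :
    (U - V).coeff k = U.coeff k - V.coeff k := rfl

theorem Hs.coeff_smul (r : ℝ) (U : Hs Q s) (k : quasilattice Q) :
    (r • U).coeff k = (r : ℂ) * U.coeff k := rfl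

/-- The element of `H_s` with given coefficients. -/
def Hs.mk (U : Coeffs Q) (h : MemHs Q s U) : Hs Q s := ⟨U, h⟩

theorem Hs.ext {U V : Hs Q s} (h : ∀ k, U.coeff k = V.coeff k) : U = V :=
  Subtype.ext (funext h)

theorem conv3_apply {f : quasilattice Q → Path T} (hf : Summable fun k => ‖f k‖)
    (k : quasilattice Q) (t : Set.Icc (0 : ℝ) T) :
    conv3 f f f k t = conv3 (fun k => f k t) (fun k => f k t) (fun k => f k t) k :=
  map_conv3 ((Pi.evalRingHom (fun _ : Set.Icc (0 : ℝ) T => ℝ) t).comp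
    (ContinuousMap.coeFnRingHom : Path T →+* (Set.Icc (0 : ℝ) T → ℝ)))
    (continuous_eval_const t) hf hf hf k

theorem norm_expPath_mul_le {W : ℝ} (hW : 0 ≤ W) (x : Path T) :
    ‖expPath T W 0 * x‖ ≤ W * ‖x‖ := by
  refine (ContinuousMap.norm_le _ (by positivity)).2 fun t => ?_
  rw [ContinuousMap.mul_apply, norm_mul, Real.norm_of_nonneg (expPath_nonneg hW t), expPath_apply]
  simpa using mul_le_mul_of_nonneg_left (x.norm_coe_le_norm t) hW

theorem IsWeight.l1Bound_conv3_path {W : quasilattice Q → ℝ} (hW : IsWeight W)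
    {U : quasilattice Q → Path T} {B : ℝ} (hU : L1Bound (fun k => W k * ‖U k‖) B) :
    L1Bound (fun k => W k * ‖conv3 U U U k‖) (B * B * B) := by
  have h1 : L1Bound (fun k => ‖expPath T (W k) 0 * U k‖) B :=
    hU.mono (fun k => norm_expPath_mul_le (hW.pos k).le _) le_rfl
  exact ((isNormWeight_const hW).l1Bound_conv3 h1 h1 h1).mono
    (fun k => mul_norm_le_norm_expPath_mul (hW.pos k) _) le_rfl

/-- The right-hand side of the equation for the coefficients. -/
def rhsPath (μ : ℝ) (U : quasilattice Q → Path T) (k : quasilattice Q) : Path T :=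
  μ • U k - symbol k • U k - conv3 U U U k

/-- The symbol grows polynomially in N, so half of the exponential weight pays for it. -/
theorem exists_l1Bound_rhsPath {ρ B μ : ℝ} (hρ : 0 < ρ) {U : quasilattice Q → Path T}
    (hU : L1Bound (fun k => expWeight Q ρ k * ‖U k‖) B) :
    ∃ B', L1Bound (fun k => expWeight Q (ρ / 2) k * ‖rhsPath μ U k‖) B' := by
  obtain ⟨C, hC, hsym⟩ := exists_symbol_le Q (show 0 < ρ / 2 by positivity)
  have hWt : IsWeight (expWeight Q (ρ / 2)) := isWeight_expWeight (by positivity)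
  have h1 := L1Bound.symbol_mul hsym hC.le (fun k => norm_nonneg (U k)) hU
  have h2 : L1Bound (fun k => expWeight Q (ρ / 2) k * ‖U k‖) B :=
    hU.mono (fun k => mul_le_mul_of_nonneg_right (expWeight_mono (by linarith) k)
      (norm_nonneg _)) le_rfl
  have h3 := hWt.l1Bound_conv3_path h2
  refine ⟨_, (((h2.const_mul (abs_nonneg μ)).add h1).add h3).mono (fun k => ?_) le_rfl⟩
  have h4 := hWt.pos k
  have h5 := symbol_nonneg (k : ℂ)
  calc expWeight Q (ρ / 2) k * ‖rhsPath μ U k‖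
      ≤ expWeight Q (ρ / 2) k * (|μ| * ‖U k‖ + symbol k * ‖U k‖ + ‖conv3 U U U k‖) := by
        gcongr
        unfold rhsPath
        refine (norm_sub_le _ _).trans (add_le_add ((norm_sub_le _ _).trans ?_) le_rfl)
        rw [norm_smul, norm_smul, Real.norm_eq_abs, Real.norm_of_nonneg h5]
    _ = _ := by ring

variable (hT : 0 ≤ T)

/-- The coefficients at time `t`. -/
def stateC (U : quasilattice Q → Path T) (t : ℝ) : Coeffs Q :=
  toC fun k => Path.ext hT (U k) t

theorem norm_ext_le (f : Path T) (t : ℝ) : ‖Path.ext hT f t‖ ≤ ‖f‖ := f.norm_coe_le_norm _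

theorem memHs_stateC {ρ B : ℝ} (hρ : 0 < ρ) {U : quasilattice Q → Path T}
    (hU : L1Bound (fun k => expWeight Q ρ k * ‖U k‖) B) (t : ℝ) : MemHs Q s (stateC hT U t) := by
  obtain ⟨C, hC, h⟩ := exists_sobolev_const Q s hρ
  refine (h _ B (hU.mono (fun k => ?_) le_rfl)).1
  unfold stateC
  rw [norm_toC]
  exact mul_le_mul_of_nonneg_left (norm_ext_le hT _ _) (Real.exp_pos _).le

theorem stateC_rhsPath {ρ B μ : ℝ} (hρ : 0 < ρ) {U : quasilattice Q → Path T}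
    (hU : L1Bound (fun k => expWeight Q ρ k * ‖U k‖) B) (t : ℝ) :
    stateC hT (rhsPath μ U) t = (μ : ℂ) • stateC hT U t - linOp Q (stateC hT U t)
      - prod3 Q (stateC hT U t) (stateC hT U t) (stateC hT U t) := by
  have hsum : Summable fun k => ‖U k‖ := Summable.of_nonneg_of_le (fun _ => norm_nonneg _)
    (fun k => le_mul_of_one_le_left (norm_nonneg _) ((isWeight_expWeight hρ.le).one_le k))
    (hU.summable fun k => mul_nonneg (Real.exp_pos _).le (norm_nonneg _))
  have hsum' : Summable fun k => ‖Path.ext hT (U k) t‖ :=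
    Summable.of_nonneg_of_le (fun _ => norm_nonneg _) (fun k => norm_ext_le hT _ _) hsum
  rw [prod3_eq_conv3]
  unfold stateC
  rw [conv3_toC hsum' hsum' hsum']
  funext k
  have h1 := conv3_apply hsum k (Set.projIcc 0 T hT t)
  simp only [toC, Pi.sub_apply, Pi.smul_apply, linOp, smul_eq_mul, Path.ext, rhsPath,
    ContinuousMap.sub_apply, ContinuousMap.smul_apply, h1, symbol]
  push_cast
  ring

theorem IsCoeffSolution.abs_sub_le {μ : ℝ} {u₀ : quasilattice Q → ℝ} {U : quasilattice Q → Path T}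
    (hU : IsCoeffSolution hT μ u₀ U) (k : quasilattice Q) {t τ : ℝ} (ht : t ∈ Set.Icc 0 T)
    (hτ : τ ∈ Set.Icc 0 T) :
    ‖Path.ext hT (U k) τ - Path.ext hT (U k) t‖ ≤ ‖rhsPath μ U k‖ * ‖τ - t‖ :=
  (convex_Icc 0 T).norm_image_sub_le_of_norm_hasDerivWithin_le
    (f' := fun x => Path.ext hT (rhsPath μ U k) x)
    (fun x hx => by
      rw [Path.ext_of_mem hT _ hx]
      exact hU.deriv k ⟨x, hx⟩)
    (fun x _ => norm_ext_le hT _ x) ht hτ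

/-- A solution for the coefficients with summable exponential weights is a solution in `H_s`. -/
theorem IsCoeffSolution.isSolution {μ ρ B : ℝ} (hρ : 0 < ρ) {u₀ : quasilattice Q → ℝ}
    {U : quasilattice Q → Path T} (hU : IsCoeffSolution hT μ u₀ U)
    (hB : L1Bound (fun k => expWeight Q ρ k * ‖U k‖) B) {W : ℝ → Hs Q s}
    (hW : ∀ t, (W t).coeff = stateC hT U t) : IsSolution Q s μ T (toC u₀) W := by
  obtain ⟨B', hF⟩ := exists_l1Bound_rhsPath (μ := μ) hρ hB
  have hρ2 : 0 < ρ / 2 := by positivity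
  obtain ⟨C, hC, hsob⟩ := exists_sobolev_const Q s hρ2
  refine ⟨?_, fun t ht => ?_⟩
  · rw [hW]
    funext k
    simp only [stateC, toC]
    rw [Path.ext_of_mem hT _ ⟨le_rfl, hT⟩, hU.init k]
  · refine ⟨Hs.mk (stateC hT (rhsPath μ U) t) (memHs_stateC hT hρ2 hF t), ?_, ?_⟩
    · rw [hW]
      exact stateC_rhsPath hT hρ hB t
    · set F : Hs Q s := Hs.mk (stateC hT (rhsPath μ U) t) (memHs_stateC hT hρ2 hF t) with hFdef
      -- Each coefficient's difference quotient converges, and by the mean value inequality its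
      -- error is at most 2‖rhs‖, summable with exponential weight. Dominated convergence gives the
      -- derivative in the norm of H_s.
      refine hasDerivWithinAt_iff_tendsto_slope.2 (tendsto_iff_norm_sub_tendsto_zero.2 ?_)
      set e : ℝ → quasilattice Q → ℝ := fun τ k => expWeight Q (ρ / 2) k *
        ‖slope (Path.ext hT (U k)) t τ - Path.ext hT (rhsPath μ U k) t‖ with he
      have he0 : ∀ τ k, 0 ≤ e τ k := fun τ k => mul_nonneg (Real.exp_pos _).le (norm_nonneg _)
      set b : quasilattice Q → ℝ := fun k => 2 * (expWeight Q (ρ / 2) k * ‖rhsPath μ U k‖) with hb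
      have hbs : Summable b :=
        (hF.summable fun k => mul_nonneg (Real.exp_pos _).le (norm_nonneg _)).mul_left 2
      have hmem : ∀ᶠ τ in nhdsWithin t (Set.Icc 0 T \ {t}), τ ∈ Set.Icc 0 T \ {t} :=
        self_mem_nhdsWithin
      have heb : ∀ᶠ τ in nhdsWithin t (Set.Icc 0 T \ {t}), ∀ k, e τ k ≤ b k := by
        filter_upwards [hmem] with τ hτ k
        have h1 := hU.abs_sub_le hT k ht hτ.1
        have h2 : 0 < ‖τ - t‖ := norm_pos_iff.2 (sub_ne_zero.2 hτ.2)
        have h3 : ‖slope (Path.ext hT (U k)) t τ‖ ≤ ‖rhsPath μ U k‖ := by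
          rw [slope_def_field, norm_div, div_le_iff₀ h2]
          exact h1
        have h4 := norm_ext_le hT (rhsPath μ U k) t
        have h5 : 0 < expWeight Q (ρ / 2) k := Real.exp_pos _
        rw [he, hb]
        simp only
        calc _ ≤ expWeight Q (ρ / 2) k * (‖rhsPath μ U k‖ + ‖rhsPath μ U k‖) := by
              gcongr
              exact (norm_sub_le _ _).trans (add_le_add h3 h4)
          _ = _ := by ring
      have hlim : Filter.Tendsto (fun τ => C * ∑' k, e τ k) (nhdsWithin t (Set.Icc 0 T \ {t}))
          (nhds 0) := by
        have h1 : Filter.Tendsto (fun τ => ∑' k, e τ k) (nhdsWithin t (Set.Icc 0 T \ {t}))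
            (nhds (∑' _ : quasilattice Q, (0 : ℝ))) := by
          refine tendsto_tsum_of_dominated_convergence hbs (fun k => ?_) ?_
          · have h2 := hU.deriv k ⟨t, ht⟩
            have h3 : Path.ext hT (rhsPath μ U k) t
                = μ * U k ⟨t, ht⟩ - symbol k * U k ⟨t, ht⟩ - conv3 U U U k ⟨t, ht⟩ := by
              rw [Path.ext_of_mem hT _ ht]
              rfl
            rw [← h3, hasDerivWithinAt_iff_tendsto_slope, tendsto_iff_norm_sub_tendsto_zero] at h2
            have h4 := h2.const_mul (expWeight Q (ρ / 2) k)
            rwa [mul_zero] at h4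
          · filter_upwards [heb] with τ hτ k
            rw [Real.norm_of_nonneg (he0 τ k)]
            exact hτ k
        simpa using h1.const_mul C
      refine squeeze_zero' (Filter.Eventually.of_forall fun _ => norm_nonneg _) ?_ hlim
      filter_upwards [heb] with τ hτ
      have hes : Summable (e τ) := Summable.of_nonneg_of_le (he0 τ) hτ hbs
      refine (hsob (slope W t τ - F).coeff _ ((l1Bound_tsum hes (he0 τ)).mono (fun k => ?_)
        le_rfl)).2 _ rfl
      rw [he]
      simp only
      refine mul_le_mul_of_nonneg_left (le_of_eq ?_) (Real.exp_pos _).le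
      have h1 : (slope W t τ - F).coeff k
          = (((slope (Path.ext hT (U k)) t τ - Path.ext hT (rhsPath μ U k) t : ℝ)) : ℂ) := by
        rw [Hs.coeff_sub, slope, Hs.coeff_smul, vsub_eq_sub, Hs.coeff_sub, hW, hW, slope_def_field]
        have h2 : F.coeff k = ((Path.ext hT (rhsPath μ U k) t : ℝ) : ℂ) := rfl
        rw [h2]
        simp only [stateC, toC]
        push_cast
        ring
      rw [h1, Complex.norm_real]

end Evolution

/-! ### Uniqueness in H_s. -/

section Uniqueness
variable {Q : ℕ} {s : ℝ} {T : ℝ}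

theorem isNormWeight_one : IsNormWeight fun _ : quasilattice Q => (1 : ℂ) where
  norm_le _ _ := by rw [one_mul]
  norm_mul_le _ _ _ _ _ x y z := by simp

/-- The evaluation of a coefficient, as a continuous linear map. -/
def coeffCLM (hQ : Q ≠ 0) (he : Even Q) (hs : (Q : ℝ) / 4 < s) (k : quasilattice Q) :
    Hs Q s →L[ℝ] ℂ :=
  LinearMap.mkContinuous
    { toFun := fun V => V.coeff k
      map_add' := fun _ _ => rfl
      map_smul' := fun r V => by rw [Hs.coeff_smul]; simp }
    (embedConst Q s) fun V => (l1Bound_coeff hQ he hs V).le k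

theorem IsSolution.mono {μ T' : ℝ} {U₀ : Coeffs Q} {W : ℝ → Hs Q s} (hW : IsSolution Q s μ T U₀ W)
    (h : T' ≤ T) : IsSolution Q s μ T' U₀ W :=
  ⟨hW.1, fun t ht => by
    obtain ⟨F, h1, h2⟩ := hW.2 t ⟨ht.1, ht.2.trans h⟩
    exact ⟨F, h1, h2.mono (Set.Icc_subset_Icc_right h)⟩⟩

theorem IsSolution.continuousOn {μ : ℝ} {U₀ : Coeffs Q} {W : ℝ → Hs Q s}
    (hW : IsSolution Q s μ T U₀ W) : ContinuousOn W (Set.Icc 0 T) := fun t ht => by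
  obtain ⟨F, _, h⟩ := hW.2 t ht
  exact h.continuousWithinAt

theorem l1Bound_cube_sub_coeff (hQ : Q ≠ 0) (he : Even Q) (hs : (Q : ℝ) / 4 < s) {L B : ℝ}
    {U V : Hs Q s} (hU : embedConst Q s * ‖U‖ ≤ L) (hV : embedConst Q s * ‖V‖ ≤ L)
    (hB : L1Bound (fun k => ‖U.coeff k - V.coeff k‖) B) :
    L1Bound (fun k => ‖prod3 Q U.coeff U.coeff U.coeff k - prod3 Q V.coeff V.coeff V.coeff k‖)
      (3 * L ^ 2 * B) := by
  have h1 := (l1Bound_coeff hQ he hs U).mono (fun _ => le_rfl) hU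
  have h2 := (l1Bound_coeff hQ he hs V).mono (fun _ => le_rfl) hV
  have h3 := (isNormWeight_one (Q := Q)).l1Bound_cube_sub (U := U.coeff) (V := V.coeff) (B := B)
    (C := L) (by simpa using h1) (by simpa using h2) (by simpa using hB)
  simpa [prod3_eq_conv3] using h3

theorem continuousOn_prod3 (hQ : Q ≠ 0) (he : Even Q) (hs : (Q : ℝ) / 4 < s) {W : ℝ → Hs Q s}
    (hW : ContinuousOn W (Set.Icc 0 T)) {L : ℝ}
    (hL : ∀ t ∈ Set.Icc 0 T, embedConst Q s * ‖W t‖ ≤ L) (k : quasilattice Q) :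
    ContinuousOn (fun t => prod3 Q (W t).coeff (W t).coeff (W t).coeff k) (Set.Icc 0 T) := by
  intro t ht
  rw [ContinuousWithinAt, tendsto_iff_norm_sub_tendsto_zero]
  have h1 := hW t ht
  rw [ContinuousWithinAt, tendsto_iff_norm_sub_tendsto_zero] at h1
  have h2 := h1.const_mul (3 * L ^ 2 * embedConst Q s)
  rw [mul_zero] at h2
  refine squeeze_zero' (Filter.Eventually.of_forall fun _ => norm_nonneg _) ?_ h2
  filter_upwards [self_mem_nhdsWithin] with τ hτ
  have h3 := l1Bound_cube_sub_coeff hQ he hs (hL τ hτ) (hL t ht)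
    (l1Bound_coeff hQ he hs (W τ - W t))
  exact (h3.le k).trans (le_of_eq (by ring))

/-- With the integrating factor e^{at} the bound does not depend on a ≥ 0. This matters since the
symbol is unbounded over the modes and H_s provides no weight to spare. -/
theorem norm_le_integral_of_damped {f G : ℝ → ℂ} {a : ℝ} (ha : 0 ≤ a)
    (hf : ∀ t ∈ Set.Icc 0 T, HasDerivWithinAt f (-(a : ℂ) * f t + G t) (Set.Icc 0 T) t)
    (hG : ContinuousOn G (Set.Icc 0 T)) (h0 : f 0 = 0) {t : ℝ} (ht : t ∈ Set.Icc 0 T) :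
    ‖f t‖ ≤ ∫ τ in (0 : ℝ)..t, ‖G τ‖ := by
  have hsub : Set.Icc 0 t ⊆ Set.Icc 0 T := Set.Icc_subset_Icc_right ht.2
  set h : ℝ → ℂ := fun τ => ((Real.exp (a * τ) : ℝ) : ℂ) * f τ with hh
  have hexp : ∀ τ, HasDerivAt (fun τ : ℝ => ((Real.exp (a * τ) : ℝ) : ℂ))
      ((Real.exp (a * τ) * a : ℝ) : ℂ) τ := fun τ => by
    have h1 := ((hasDerivAt_id τ).const_mul a).exp
    simp only [id, mul_one] at h1
    exact h1.ofReal_comp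
  have hexpc : Continuous fun τ : ℝ => ((Real.exp (a * τ) : ℝ) : ℂ) := by fun_prop
  have hd : ∀ τ ∈ Set.Icc 0 T, HasDerivWithinAt h (((Real.exp (a * τ) : ℝ) : ℂ) * G τ)
      (Set.Icc 0 T) τ := fun τ hτ => by
    refine ((hexp τ).hasDerivWithinAt.mul (hf τ hτ)).congr_deriv ?_
    push_cast
    ring
  have hcont : ContinuousOn h (Set.Icc 0 t) := fun τ hτ =>
    ((hd τ (hsub hτ)).mono hsub).continuousWithinAt
  have hGc : ContinuousOn (fun τ => ((Real.exp (a * τ) : ℝ) : ℂ) * G τ) (Set.Icc 0 t) :=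
    hexpc.continuousOn.mul (hG.mono hsub)
  have hGi : IntervalIntegrable (fun τ => ((Real.exp (a * τ) : ℝ) : ℂ) * G τ)
      MeasureTheory.volume 0 t := hGc.intervalIntegrable_of_Icc ht.1
  have hftc := intervalIntegral.integral_eq_sub_of_hasDerivAt_of_le ht.1 hcont
    (fun τ hτ => (hd τ (hsub (Set.Ioo_subset_Icc_self hτ))).hasDerivAt
      (Icc_mem_nhds hτ.1 (hτ.2.trans_le ht.2))) hGi
  have h1 : ‖h t‖ ≤ Real.exp (a * t) * ∫ τ in (0 : ℝ)..t, ‖G τ‖ := by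
    have h2 : h t = ∫ τ in (0 : ℝ)..t, ((Real.exp (a * τ) : ℝ) : ℂ) * G τ := by
      rw [hftc, hh]
      simp [h0]
    rw [h2, ← intervalIntegral.integral_const_mul]
    refine (intervalIntegral.norm_integral_le_integral_norm ht.1).trans ?_
    refine intervalIntegral.integral_mono_on ht.1 hGi.norm
      (((hG.mono hsub).norm.intervalIntegrable_of_Icc ht.1).const_mul _) fun τ hτ => ?_
    rw [norm_mul, Complex.norm_real, Real.norm_of_nonneg (Real.exp_pos _).le]
    have := hτ.2
    gcongr
  rw [hh] at h1
  simp only at h1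
  rw [norm_mul, Complex.norm_real, Real.norm_of_nonneg (Real.exp_pos _).le] at h1
  exact le_of_mul_le_mul_left h1 (Real.exp_pos _)

/-- Uniqueness for the initial value problem in `H_s`. -/
theorem isSolution_unique (hQ : Q ≠ 0) (he : Even Q) (hs : (Q : ℝ) / 4 < s) {μ : ℝ} {U₀ : Coeffs Q}
    {W W' : ℝ → Hs Q s} (hW : IsSolution Q s μ T U₀ W) (hW' : IsSolution Q s μ T U₀ W') :
    Set.EqOn W' W (Set.Icc 0 T) := by
  obtain ⟨M, hM⟩ := isCompact_Icc.exists_bound_of_continuousOn hW.continuousOn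
  obtain ⟨M', hM'⟩ := isCompact_Icc.exists_bound_of_continuousOn hW'.continuousOn
  have hemb : 0 ≤ embedConst Q s := Real.sqrt_nonneg _
  set L := embedConst Q s * max M M' with hL
  have hWL : ∀ t ∈ Set.Icc 0 T, embedConst Q s * ‖W t‖ ≤ L := fun t ht =>
    mul_le_mul_of_nonneg_left ((hM t ht).trans (le_max_left _ _)) hemb
  have hWL' : ∀ t ∈ Set.Icc 0 T, embedConst Q s * ‖W' t‖ ≤ L := fun t ht =>
    mul_le_mul_of_nonneg_left ((hM' t ht).trans (le_max_right _ _)) hemb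
  set D : quasilattice Q → ℝ → ℂ := fun k t => (W' t).coeff k - (W t).coeff k with hD
  set G : quasilattice Q → ℝ → ℂ := fun k t => (μ : ℂ) * D k t
    - (prod3 Q (W' t).coeff (W' t).coeff (W' t).coeff k
      - prod3 Q (W t).coeff (W t).coeff (W t).coeff k) with hG
  have hcoef : ∀ {W : ℝ → Hs Q s}, ContinuousOn W (Set.Icc 0 T) → ∀ k,
      ContinuousOn (fun t => (W t).coeff k) (Set.Icc 0 T) := fun hW k =>
    (coeffCLM hQ he hs k).continuous.comp_continuousOn hW
  have hGc : ∀ k, ContinuousOn (G k) (Set.Icc 0 T) := fun k =>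
    (continuousOn_const.mul ((hcoef hW'.continuousOn k).sub (hcoef hW.continuousOn k))).sub
      ((continuousOn_prod3 hQ he hs hW'.continuousOn hWL' k).sub
        (continuousOn_prod3 hQ he hs hW.continuousOn hWL k))
  have hDd : ∀ k, ∀ t ∈ Set.Icc 0 T,
      HasDerivWithinAt (D k) (-((symbol k : ℝ) : ℂ) * D k t + G k t) (Set.Icc 0 T) t := by
    intro k t ht
    obtain ⟨F, hF, h1⟩ := hW.2 t ht
    obtain ⟨F', hF', h1'⟩ := hW'.2 t ht
    have h2 := (coeffCLM hQ he hs k).hasFDerivAt.comp_hasDerivWithinAt t h1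
    have h2' := (coeffCLM hQ he hs k).hasFDerivAt.comp_hasDerivWithinAt t h1'
    refine (h2'.sub h2).congr_deriv ?_
    change F'.coeff k - F.coeff k = _
    rw [hF, hF', hG, hD]
    simp only [Pi.sub_apply, Pi.smul_apply, linOp, smul_eq_mul, symbol]
    ring
  have hD0 : ∀ k, D k 0 = 0 := fun k => by
    rw [hD]
    simp only
    rw [hW.1, hW'.1, sub_self]
  set C := |μ| + 3 * L ^ 2 + 1 with hC
  have hC0 : 0 < C := by positivity
  -- Iterated Gronwall in ℓ¹: the forcing is C-Lipschitz, and C ∫₀ᵗ e^{2Cτ} dτ ≤ e^{2Ct}/2, so each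
  -- pass halves the bound.
  have hstep : ∀ n : ℕ, ∀ t ∈ Set.Icc 0 T,
      L1Bound (fun k => ‖D k t‖) (2 * L * Real.exp (2 * C * t) / 2 ^ n) := by
    intro n
    induction n with
    | zero =>
      intro t ht
      have h1 := (l1Bound_coeff hQ he hs (W' t)).mono (fun _ => le_rfl) (hWL' t ht)
      have h2 := (l1Bound_coeff hQ he hs (W t)).mono (fun _ => le_rfl) (hWL t ht)
      refine (h1.add h2).mono (fun k => norm_sub_le _ _) ?_
      have h3 : 1 ≤ Real.exp (2 * C * t) := Real.one_le_exp (by have := ht.1; positivity)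
      have h4 := h1.nonneg
      rw [pow_zero, div_one]
      nlinarith
    | succ n ih =>
      intro t ht S
      have hsub : Set.Icc 0 t ⊆ Set.Icc 0 T := Set.Icc_subset_Icc_right ht.2
      have hint : ∀ k, IntervalIntegrable (fun τ => ‖G k τ‖) MeasureTheory.volume 0 t := fun k =>
        ((hGc k).mono hsub).norm.intervalIntegrable_of_Icc ht.1
      have hL0 : 0 ≤ L := (mul_nonneg hemb (norm_nonneg _)).trans (hWL t ht)
      calc ∑ k ∈ S, ‖D k t‖ ≤ ∑ k ∈ S, ∫ τ in (0 : ℝ)..t, ‖G k τ‖ :=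
            Finset.sum_le_sum fun k _ =>
              norm_le_integral_of_damped (symbol_nonneg _) (hDd k) (hGc k) (hD0 k) ht
        _ = ∫ τ in (0 : ℝ)..t, ∑ k ∈ S, ‖G k τ‖ :=
            (intervalIntegral.integral_finsetSum fun k _ => hint k).symm
        _ ≤ ∫ τ in (0 : ℝ)..t, C * (2 * L) / 2 ^ n * Real.exp (2 * C * τ) := by
            refine intervalIntegral.integral_mono_on ht.1 ?_
              (Continuous.intervalIntegrable (by fun_prop) _ _) fun τ hτ => ?_
            · simpa only [Finset.sum_fn] using IntervalIntegrable.sum S (fun k _ => hint k)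
            have hτ' := hsub hτ
            have h1 := ih τ hτ'
            have h2 := l1Bound_cube_sub_coeff hQ he hs (hWL' τ hτ') (hWL τ hτ') h1
            have h3 : L1Bound (fun k => ‖G k τ‖) (C * (2 * L * Real.exp (2 * C * τ) / 2 ^ n)) := by
              refine ((h1.const_mul (abs_nonneg μ)).add h2).mono (fun k => ?_) ?_
              · refine (norm_sub_le _ _).trans (add_le_add (le_of_eq ?_) le_rfl)
                rw [norm_mul, Complex.norm_real, Real.norm_eq_abs]
              · have h4 := h1.nonneg
                rw [hC]
                linarith
            exact (h3 S).trans (le_of_eq (by ring))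
        _ = C * (2 * L) / 2 ^ n * ∫ τ in (0 : ℝ)..t, Real.exp (2 * C * τ) :=
            intervalIntegral.integral_const_mul _ _
        _ ≤ C * (2 * L) / 2 ^ n * (1 / (2 * C) * Real.exp (2 * C * t)) := by
            gcongr
            exact integral_exp_le (Or.inl ⟨by positivity, by rw [one_div_mul_cancel (by positivity)]⟩)
              ht
        _ = 2 * L * Real.exp (2 * C * t) / 2 ^ (n + 1) := by
            rw [pow_succ]
            field_simp
  intro t ht
  refine Hs.ext fun k => sub_eq_zero.1 (norm_le_zero_iff.1 ?_)
  have h1 : Filter.Tendsto (fun n : ℕ => 2 * L * Real.exp (2 * C * t) * (1 / 2) ^ n) Filter.atTop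
      (nhds 0) := by
    simpa using (tendsto_pow_atTop_nhds_zero_of_lt_one (r := (1 / 2 : ℝ)) (by norm_num)
      (by norm_num)).const_mul (2 * L * Real.exp (2 * C * t))
  refine ge_of_tendsto' h1 fun n => ((hstep n t ht).le k).trans (le_of_eq ?_)
  rw [one_div, inv_pow, div_eq_mul_inv]

end Uniqueness
end
end SwiftHohenberg

namespace SwiftHohenberg
noncomputable section

/-! ### Assembly of the theorem. -/

section Main
variable {Q : ℕ}

/-- The solution with the coefficients of the approximate quasipattern as initial value, for all
values of the parameter. -/
theorem exists_coeffSolution_patternR [NeZero Q] (hQ : 8 ≤ Q) (he : Even Q) {ρ γ R c : ℝ}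
    (hρ : 0 < ρ) (hc : 0 < c) (hcR : c < R) (hγ : 0 ≤ γ) (hG : GevreyL1 Q (formalSeq Q) ρ γ R) :
    ∃ α C : ℝ, 0 < α ∧ 0 < C ∧ ∀ ν : ℝ, 0 < ν → ∀ (T : ℝ) (hT : 0 ≤ T),
      T * (ν ^ (4 * ell Q) * ν) ≤ α → ∃ U : quasilattice Q → Path T, RotInv U ∧
        IsCoeffSolution hT (ν ^ (4 * ell Q)) (patternR Q c ν) U ∧
        L1Bound (fun k => expWeight Q (ρ / 2) k * ‖U k - ContinuousMap.const _ (patternR Q c ν k)‖)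
          (C * Real.exp (-c / ν)) := by
  obtain ⟨α₁, ν₀, C₁, hα₁, hν₀, hC₁, h₁⟩ := exists_coeffSolution_small hQ he hρ hc hcR hγ hG
  obtain ⟨α₂, C₂, hα₂, hC₂, h₂⟩ := exists_coeffSolution_large hQ he hρ hc hcR hγ hG hν₀
  refine ⟨min α₁ α₂, max C₁ C₂, lt_min hα₁ hα₂, lt_max_of_lt_left hC₁, fun ν hν T hT hTα => ?_⟩
  have hE := Real.exp_pos (-c / ν)
  rcases le_total ν ν₀ with h | h
  · obtain ⟨U, a, b, d⟩ := h₁ ν hν h T hT (hTα.trans (min_le_left _ _))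
    exact ⟨U, a, b, d.mono (fun _ => le_rfl) (by gcongr; exact le_max_left _ _)⟩
  · obtain ⟨U, a, b, d⟩ := h₂ ν h T hT (hTα.trans (min_le_right _ _))
    exact ⟨U, a, b, d.mono (fun _ => le_rfl) (by gcongr; exact le_max_right _ _)⟩

/-- The coefficients are real and, -1 being a rotation, even in k. -/
theorem realValued_stateC {T : ℝ} (hT : 0 ≤ T) (hQ : Q ≠ 0) (he : Even Q)
    {U : quasilattice Q → Path T} (hU : RotInv U) (t : ℝ) : RealValued Q (stateC hT U t) :=
  fun k k' hk => by
    simp only [stateC, toC]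
    rw [hU.apply_neg hQ he k k' hk, Complex.conj_ofReal]

theorem exists_evolution [NeZero Q] (hQ : 8 ≤ Q) (he : Even Q) (s : ℝ)
    {ρ γ R c : ℝ} (hρ : 0 < ρ) (hc : 0 < c) (hcR : c < R) (hγ : 0 ≤ γ)
    (hG : GevreyL1 Q (formalSeq Q) ρ γ R) :
    ∃ α C : ℝ, 0 < α ∧ 0 < C ∧ ∀ ν : ℝ, 0 < ν →
      MemHs Q (s + 4) (toC (patternR Q c ν)) ∧ ∃ Ubar : Hs Q s,
        Ubar.coeff = toC (patternR Q c ν) ∧ ∀ T : ℝ, 0 ≤ T → T * (ν ^ (4 * ell Q) * ν) ≤ α →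
        ∃ W : ℝ → Hs Q s, IsSolution Q s (ν ^ (4 * ell Q)) T Ubar.coeff W ∧
          ∀ t, RealValued Q (W t).coeff ∧ ‖W t - Ubar‖ ≤ C * Real.exp (-c / ν) := by
  have hl := one_le_ell hQ he
  have hρ2 : 0 < ρ / 2 := by positivity
  obtain ⟨α, C, hα, hC, h⟩ := exists_coeffSolution_patternR hQ he hρ hc hcR hγ hG
  obtain ⟨C₀, hC₀, hpat⟩ := exists_l1Bound_patternR hl hρ.le hc hcR hγ hG
  obtain ⟨S, hS, hsob⟩ := exists_sobolev_const Q s hρ2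
  obtain ⟨S', hS', hsob'⟩ := exists_sobolev_const Q (s + 4) hρ2
  refine ⟨α, S * C, hα, by positivity, fun ν hν => ?_⟩
  have hp : L1Bound (fun k => expWeight Q (ρ / 2) k * ‖patternR Q c ν k‖) C₀ :=
    (hpat ν hν).mono (fun k => mul_le_mul_of_nonneg_right (expWeight_mono (by linarith) k)
      (norm_nonneg _)) le_rfl
  have hpC : L1Bound (fun k => expWeight Q (ρ / 2) k * ‖toC (patternR Q c ν) k‖) C₀ := by
    simpa only [norm_toC] using hp
  refine ⟨(hsob' _ _ hpC).1, Hs.mk _ (hsob _ _ hpC).1, rfl, fun T hT hTα => ?_⟩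
  obtain ⟨U, hrot, hsol, hb⟩ := h ν hν T hT hTα
  have hUb : L1Bound (fun k => expWeight Q (ρ / 2) k * ‖U k‖)
      (C * Real.exp (-c / ν) + C₀) := (hb.add hp).mono (fun k => by
    rw [← mul_add]
    refine mul_le_mul_of_nonneg_left ?_ (Real.exp_pos _).le
    have h1 : ‖(ContinuousMap.const _ (patternR Q c ν k) : Path T)‖ ≤ ‖patternR Q c ν k‖ :=
      (ContinuousMap.norm_le _ (norm_nonneg _)).2 fun t => le_rfl
    calc ‖U k‖ = ‖U k - ContinuousMap.const _ (patternR Q c ν k)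
          + ContinuousMap.const _ (patternR Q c ν k)‖ := by rw [sub_add_cancel]
      _ ≤ _ := (norm_add_le _ _).trans (add_le_add le_rfl h1)) le_rfl
  set W : ℝ → Hs Q s := fun t => Hs.mk (stateC hT U t) (memHs_stateC hT hρ2 hUb t) with hW
  refine ⟨W, hsol.isSolution hT hρ2 hUb fun t => rfl, fun t => ⟨?_, ?_⟩⟩
  · exact realValued_stateC hT (NeZero.ne Q) he hrot t
  · refine ((hsob (W t - Hs.mk _ (hsob _ _ hpC).1).coeff (C * Real.exp (-c / ν))
      (hb.mono (fun k => ?_) le_rfl)).2 _ rfl).trans (le_of_eq (by ring))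
    refine mul_le_mul_of_nonneg_left ?_ (Real.exp_pos _).le
    have h1 : (W t - Hs.mk _ (hsob _ _ hpC).1).coeff k
        = ((Path.ext hT (U k - ContinuousMap.const _ (patternR Q c ν k)) t : ℝ) : ℂ) :=
      (Complex.ofReal_sub _ _).symm
    rw [h1, Complex.norm_real]
    exact norm_ext_le hT _ t

end Main
end
end SwiftHohenberg

theorem mainTheorem5 (Q : ℕ) (hQ : 8 ≤ Q) (hQeven : Even Q) (s : ℝ) (hs : (Q : ℝ) / 4 < s) :
    ∃ U : ℕ → SwiftHohenberg.Coeffs Q,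
      SwiftHohenberg.IsFormalSolution Q s U ∧
      (∀ V, SwiftHohenberg.IsFormalSolution Q s V → V = U) ∧
      (∃ K : ℝ, 0 < K ∧ SwiftHohenberg.GevreyBound Q s U K) ∧
      ∀ K : ℝ, 0 < K → SwiftHohenberg.GevreyBound Q s U K →
      ∀ K' : ℝ, K ^ (1 / (4 * (SwiftHohenberg.ell Q : ℝ))) < K' →
      ∃ α : ℝ, 0 < α ∧ ∃ C' : ℝ, 0 < C' ∧ ∀ μ : ℝ, 0 < μ →
        SwiftHohenberg.MemHs Q (s + 4) (SwiftHohenberg.approxPattern Q U K' μ) ∧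
        ∃ Ubar : SwiftHohenberg.Hs Q s,
          Ubar.coeff = SwiftHohenberg.approxPattern Q U K' μ ∧
          ∃ W : ℝ → SwiftHohenberg.Hs Q s,
            SwiftHohenberg.IsSolution Q s μ
              (α / μ ^ (1 + 1 / (4 * (SwiftHohenberg.ell Q : ℝ)))) Ubar.coeff W ∧
            (∀ T : ℝ, 0 < T → T ≤ α / μ ^ (1 + 1 / (4 * (SwiftHohenberg.ell Q : ℝ))) →
              ∀ W' : ℝ → SwiftHohenberg.Hs Q s,
                SwiftHohenberg.IsSolution Q s μ T Ubar.coeff W' →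
                Set.EqOn W' W (Set.Icc (0 : ℝ) T)) ∧
            ∀ t ∈ Set.Icc (0 : ℝ) (α / μ ^ (1 + 1 / (4 * (SwiftHohenberg.ell Q : ℝ)))),
              SwiftHohenberg.RealValued Q (W t).coeff ∧
              ‖W t - Ubar‖ ≤
                C' * Real.exp (-((1 / K') / μ ^ (1 / (4 * (SwiftHohenberg.ell Q : ℝ))))) := by
  open SwiftHohenberg in
  have hQ0 : Q ≠ 0 := by omega
  have : NeZero Q := ⟨hQ0⟩
  have hl := one_le_ell hQ hQeven
  have hl' : (0 : ℝ) < 4 * (ell Q : ℝ) := by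
    have : (1 : ℝ) ≤ ell Q := by exact_mod_cast hl
    linarith
  have hU := isFormalSolution_formalSeq (by omega) hQeven s
  refine ⟨fun n => toC (formalSeq Q n), hU,
    fun V hV => formalSolution_unique (by omega) hQeven hs hU hV,
    exists_gevreyBound hQ hQeven s, fun K hK hGK K' hK' => ?_⟩
  -- R > 1/K' = c, so the Borel series converges on the whole interval of integration with room to
  -- spare.
  obtain ⟨ρ, γ, R, hρ, hγ, hR, hG⟩ := exists_gevreyL1 hQ hQeven hs hK hGK hK'
  have hK'0 : 0 < K' := (Real.rpow_pos_of_pos hK _).trans hK'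
  obtain ⟨α, C, hα, hC, h⟩ := exists_evolution hQ hQeven s hρ (c := 1 / K') (by positivity) hR
    hγ.le hG
  refine ⟨α, hα, C, hC, fun μ hμ => ?_⟩
  set ν := μ ^ (1 / (4 * (ell Q : ℝ))) with hν
  have hν0 : 0 < ν := Real.rpow_pos_of_pos hμ _
  have hνμ : ν ^ (4 * ell Q) = μ := by
    rw [hν, ← Real.rpow_natCast, ← Real.rpow_mul hμ.le]
    push_cast
    rw [one_div_mul_cancel hl'.ne', Real.rpow_one]
  -- The exponent 1 + 1/4l is the time scale 1/(μν) on which the weight shrinks.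
  have hμν : μ ^ (1 + 1 / (4 * (ell Q : ℝ))) = μ * ν := by
    rw [Real.rpow_add hμ, Real.rpow_one]
  have happ : approxPattern Q (fun n => toC (formalSeq Q n)) K' μ = toC (patternR Q (1 / K') ν) :=
    truncLaplace_formalSeq hl hρ.le hK'0 hR hG
  obtain ⟨h1, Ubar, h2, h3⟩ := h ν hν0
  rw [hνμ] at h3
  rw [happ, hμν]
  have hT : 0 ≤ α / (μ * ν) := by positivity
  obtain ⟨W, h4, h5⟩ := h3 _ hT (by rw [div_mul_cancel₀ _ (by positivity)])
  refine ⟨h1, Ubar, h2, W, h4, fun T hT0 hTα W' hW' => ?_, fun t _ => ?_⟩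
  · exact isSolution_unique hQ0 hQeven hs (h4.mono hTα) hW'
  · refine ⟨(h5 t).1, (h5 t).2.trans (le_of_eq ?_)⟩
    rw [neg_div]
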